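/- **Main Theorem.** A map $f\colon[0,1]\to[0,1]$ is called $C^2$ *unimodal*, written $f\in\mathcal{U}^2$, if there exists $c\in(0,1)$ such that 1. $f$ is $C^2$ and $f'\neq 0$ on $[0,1]\setminus\{c\}$ (one-sided at the endpoints $0$ and $1$); 2. there exist real numbers $\ell_-,\ell_+\ge 1$, a neighbourhood $U\subset[0,1]$ of $c$, and $C^2$ diffeomorphisms $\phi_-,\phi_+,\varphi_-,\varphi_+$ of $\mathbb{R}$ with $\phi_\pm(c)=\varphi_\pm(f(c))=0$ such that $|\varphi_-(f(x))|=|\phi_-(x)|^{\ell_-}$ for every $x\in U$ with $x\le c$, and $|\varphi_+(f(x))|=|\phi_+(x)|^{\ell_+}$ for every $x\in U$ with $x\ge c$. The two critical orders may be different ($\ell_-\neq\ell_+$), so asymmetric maps are included. A *wandering interval* of $f$ is a nondegenerate interval $J\subset[0,1]$ such that the sets $J, f(J), f^2(J),\dots$ are pairwise disjoint and, for each $x\in J$, the $\omega$-limit set $\omega(x)$ of $x$ under $f$ is not a periodic orbit. Then every $f\in\mathcal{U}^2$ has no wandering interval. -/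

import Mathlib

open Set Filter Topology
open scoped Manifold ContDiff

/-- `HasCriticalOrder r f c ℓ s`: on the part of some neighbourhood of `c` that lies in `s`, one has
`|ψ (f x)| = |φ x| ^ ℓ` for `C^r` diffeomorphisms `φ, ψ` of `ℝ` with `φ c = 0` and `ψ (f c) = 0`.
It is used with the half-lines `s = (-∞, c]` and `s = [c, ∞)`. -/
def HasCriticalOrder (r : WithTop ℕ∞) (f : ℝ → ℝ) (c ℓ : ℝ) (s : Set ℝ) : Prop :=
  ∃ φ ψ : Diffeomorph 𝓘(ℝ, ℝ) 𝓘(ℝ, ℝ) ℝ ℝ r, φ c = 0 ∧ ψ (f c) = 0 ∧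
    ∃ U ∈ 𝓝 c, ∀ x ∈ U, x ∈ s → |ψ (f x)| = |φ x| ^ ℓ

/-- The class of `C^r` unimodal maps of `[0,1]`. A map `[0,1] → [0,1]` is given by a function
`f : ℝ → ℝ` that maps `[0,1]` into itself; the values of `f` outside `[0,1]` play no role.
Smoothness and derivatives at the endpoints `0` and `1` are one-sided. -/
def UnimodalMaps (r : WithTop ℕ∞) : Set (ℝ → ℝ) :=
  {f | MapsTo f (Icc 0 1) (Icc 0 1) ∧
    ∃ c ∈ Ioo (0 : ℝ) 1,
      ContDiffOn ℝ r f (Icc 0 1 \ {c}) ∧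
      (∀ x ∈ Icc (0 : ℝ) 1 \ {c}, derivWithin f (Icc 0 1) x ≠ 0) ∧
      ∃ ℓm ℓp : ℝ, 1 ≤ ℓm ∧ 1 ≤ ℓp ∧
        HasCriticalOrder r f c ℓm (Iic c) ∧ HasCriticalOrder r f c ℓp (Ici c)}

/-- The ω-limit set of the point `x` under iteration of `f`. -/
def omegaSet (f : ℝ → ℝ) (x : ℝ) : Set ℝ :=
  omegaLimit atTop (fun (n : ℕ) (y : ℝ) => f^[n] y) {x}

/-- `A` is the (forward) orbit of a periodic point of `f`. -/
def IsPeriodicOrbit (f : ℝ → ℝ) (A : Set ℝ) : Prop :=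
  ∃ p ∈ Function.periodicPts f, A = range fun n : ℕ => f^[n] p

/-- `J` is a wandering interval of `f : [0,1] → [0,1]`: a nondegenerate interval (open, closed or
half-open) whose forward images are pairwise disjoint and none of whose points has a periodic
orbit as its ω-limit set. -/
def IsWanderingInterval (f : ℝ → ℝ) (J : Set ℝ) : Prop :=
  J ⊆ Icc 0 1 ∧ J.OrdConnected ∧ J.Nontrivial ∧
    (∀ m n : ℕ, m ≠ n → Disjoint (f^[m] '' J) (f^[n] '' J)) ∧
    ∀ x ∈ J, ¬ IsPeriodicOrbit f (omegaSet f x)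

/-! A wandering interval is excluded by following its closest approaches to the turning point, with
cross-ratios as the measure of distortion.

Setting. After a flip and an extension beyond `[0,1]` the map is a unimodal `F` with maximum at `c`,
and both ends of `[a, b]` go to the fixed point `a`. The assumption on ω-limit sets enters only
through `NoInjectiveReturn`: an interval that meets the orbit and is mapped injectively into itself
by an iterate forces convergence to a periodic orbit. The wandering interval is replaced by a
maximal interval `[α, β]` of points that never hit `c` (`exists_wanderingSystem`).

Distortion. A C² change of coordinates alters a cross-ratio by a factor exponential in the length
involved, and `x ^ ℓ` with `ℓ ≥ 1` does not decrease it (`crossRatio_le_rpow`). Hence neither branch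
of `F` shrinks cross-ratios by more than such a factor. For an iterate the exponents add up, and
their sum is bounded as soon as the successive images cover no point more than three times
(`UnimodalSystem.koebe`).

Records. Closeness to `c` is measured at the critical value, by `inGap` and `outGap`, which makes
the two sides of `c` comparable. Bounded distortion away from `c` yields infinitely many records
(`exists_inGap_lt`). For consecutive records `p < n < q` a branch of `F^[n + 1]` around `[α, β]`
reaches half way into the neighbouring images with bounded distortion (`koebe_record`). Since `[α,
β]` is maximal, the branch extends very little beyond `α`, so a huge cross-ratio is transported to
the image; this makes `inGap / outGap` tend to zero along the records (`exists_inGap_le`).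

Asymmetry. Between consecutive records `n` and `m = n + 1 + k` the branch of `F^[k]` over the level
set `{F > loEnd F α β (n + 1)}` again has bounded distortion (`koebe_return`). As the relative gap
at `n` is small, there are two cases. Either the branch ends before the critical value, and the
level set is very short on the side of `c` opposite to the `m`-th interval; or the critical orbit
returns, on that opposite side and very close to `c`. A run of returns with the same time `k` must
end. At its end, and at every non-return, the power laws on the two sides show that the interval
lies on the side of strictly larger order (`PowerLaw.order_lt`). All late records therefore lie on
one side, whose order `L` exceeds 1.

Growth. Write `f` for the far distance to `c` and `δ` for the gap ratio. Up to constants, every step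
gives `δ_m ≤ δ_n ^ L` and `f_n ^ L ≤ f_m`, and a non-return improves the latter to `f_n ^ L ≤ δ_n *
f_m` (`step_bounds`). So `-log f` grows at most, and `-log δ` at least, by the factor `L`; their
corrected ratio never increases and drops by `1 / L` at each non-return. The step following a run is
a non-return (`not_isReturn_of_run_end`), so there are infinitely many drops of a positive quantity,
which is absurd (`false_of_growth`). -/

/-! ### Unimodal maps of the line and the branches of their iterates -/

/-- A continuous map of the line that increases up to `c`, decreases afterwards, and maps `[a, b]`
into itself and the boundary of `[a, b]` to the fixed point `a`. -/
structure UnimodalSystem (F : ℝ → ℝ) (a c b : ℝ) : Prop where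
  cont : Continuous F
  mono : StrictMonoOn F (Iic c)
  anti : StrictAntiOn F (Ici c)
  lt_left : a < c
  lt_right : c < b
  left_fixed : F a = a
  right_image : F b = a
  peak_le : F c ≤ b

/-- The first `k` iterates of points of `S` avoid `c`. -/
def FreeOn (F : ℝ → ℝ) (c : ℝ) (k : ℕ) (S : Set ℝ) : Prop :=
  ∀ i < k, ∀ x ∈ S, F^[i] x ≠ c

/-- No point of the orbit of `x` lies in an interval that some iterate of `F` maps injectively into
itself. -/
def NoInjectiveReturn (F : ℝ → ℝ) (x : ℝ) : Prop :=
  ∀ (n p : ℕ) (L : Set ℝ), 1 ≤ p → L.OrdConnected → F^[n] x ∈ L → MapsTo F^[p] L L →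
    InjOn F^[p] L → False

theorem image_uIcc_of_injOn {g : ℝ → ℝ} {x y : ℝ} (hg : Continuous g)
    (hi : InjOn g (uIcc x y)) : g '' uIcc x y = uIcc (g x) (g y) := by
  apply Subset.antisymm
  · rintro _ ⟨z, hz, rfl⟩
    wlog hxy : x ≤ y generalizing x y
    · rw [uIcc_comm]
      exact this (by rwa [uIcc_comm]) (by rwa [uIcc_comm]) (le_of_not_ge hxy)
    rw [uIcc_of_le hxy] at hi hz
    rcases hg.continuousOn.strictMonoOn_of_injOn_Icc' hxy hi with h | h
    · exact mem_uIcc.2 (Or.inl ⟨h.monotoneOn (left_mem_Icc.2 hxy) hz hz.1,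
        h.monotoneOn hz (right_mem_Icc.2 hxy) hz.2⟩)
    · exact mem_uIcc.2 (Or.inr ⟨h.antitoneOn hz (right_mem_Icc.2 hxy) hz.2,
        h.antitoneOn (left_mem_Icc.2 hxy) hz hz.1⟩)
  · exact intermediate_value_uIcc hg.continuousOn

theorem mem_uIcc_of_injOn {g : ℝ → ℝ} {x y z : ℝ} (hg : Continuous g)
    (hi : InjOn g (uIcc x y)) (hz : z ∈ uIcc x y) : g z ∈ uIcc (g x) (g y) := by
  rw [← image_uIcc_of_injOn hg hi]; exact mem_image_of_mem _ hz

theorem ordConnected_image {g : ℝ → ℝ} {S : Set ℝ} (hg : Continuous g) (hS : S.OrdConnected) :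
    (g '' S).OrdConnected :=
  (hS.isPreconnected.image _ hg.continuousOn).ordConnected

theorem FreeOn.mono {F : ℝ → ℝ} {c : ℝ} {k l : ℕ} {S T : Set ℝ} (h : FreeOn F c k S) (hl : l ≤ k)
    (hT : T ⊆ S) : FreeOn F c l T :=
  fun i hi x hx => h i (hi.trans_le hl) x (hT hx)

theorem FreeOn.image {F : ℝ → ℝ} {c : ℝ} {k j : ℕ} {S : Set ℝ} (h : FreeOn F c (k + j) S) :
    FreeOn F c k (F^[j] '' S) := by
  rintro i hi _ ⟨x, hx, rfl⟩
  rw [← Function.iterate_add_apply]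
  exact h (i + j) (by omega) x hx

namespace UnimodalSystem

variable {F : ℝ → ℝ} {a c b : ℝ}

theorem cont_iterate (h : UnimodalSystem F a c b) (k : ℕ) : Continuous F^[k] :=
  h.cont.iterate k

theorem lt_peak (h : UnimodalSystem F a c b) {x : ℝ} (hx : x ≠ c) : F x < F c := by
  rcases lt_or_gt_of_ne hx with hx | hx
  · exact h.mono (mem_Iic.2 hx.le) (mem_Iic.2 le_rfl) hx
  · exact h.anti (mem_Ici.2 le_rfl) (mem_Ici.2 hx.le) hx

theorem le_peak (h : UnimodalSystem F a c b) (x : ℝ) : F x ≤ F c := by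
  rcases eq_or_ne x c with rfl | hx
  · exact le_rfl
  · exact (h.lt_peak hx).le

theorem mapsTo (h : UnimodalSystem F a c b) : MapsTo F (Icc a b) (Icc a b) := by
  intro x hx
  refine ⟨?_, (h.le_peak x).trans h.peak_le⟩
  rcases le_total x c with hxc | hxc
  · calc a = F a := h.left_fixed.symm
      _ ≤ F x := h.mono.monotoneOn (mem_Iic.2 h.lt_left.le) (mem_Iic.2 hxc) hx.1
  · calc a = F b := h.right_image.symm
      _ ≤ F x := h.anti.antitoneOn (mem_Ici.2 hxc) (mem_Ici.2 h.lt_right.le) hx.2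

theorem iterate_mem (h : UnimodalSystem F a c b) {x : ℝ} (hx : x ∈ Icc a b) (k : ℕ) :
    F^[k] x ∈ Icc a b :=
  h.mapsTo.iterate k hx

theorem injOn_side (h : UnimodalSystem F a c b) {S : Set ℝ} (hS : S ⊆ Iic c ∨ S ⊆ Ici c) :
    InjOn F S := by
  rcases hS with hS | hS
  · exact h.mono.injOn.mono hS
  · exact h.anti.injOn.mono hS

theorem side_of_notMem {S : Set ℝ} (hS : S.OrdConnected) (hc : c ∉ S) : S ⊆ Iio c ∨ S ⊆ Ioi c := by
  by_contra! hcon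
  obtain ⟨h1, h2⟩ := hcon
  obtain ⟨x, hx, hxc⟩ := not_subset.1 h1
  obtain ⟨y, hy, hyc⟩ := not_subset.1 h2
  exact hc (hS.out hy hx ⟨not_lt.1 hyc, not_lt.1 hxc⟩)

theorem injOn_of_notMem (h : UnimodalSystem F a c b) {S : Set ℝ} (hS : S.OrdConnected)
    (hc : c ∉ S) : InjOn F S :=
  h.injOn_side ((side_of_notMem hS hc).imp (fun h => h.trans Iio_subset_Iic_self)
    (fun h => h.trans Ioi_subset_Ici_self))

theorem injOn_iterate (h : UnimodalSystem F a c b) {S : Set ℝ} (hS : S.OrdConnected) {k : ℕ}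
    (hf : FreeOn F c k S) : InjOn F^[k] S := by
  induction k with
  | zero => simp
  | succ k ih =>
    rw [Function.iterate_succ']
    refine InjOn.comp (t := F^[k] '' S) ?_ (ih (hf.mono (Nat.le_succ k) Subset.rfl))
      (mapsTo_image _ _)
    refine h.injOn_of_notMem (ordConnected_image (h.cont_iterate k) hS) ?_
    rintro ⟨x, hx, hxc⟩
    exact hf k (Nat.lt_succ_self k) x hx hxc

theorem image_uIcc (h : UnimodalSystem F a c b) {k : ℕ} {x y : ℝ} (hf : FreeOn F c k (uIcc x y)) :
    F^[k] '' uIcc x y = uIcc (F^[k] x) (F^[k] y) :=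
  image_uIcc_of_injOn (h.cont_iterate k) (h.injOn_iterate ordConnected_uIcc hf)

theorem mem_uIcc_iterate (h : UnimodalSystem F a c b) {k : ℕ} {x y z : ℝ}
    (hf : FreeOn F c k (uIcc x y)) (hz : z ∈ uIcc x y) : F^[k] z ∈ uIcc (F^[k] x) (F^[k] y) :=
  mem_uIcc_of_injOn (h.cont_iterate k) (h.injOn_iterate ordConnected_uIcc hf) hz

/-- Extension of a branch of `F^[k]` over an open target interval: from `y` one can move in the
direction `s` until the branch breaks at `c` or its image reaches the boundary of the target. -/
theorem exists_extension (h : UnimodalSystem F a c b) {k : ℕ} {y P Q s : ℝ}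
    (hs : s = 1 ∨ s = -1) (hy : y ∈ Icc a b) (hP : a ≤ P) (hQ : Q ≤ b)
    (hfree : FreeOn F c k {y}) (hyM : F^[k] y ∈ Ioo P Q) :
    ∃ z ∈ Icc a b, 0 < s * (z - y) ∧
      (∀ x ∈ uIcc y z, x ≠ z → (∀ i < k, F^[i] x ≠ c) ∧ F^[k] x ∈ Ioo P Q) ∧
      ((∃ i < k, F^[i] z = c) ∨ F^[k] z = P ∨ F^[k] z = Q) := by
  -- The end of `[a, b]` in the direction `s` serves as `w`: every iterate sends `a`, and every
  -- positive iterate sends `b`, to `a ≤ P`. For `k = 0` at `b` the bound `Q ≤ b` takes over.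
  obtain ⟨w, hw, hwy, hwM⟩ : ∃ w ∈ Icc a b, 0 ≤ s * (w - y) ∧ F^[k] w ∉ Ioo P Q := by
    have ha : ∀ k, F^[k] a = a := fun k => Function.iterate_fixed h.left_fixed k
    have hab : a ≤ b := (h.lt_left.trans h.lt_right).le
    rcases hs with rfl | rfl
    · refine ⟨b, right_mem_Icc.2 hab, by linarith [hy.2], ?_⟩
      cases k with
      | zero => exact fun hh => absurd hh.2 (not_lt.2 (by simpa using hQ))
      | succ k =>
        rw [Function.iterate_succ_apply, h.right_image, ha]
        exact fun hh => absurd hh.1 (not_lt.2 hP)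
    · refine ⟨a, left_mem_Icc.2 hab, by linarith [hy.1], ?_⟩
      rw [ha]
      exact fun hh => absurd hh.1 (not_lt.2 hP)
  have hss : s * s = 1 := by rcases hs with rfl | rfl <;> norm_num
  set γ : ℝ → ℝ := fun t => y + s * t with hγ
  have hγc : Continuous γ := by fun_prop
  set good : Set ℝ := {x | (∀ i < k, F^[i] x ≠ c) ∧ F^[k] x ∈ Ioo P Q} with hgood
  have hopen : IsOpen good := by
    have : good = (⋂ i ∈ Finset.range k, {x | F^[i] x ≠ c}) ∩ F^[k] ⁻¹' Ioo P Q := by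
      ext x; simp [hgood]
    rw [this]
    refine IsOpen.inter (isOpen_biInter_finset fun i _ => ?_) (isOpen_Ioo.preimage (h.cont_iterate k))
    exact isOpen_ne.preimage (h.cont_iterate i)
  set B : Set ℝ := Icc 0 (s * (w - y)) ∩ γ ⁻¹' goodᶜ with hB
  have hBc : IsCompact B := isCompact_Icc.inter_right (hopen.isClosed_compl.preimage hγc)
  have hBne : B.Nonempty := by
    refine ⟨s * (w - y), ⟨hwy, le_rfl⟩, ?_⟩
    have : γ (s * (w - y)) = w := by
      simp only [hγ]; linear_combination (w - y) * hss
    rw [mem_preimage, this]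
    exact fun hh => hwM hh.2
  -- The good set is open, so there is a first bad parameter. By continuity the image there is still
  -- in `[P, Q]`, so goodness can fail only by hitting `c` or an end of the target.
  obtain ⟨t, htB, htmin⟩ := hBc.exists_isLeast hBne
  have hygood : y ∈ good := ⟨fun i hi => hfree i hi y rfl, hyM⟩
  have ht0 : 0 < t := by
    rcases htB.1.1.eq_or_lt with h0 | h0
    · exfalso; apply htB.2; simpa [hγ, ← h0] using hygood
    · exact h0
  have hbelow : ∀ t', 0 ≤ t' → t' < t → γ t' ∈ good := by
    intro t' h0 h1
    by_contra hcon
    exact absurd (htmin ⟨⟨h0, h1.le.trans htB.1.2⟩, hcon⟩) (not_le.2 h1)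
  have htw := htB.1.2
  refine ⟨γ t, ?_, ?_, ?_, ?_⟩
  · rcases hs with rfl | rfl <;> simp only [hγ, mem_Icc] <;> constructor <;>
      linarith [hy.1, hy.2, hw.1, hw.2]
  · have : s * (γ t - y) = t := by simp only [hγ]; linear_combination t * hss
    rwa [this]
  · intro x hx hxz
    have hxγ : x = γ (s * (x - y)) := by simp only [hγ]; linear_combination (y - x) * hss
    rw [hxγ]
    apply hbelow
    · rcases hs with rfl | rfl <;> rcases mem_uIcc.1 hx with hx | hx <;> simp only [hγ] at hx <;>
        linarith [hx.1, hx.2]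
    · have hle : s * (x - y) ≤ t := by
        rcases hs with rfl | rfl <;> rcases mem_uIcc.1 hx with hx | hx <;> simp only [hγ] at hx <;>
        linarith [hx.1, hx.2]
      exact lt_of_le_of_ne hle fun hh => hxz (by rw [hxγ, hh])
  · by_contra! hcon
    apply htB.2
    refine ⟨hcon.1, ?_⟩
    have hcl : F^[k] (γ t) ∈ closure (Ioo P Q) := by
      have hlim : Tendsto (fun t' => F^[k] (γ t')) (𝓝[<] t) (𝓝 (F^[k] (γ t))) :=
        ((h.cont_iterate k).comp hγc).continuousAt.tendsto.mono_left nhdsWithin_le_nhds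
      refine mem_closure_of_tendsto hlim ?_
      have : Ioo 0 t ∈ 𝓝[<] t := Ioo_mem_nhdsLT ht0
      filter_upwards [this] with t' ht'
      exact (hbelow t' ht'.1.le ht'.2).2
    rw [closure_Ioo (hyM.1.trans hyM.2).ne] at hcl
    exact ⟨lt_of_le_of_ne hcl.1 (Ne.symm hcon.2.1), lt_of_le_of_ne hcl.2 hcon.2.2⟩

end UnimodalSystem

/-! ### Cross-ratios and the Koebe principle -/

/-- The cross-ratio of the middle interval `[x₂, x₃]` inside `[x₁, x₄]`. -/
noncomputable def crossRatio (x₁ x₂ x₃ x₄ : ℝ) : ℝ :=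
  |x₃ - x₂| * |x₄ - x₁| / (|x₂ - x₁| * |x₄ - x₃|)

/-- On each side of `c`, the map `F` does not contract cross-ratios by more than a factor that is
exponential in the length of the large interval. -/
def CrossRatioBound (F : ℝ → ℝ) (a c b C : ℝ) : Prop :=
  ∀ x₁ x₂ x₃ x₄, x₁ < x₂ → x₂ < x₃ → x₃ < x₄ → a ≤ x₁ → x₄ ≤ b → (x₄ ≤ c ∨ c ≤ x₁) →
    crossRatio x₁ x₂ x₃ x₄ ≤
      Real.exp (C * (x₄ - x₁)) * crossRatio (F x₁) (F x₂) (F x₃) (F x₄)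

/-- Four points in strictly monotone position. -/
def InOrder (x₁ x₂ x₃ x₄ : ℝ) : Prop :=
  (x₁ < x₂ ∧ x₂ < x₃ ∧ x₃ < x₄) ∨ (x₄ < x₃ ∧ x₃ < x₂ ∧ x₂ < x₁)

theorem crossRatio_reverse (x₁ x₂ x₃ x₄ : ℝ) : crossRatio x₄ x₃ x₂ x₁ = crossRatio x₁ x₂ x₃ x₄ := by
  unfold crossRatio
  rw [abs_sub_comm x₂ x₃, abs_sub_comm x₁ x₄, abs_sub_comm x₃ x₄, abs_sub_comm x₁ x₂,
    mul_comm |x₄ - x₃|]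

theorem crossRatio_nonneg (x₁ x₂ x₃ x₄ : ℝ) : 0 ≤ crossRatio x₁ x₂ x₃ x₄ := by
  unfold crossRatio; positivity

theorem CrossRatioBound.of_inOrder {F : ℝ → ℝ} {a c b C : ℝ} (h : CrossRatioBound F a c b C)
    {x₁ x₂ x₃ x₄ : ℝ} (hx : InOrder x₁ x₂ x₃ x₄) (hsub : uIcc x₁ x₄ ⊆ Icc a b)
    (hc : uIcc x₁ x₄ ⊆ Iic c ∨ uIcc x₁ x₄ ⊆ Ici c) :
    crossRatio x₁ x₂ x₃ x₄ ≤
      Real.exp (C * |x₄ - x₁|) * crossRatio (F x₁) (F x₂) (F x₃) (F x₄) := by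
  have h1 := hsub left_mem_uIcc
  have h4 := hsub right_mem_uIcc
  have hc1 := hc.imp (fun h => h left_mem_uIcc) (fun h => h left_mem_uIcc)
  have hc4 := hc.imp (fun h => h right_mem_uIcc) (fun h => h right_mem_uIcc)
  rcases hx with ⟨h12, h23, h34⟩ | ⟨h43, h32, h21⟩
  · rw [abs_of_pos (by linarith)]
    refine h _ _ _ _ h12 h23 h34 h1.1 h4.2 ?_
    exact hc.imp (fun h => h right_mem_uIcc) (fun h => h left_mem_uIcc)
  · rw [abs_of_neg (by linarith), ← crossRatio_reverse, ← crossRatio_reverse (F x₁), neg_sub]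
    refine h _ _ _ _ h43 h32 h21 h4.1 h1.2 ?_
    exact hc.imp (fun h => h left_mem_uIcc) (fun h => h right_mem_uIcc)

theorem InOrder.reverse {x₁ x₂ x₃ x₄ : ℝ} (h : InOrder x₁ x₂ x₃ x₄) : InOrder x₄ x₃ x₂ x₁ := by
  rcases h with h | h
  · exact Or.inr h
  · exact Or.inl h

theorem InOrder.image {g : ℝ → ℝ} {x₁ x₂ x₃ x₄ : ℝ} (h : InOrder x₁ x₂ x₃ x₄) (hg : Continuous g)
    (hi : InjOn g (uIcc x₁ x₄)) : InOrder (g x₁) (g x₂) (g x₃) (g x₄) := by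
  wlog h' : x₁ < x₂ ∧ x₂ < x₃ ∧ x₃ < x₄ generalizing x₁ x₂ x₃ x₄
  · exact (this h.reverse (by rwa [uIcc_comm]) (h.resolve_left h')).reverse
  obtain ⟨h12, h23, h34⟩ := h'
  have h14 : x₁ ≤ x₄ := by linarith
  rw [uIcc_of_le h14] at hi
  have m1 : x₁ ∈ Icc x₁ x₄ := ⟨by linarith, by linarith⟩
  have m2 : x₂ ∈ Icc x₁ x₄ := ⟨by linarith, by linarith⟩
  have m3 : x₃ ∈ Icc x₁ x₄ := ⟨by linarith, by linarith⟩
  have m4 : x₄ ∈ Icc x₁ x₄ := ⟨by linarith, by linarith⟩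
  rcases hg.continuousOn.strictMonoOn_of_injOn_Icc' h14 hi with hm | hm
  · exact Or.inl ⟨hm m1 m2 h12, hm m2 m3 h23, hm m3 m4 h34⟩
  · exact Or.inr ⟨hm m3 m4 h34, hm m2 m3 h23, hm m1 m2 h12⟩

namespace UnimodalSystem

variable {F : ℝ → ℝ} {a c b : ℝ}

/-- Each step costs a factor exponential in the length of the current image, and the exponents add.
Only the total length of the images remains to be controlled. -/
theorem crossRatio_le_iterate (h : UnimodalSystem F a c b) {C : ℝ} (hCR : CrossRatioBound F a c b C)
    {x₁ x₂ x₃ x₄ : ℝ} (hx : InOrder x₁ x₂ x₃ x₄) (hsub : uIcc x₁ x₄ ⊆ Icc a b) {k : ℕ}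
    (hf : FreeOn F c k (uIcc x₁ x₄)) :
    crossRatio x₁ x₂ x₃ x₄ ≤
      Real.exp (C * ∑ i ∈ Finset.range k, |F^[i] x₄ - F^[i] x₁|) *
        crossRatio (F^[k] x₁) (F^[k] x₂) (F^[k] x₃) (F^[k] x₄) := by
  induction k with
  | zero => simp
  | succ k ih =>
    have hfk := hf.mono (Nat.le_succ k) Subset.rfl
    have hord : InOrder (F^[k] x₁) (F^[k] x₂) (F^[k] x₃) (F^[k] x₄) :=
      hx.image (h.cont_iterate k) (h.injOn_iterate ordConnected_uIcc hfk)
    have himg := h.image_uIcc hfk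
    have hnc : c ∉ uIcc (F^[k] x₁) (F^[k] x₄) := by
      rw [← himg]
      rintro ⟨z, hz, hzc⟩
      exact hf k (Nat.lt_succ_self k) z hz hzc
    have hstep := hCR.of_inOrder hord
      (by rw [← himg]; rintro _ ⟨z, hz, rfl⟩; exact h.iterate_mem (hsub hz) k)
      ((side_of_notMem ordConnected_uIcc hnc).imp (fun h => h.trans Iio_subset_Iic_self)
        (fun h => h.trans Ioi_subset_Ici_self))
    simp only [Function.iterate_succ_apply']
    calc crossRatio x₁ x₂ x₃ x₄ ≤ _ := ih hfk
      _ ≤ Real.exp (C * ∑ i ∈ Finset.range k, |F^[i] x₄ - F^[i] x₁|) * _ :=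
        mul_le_mul_of_nonneg_left hstep (Real.exp_pos _).le
      _ = _ := by rw [← mul_assoc, ← Real.exp_add, Finset.sum_range_succ, mul_add]

end UnimodalSystem

/-- Lebesgue measure is additive on disjoint sets; half-open intervals are taken so that common
endpoints do no harm. -/
theorem sum_length_le {ι : Type*} {J : Finset ι} {u v : ι → ℝ} {a b : ℝ} (hab : a ≤ b)
    (huv : ∀ j ∈ J, u j ≤ v j) (hu : ∀ j ∈ J, a ≤ u j) (hv : ∀ j ∈ J, v j ≤ b)
    (hd : ∀ i ∈ J, ∀ j ∈ J, i ≠ j → v i ≤ u j ∨ v j ≤ u i) : ∑ j ∈ J, (v j - u j) ≤ b - a := by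
  have hdis : PairwiseDisjoint (↑J) (fun j => Ioc (u j) (v j)) := by
    intro i hi j hj hij
    rw [Function.onFun, Set.disjoint_left]
    intro x hxi hxj
    rcases hd i hi j hj hij with h | h
    · linarith [hxi.2, hxj.1]
    · linarith [hxj.2, hxi.1]
  have hm := MeasureTheory.measure_biUnion_finset (μ := MeasureTheory.volume) hdis
    (fun j _ => measurableSet_Ioc)
  have hsub : (⋃ j ∈ J, Ioc (u j) (v j)) ⊆ Ioc a b := by
    simp only [iUnion_subset_iff]
    exact fun j hj => Ioc_subset_Ioc (hu j hj) (hv j hj)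
  have hle := MeasureTheory.measure_mono (μ := MeasureTheory.volume) hsub
  rw [hm] at hle
  simp only [Real.volume_Ioc] at hle
  rw [← ENNReal.ofReal_sum_of_nonneg (fun j hj => sub_nonneg.2 (huv j hj))] at hle
  exact (ENNReal.ofReal_le_ofReal_iff (sub_nonneg.2 hab)).1 hle

/-- Intervals `T j ⊇ H j`, where the `H j` do not overlap and `T j` contains no other `H i`, cover
every point at most three times. -/
theorem sum_length_le_three_mul {ι : Type*} {J : Finset ι} {u v A B : ι → ℝ} {a b : ℝ} (hab : a ≤ b)
    (huv : ∀ j ∈ J, u j ≤ v j) (hA : ∀ j ∈ J, a ≤ A j) (hB : ∀ j ∈ J, B j ≤ b)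
    (hAu : ∀ j ∈ J, A j ≤ u j) (hvB : ∀ j ∈ J, v j ≤ B j)
    (hd : ∀ i ∈ J, ∀ j ∈ J, i ≠ j → v i ≤ u j ∨ v j ≤ u i)
    (hn : ∀ i ∈ J, ∀ j ∈ J, i ≠ j → ¬ (A i ≤ u j ∧ v j ≤ B i)) :
    ∑ j ∈ J, (B j - A j) ≤ 3 * (b - a) := by
  have h1 := sum_length_le hab huv (fun j hj => (hA j hj).trans (hAu j hj))
    (fun j hj => (hvB j hj).trans (hB j hj)) hd
  -- The right collars `[v j, B j]` do not overlap: if `H i` lies to the left of `H j` and `B i`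
  -- passes `v j`, then `T i` contains `H j`. The left collars are symmetric, and `H` with its two
  -- collars makes up `T`.
  have h2 : ∑ j ∈ J, (B j - v j) ≤ b - a := by
    refine sum_length_le hab hvB
      (fun j hj => (hA j hj).trans ((hAu j hj).trans (huv j hj))) hB ?_
    intro i hi j hj hij
    rcases hd i hi j hj hij with h | h
    · have := hn i hi j hj hij
      left
      by_contra! hcon
      exact this ⟨by linarith [hAu i hi, huv i hi], hcon.le⟩
    · have := hn j hj i hi hij.symm
      right
      by_contra! hcon
      exact this ⟨by linarith [hAu j hj, huv j hj], hcon.le⟩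
  have h3 : ∑ j ∈ J, (u j - A j) ≤ b - a := by
    refine sum_length_le hab hAu hA
      (fun j hj => (huv j hj).trans ((hvB j hj).trans (hB j hj))) ?_
    intro i hi j hj hij
    rcases hd i hi j hj hij with h | h
    · have := hn j hj i hi hij.symm
      left
      by_contra! hcon
      exact this ⟨hcon.le, by linarith [hvB j hj, huv j hj]⟩
    · have := hn i hi j hj hij
      right
      by_contra! hcon
      exact this ⟨hcon.le, by linarith [hvB i hi, huv i hi]⟩
  have : ∑ j ∈ J, (B j - A j) =
      ∑ j ∈ J, (v j - u j) + ∑ j ∈ J, (B j - v j) + ∑ j ∈ J, (u j - A j) := by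
    rw [← Finset.sum_add_distrib, ← Finset.sum_add_distrib]
    exact Finset.sum_congr rfl fun j _ => by ring
  linarith

/-- Koebe principle: a cross-ratio is controlled by its image under `F^[k]` if the iterated images
of a surrounding interval `[A, B]` overlap boundedly, as witnessed by disjoint intervals
`[u i, v i]`. -/
theorem UnimodalSystem.koebe {F : ℝ → ℝ} {a c b C : ℝ} (h : UnimodalSystem F a c b) (hC : 0 ≤ C)
    (hCR : CrossRatioBound F a c b C) {A B : ℝ} (hA : A ∈ Icc a b) (hB : B ∈ Icc a b) {k : ℕ}
    (hf : FreeOn F c k (uIcc A B)) {u v : ℕ → ℝ} (huv : ∀ i < k, u i ≤ v i)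
    (hsub : ∀ i < k, Icc (u i) (v i) ⊆ uIcc (F^[i] A) (F^[i] B))
    (hd : ∀ i < k, ∀ j < k, i ≠ j → v i ≤ u j ∨ v j ≤ u i)
    (hn : ∀ i < k, ∀ j < k, i ≠ j → ¬ Icc (u j) (v j) ⊆ uIcc (F^[i] A) (F^[i] B))
    {x₁ x₂ x₃ x₄ : ℝ} (hx : InOrder x₁ x₂ x₃ x₄) (h1 : x₁ ∈ uIcc A B) (h4 : x₄ ∈ uIcc A B) :
    crossRatio x₁ x₂ x₃ x₄ ≤ Real.exp (C * (3 * (b - a))) *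
      crossRatio (F^[k] x₁) (F^[k] x₂) (F^[k] x₃) (F^[k] x₄) := by
  have hab : a ≤ b := (h.lt_left.trans h.lt_right).le
  have hsubAB : uIcc A B ⊆ Icc a b := ordConnected_Icc.uIcc_subset hA hB
  have hsub14 : uIcc x₁ x₄ ⊆ uIcc A B := ordConnected_uIcc.uIcc_subset h1 h4
  refine (h.crossRatio_le_iterate hCR hx (hsub14.trans hsubAB) (hf.mono le_rfl hsub14)).trans ?_
  refine mul_le_mul_of_nonneg_right ?_ (crossRatio_nonneg _ _ _ _)
  refine Real.exp_le_exp.2 (mul_le_mul_of_nonneg_left ?_ hC)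
  have key : ∑ i ∈ Finset.range k,
      (max (F^[i] A) (F^[i] B) - min (F^[i] A) (F^[i] B)) ≤ 3 * (b - a) := by
    refine sum_length_le_three_mul (u := u) (v := v) hab ?_ ?_ ?_ ?_ ?_ ?_ ?_
    · exact fun i hi => huv i (Finset.mem_range.1 hi)
    · exact fun i hi => le_min (h.iterate_mem hA i).1 (h.iterate_mem hB i).1
    · exact fun i hi => max_le (h.iterate_mem hA i).2 (h.iterate_mem hB i).2
    · exact fun i hi => (hsub i (Finset.mem_range.1 hi)
        (left_mem_Icc.2 (huv i (Finset.mem_range.1 hi)))).1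
    · exact fun i hi => (hsub i (Finset.mem_range.1 hi)
        (right_mem_Icc.2 (huv i (Finset.mem_range.1 hi)))).2
    · exact fun i hi j hj => hd i (Finset.mem_range.1 hi) j (Finset.mem_range.1 hj)
    · exact fun i hi j hj hij hh => hn i (Finset.mem_range.1 hi) j (Finset.mem_range.1 hj) hij
        (Icc_subset_Icc hh.1 hh.2)
  refine (Finset.sum_le_sum fun i hi => ?_).trans key
  have hfi : FreeOn F c i (uIcc A B) := hf.mono (Finset.mem_range.1 hi).le Subset.rfl
  have m1 := h.mem_uIcc_iterate hfi h1
  have m4 := h.mem_uIcc_iterate hfi h4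
  exact abs_sub_le_iff.2 ⟨by linarith [m4.2, m1.1], by linarith [m1.2, m4.1]⟩

/-! ### Wandering systems and their closest approaches to the turning point -/

/-- Left endpoint of the `i`-th image of `[α, β]`. -/
noncomputable def loEnd (F : ℝ → ℝ) (α β : ℝ) (i : ℕ) : ℝ := min (F^[i] α) (F^[i] β)

/-- Right endpoint of the `i`-th image of `[α, β]`. -/
noncomputable def hiEnd (F : ℝ → ℝ) (α β : ℝ) (i : ℕ) : ℝ := max (F^[i] α) (F^[i] β)

/-- A maximal interval `[α, β]` whose iterates avoid `c` and do not overlap. -/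
structure WanderingSystem (F : ℝ → ℝ) (a c b α β x : ℝ) : Prop extends UnimodalSystem F a c b where
  left_lt : a < α
  lt_mid : α < x
  mid_lt : x < β
  lt_right_end : β < b
  free : ∀ i, ∀ y ∈ Icc α β, F^[i] y ≠ c
  disj : ∀ i j, i ≠ j → hiEnd F α β i ≤ loEnd F α β j ∨ hiEnd F α β j ≤ loEnd F α β i
  max_left : ∀ ε > 0, ∃ z ∈ Ioo (α - ε) α, ∃ i, F^[i] z = c
  max_right : ∀ ε > 0, ∃ z ∈ Ioo β (β + ε), ∃ i, F^[i] z = c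
  noReturn : NoInjectiveReturn F x

/-- Bounded distortion of `F` away from `c`. -/
def DistortionBound (F : ℝ → ℝ) (a c b : ℝ) : Prop :=
  ∀ η > 0, ∃ C ≥ 0, ∀ x y z, y ∈ uIcc x z → uIcc x z ⊆ Icc a b →
    (uIcc x z ⊆ Iic (c - η) ∨ uIcc x z ⊆ Ici (c + η)) →
    |F z - F y| * |y - x| ≤ Real.exp (C * |z - x|) * (|F y - F x| * |z - y|)

/-- Distance from the critical value to the image of the `n`-th interval. -/
noncomputable def inGap (F : ℝ → ℝ) (c α β : ℝ) (n : ℕ) : ℝ := F c - hiEnd F α β (n + 1)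

/-- Distance from the critical value to the far end of the image of the `n`-th interval. -/
noncomputable def outGap (F : ℝ → ℝ) (c α β : ℝ) (n : ℕ) : ℝ := F c - loEnd F α β (n + 1)

/-- The `n`-th interval is closer to `c` than all earlier ones. -/
def IsRecord (F : ℝ → ℝ) (c α β : ℝ) (n : ℕ) : Prop :=
  ∀ i < n, inGap F c α β n < inGap F c α β i

/-- `m` is the first time after `n` at which the wandering interval is closer to `c`. -/
def IsNext (F : ℝ → ℝ) (c α β : ℝ) (n m : ℕ) : Prop :=
  n < m ∧ inGap F c α β m < inGap F c α β n ∧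
    ∀ j, n < j → j < m → inGap F c α β n < inGap F c α β j

namespace WanderingSystem

variable {F : ℝ → ℝ} {a c b α β x : ℝ}

theorem lt (h : WanderingSystem F a c b α β x) : α < β := h.lt_mid.trans h.mid_lt

theorem freeOn (h : WanderingSystem F a c b α β x) (k : ℕ) : FreeOn F c k (Icc α β) :=
  fun i _ y hy => h.free i y hy

theorem left_mem (h : WanderingSystem F a c b α β x) : α ∈ Icc a b :=
  ⟨h.left_lt.le, (h.lt.trans h.lt_right_end).le⟩

theorem right_mem (h : WanderingSystem F a c b α β x) : β ∈ Icc a b :=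
  ⟨(h.left_lt.trans h.lt).le, h.lt_right_end.le⟩

theorem injOn (h : WanderingSystem F a c b α β x) (k : ℕ) : InjOn F^[k] (Icc α β) :=
  h.injOn_iterate ordConnected_Icc (h.freeOn k)

theorem image_eq (h : WanderingSystem F a c b α β x) (k : ℕ) :
    F^[k] '' Icc α β = Icc (loEnd F α β k) (hiEnd F α β k) := by
  have hu : Icc α β = uIcc α β := (uIcc_of_le h.lt.le).symm
  rw [hu, h.image_uIcc (by rw [← hu]; exact h.freeOn k)]
  rfl

theorem iterate_mem_Icc (h : WanderingSystem F a c b α β x) {i : ℕ} {y : ℝ}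
    (hy : y ∈ Icc (loEnd F α β i) (hiEnd F α β i)) (j : ℕ) :
    F^[j] y ∈ Icc (loEnd F α β (i + j)) (hiEnd F α β (i + j)) := by
  rw [← h.image_eq] at hy ⊢
  obtain ⟨z, hz, rfl⟩ := hy
  exact ⟨z, hz, by rw [add_comm, Function.iterate_add_apply]⟩

theorem image_Icc (h : WanderingSystem F a c b α β x) (i j : ℕ) :
    F^[j] '' Icc (loEnd F α β i) (hiEnd F α β i) =
      Icc (loEnd F α β (i + j)) (hiEnd F α β (i + j)) := by
  rw [← h.image_eq, ← h.image_eq, ← image_comp, add_comm, Function.iterate_add]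

theorem notMem (h : WanderingSystem F a c b α β x) (i : ℕ) :
    c ∉ Icc (loEnd F α β i) (hiEnd F α β i) := by
  rw [← h.image_eq]
  rintro ⟨z, hz, hzc⟩
  exact h.free i z hz hzc

theorem freeOn_Icc (h : WanderingSystem F a c b α β x) (k i : ℕ) :
    FreeOn F c k (Icc (loEnd F α β i) (hiEnd F α β i)) := by
  rw [← h.image_eq]
  exact FreeOn.image (h.freeOn (k + i))

theorem mid_mem (h : WanderingSystem F a c b α β x) (i : ℕ) :
    F^[i] x ∈ Ioo (loEnd F α β i) (hiEnd F α β i) := by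
  have hu : Icc α β = uIcc α β := (uIcc_of_le h.lt.le).symm
  have hx : x ∈ Icc α β := ⟨h.lt_mid.le, h.mid_lt.le⟩
  rcases (h.cont_iterate i).continuousOn.strictMonoOn_of_injOn_Icc' h.lt.le (h.injOn i) with hm | hm
  · have h1 := hm (left_mem_Icc.2 h.lt.le) hx h.lt_mid
    have h2 := hm hx (right_mem_Icc.2 h.lt.le) h.mid_lt
    exact ⟨(min_le_left _ _).trans_lt h1, h2.trans_le (le_max_right _ _)⟩
  · have h1 := hm (left_mem_Icc.2 h.lt.le) hx h.lt_mid
    have h2 := hm hx (right_mem_Icc.2 h.lt.le) h.mid_lt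
    exact ⟨(min_le_right _ _).trans_lt h2, h1.trans_le (le_max_left _ _)⟩

theorem mid_mem_Icc (h : WanderingSystem F a c b α β x) (i : ℕ) :
    F^[i] x ∈ Icc (loEnd F α β i) (hiEnd F α β i) :=
  Ioo_subset_Icc_self (h.mid_mem i)

theorem lo_lt_hi (h : WanderingSystem F a c b α β x) (i : ℕ) : loEnd F α β i < hiEnd F α β i :=
  (h.mid_mem i).1.trans (h.mid_mem i).2

theorem lo_mem (h : WanderingSystem F a c b α β x) (i : ℕ) : loEnd F α β i ∈ Icc a b := by
  have h1 := h.iterate_mem h.left_mem i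
  have h2 := h.iterate_mem h.right_mem i
  exact ⟨le_min h1.1 h2.1, (min_le_left _ _).trans h1.2⟩

theorem hi_mem (h : WanderingSystem F a c b α β x) (i : ℕ) : hiEnd F α β i ∈ Icc a b := by
  have h1 := h.iterate_mem h.left_mem i
  have h2 := h.iterate_mem h.right_mem i
  exact ⟨h1.1.trans (le_max_left _ _), max_le h1.2 h2.2⟩

theorem hi_lt_peak (h : WanderingSystem F a c b α β x) (n : ℕ) : hiEnd F α β (n + 1) < F c := by
  have hm : hiEnd F α β (n + 1) ∈ F^[1] '' Icc (loEnd F α β n) (hiEnd F α β n) := by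
    rw [h.image_Icc]; exact right_mem_Icc.2 (h.lo_lt_hi _).le
  obtain ⟨z, hz, hzz⟩ := hm
  rw [← hzz]
  exact h.lt_peak fun hh => h.notMem n (hh ▸ hz)

theorem inGap_pos (h : WanderingSystem F a c b α β x) (n : ℕ) : 0 < inGap F c α β n :=
  sub_pos.2 (h.hi_lt_peak n)

theorem inGap_lt_outGap (h : WanderingSystem F a c b α β x) (n : ℕ) :
    inGap F c α β n < outGap F c α β n := by
  have := h.lo_lt_hi (n + 1)
  unfold inGap outGap; linarith

/-- The images do not overlap, so an image whose near end is closer to the critical value is closer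
as a whole. -/
theorem outGap_le (h : WanderingSystem F a c b α β x) {n m : ℕ}
    (hnm : inGap F c α β n < inGap F c α β m) : outGap F c α β n ≤ inGap F c α β m := by
  have hne : n ≠ m := fun hh => by rw [hh] at hnm; exact lt_irrefl _ hnm
  have h1 := h.lo_lt_hi (n + 1)
  have h2 := h.lo_lt_hi (m + 1)
  unfold inGap outGap at *
  rcases h.disj (n + 1) (m + 1) (by omega) with hd | hd <;> linarith

theorem hi_le_lo (h : WanderingSystem F a c b α β x) {n m : ℕ}
    (hnm : inGap F c α β n < inGap F c α β m) :
    hiEnd F α β (m + 1) ≤ loEnd F α β (n + 1) := by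
  have := h.outGap_le hnm
  unfold inGap outGap at this; linarith

theorem inGap_ne (h : WanderingSystem F a c b α β x) {n m : ℕ} (hnm : n ≠ m) :
    inGap F c α β n ≠ inGap F c α β m := by
  have h1 := h.lo_lt_hi (n + 1)
  have h2 := h.lo_lt_hi (m + 1)
  unfold inGap
  rcases h.disj (n + 1) (m + 1) (by omega) with hd | hd <;> intro hh <;> linarith

theorem sum_length (h : WanderingSystem F a c b α β x) (J : Finset ℕ) :
    ∑ j ∈ J, (hiEnd F α β j - loEnd F α β j) ≤ b - a :=
  sum_length_le (h.lt_left.trans h.lt_right).le (fun j _ => (h.lo_lt_hi j).le)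
    (fun j _ => (h.lo_mem j).1) (fun j _ => (h.hi_mem j).2) (fun i _ j _ hij => h.disj i j hij)

theorem tendsto_length (h : WanderingSystem F a c b α β x) :
    Tendsto (fun j => hiEnd F α β j - loEnd F α β j) atTop (𝓝 0) :=
  (summable_of_sum_range_le (fun j => sub_nonneg.2 (h.lo_lt_hi j).le)
    (fun n => h.sum_length (Finset.range n))).tendsto_atTop_zero

theorem length_eq (i : ℕ) : hiEnd F α β i - loEnd F α β i = |F^[i] β - F^[i] α| :=
  max_sub_min_eq_abs' _ _ |>.trans (abs_sub_comm _ _)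

/-- The wandering interval accumulates at `c`: otherwise bounded distortion would extend it. -/
theorem exists_inGap_lt (h : WanderingSystem F a c b α β x) (hD : DistortionBound F a c b)
    {ε : ℝ} (hε : 0 < ε) : ∃ n, inGap F c α β n < ε := by
  by_contra! hcon
  obtain ⟨η, hη, hηε⟩ : ∃ η > 0, ∀ y, |y - c| < 2 * η → F c - F y < ε := by
    obtain ⟨δ, hδ, hδε⟩ := Metric.continuousAt_iff.1 (h.cont.continuousAt (x := c)) ε hε
    refine ⟨δ / 2, by positivity, fun y hy => ?_⟩
    have := hδε (x := y) (by rw [Real.dist_eq]; linarith)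
    rw [Real.dist_eq] at this
    linarith [(abs_lt.1 this).1]
  have hfar : ∀ n, ∀ y ∈ Icc (loEnd F α β n) (hiEnd F α β n), 2 * η ≤ |y - c| := by
    intro n y hy
    by_contra! hlt
    have h1 := hηε y hlt
    have h2 := (h.iterate_mem_Icc hy 1).2
    have h3 := hcon n
    unfold inGap at h3
    simp only [Function.iterate_one] at h2
    linarith
  obtain ⟨C, hC, hdist⟩ := hD η hη
  set l : ℕ → ℝ := fun i => |F^[i] β - F^[i] α| with hl
  have hlpos : ∀ i, 0 < l i := fun i => by
    have := h.lo_lt_hi i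
    simp only [hl, ← length_eq]; linarith
  have hlsum : ∀ n, ∑ i ∈ Finset.range n, l i ≤ b - a := fun n => by
    have := h.sum_length (Finset.range n)
    simpa only [length_eq] using this
  have hlle : ∀ i, l i ≤ b - a := fun i => by
    have h1 := h.lo_mem i
    have h2 := h.hi_mem i
    simp only [hl, ← length_eq]; linarith [h1.1, h2.2]
  have hab : 0 < b - a := (hlpos 0).trans_le (hlle 0)
  -- The images of `[α, z]` will have total length at most twice that of the images of `[α, β]`, so
  -- `K` bounds the whole distortion. The bound `t` on `z - β` keeps each added piece below `η` and
  -- below the piece it is attached to.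
  set K := Real.exp (C * (2 * (b - a))) with hK
  have hKpos : 0 < K := Real.exp_pos _
  obtain ⟨t, ht, htb, ht1, ht2⟩ : ∃ t > 0, t ≤ b - β ∧ K * (t / l 0) ≤ 1 ∧
      K * (t / l 0) * (b - a) ≤ η := by
    have h0 := hlpos 0
    refine ⟨min (b - β) (min (l 0 / K) (η * l 0 / (K * (b - a)))), ?_, min_le_left _ _, ?_, ?_⟩
    · have := h.lt_right_end
      refine lt_min (by linarith) (lt_min (by positivity) (by positivity))
    · have : min (b - β) (min (l 0 / K) (η * l 0 / (K * (b - a)))) ≤ l 0 / K :=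
        (min_le_right _ _).trans (min_le_left _ _)
      calc K * (_ / l 0) ≤ K * ((l 0 / K) / l 0) := by gcongr
        _ = 1 := by field_simp
    · have : min (b - β) (min (l 0 / K) (η * l 0 / (K * (b - a)))) ≤ η * l 0 / (K * (b - a)) :=
        (min_le_right _ _).trans (min_le_right _ _)
      calc K * (_ / l 0) * (b - a) ≤ K * ((η * l 0 / (K * (b - a))) / l 0) * (b - a) := by gcongr
        _ = η := by field_simp
  obtain ⟨z, hz, i₀, hzc⟩ := h.max_right t ht
  set R : ℕ → ℝ := fun i => |F^[i] z - F^[i] β| with hR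
  have hsmall : ∀ i, (R i ≤ Real.exp (C * ∑ j ∈ Finset.range i, (l j + R j)) *
      ((z - β) / l 0) * l i ∧
    ∑ j ∈ Finset.range i, (l j + R j) ≤ 2 * ∑ j ∈ Finset.range i, l j) →
      R i ≤ l i ∧ R i ≤ η := by
    rintro i ⟨h1, h2⟩
    have h3 : Real.exp (C * ∑ j ∈ Finset.range i, (l j + R j)) ≤ K := by
      refine Real.exp_le_exp.2 (mul_le_mul_of_nonneg_left ?_ hC)
      linarith [hlsum i]
    have h4 : (z - β) / l 0 ≤ t / l 0 :=
      div_le_div_of_nonneg_right (by linarith [hz.2]) (hlpos 0).le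
    have h5 : 0 ≤ (z - β) / l 0 := div_nonneg (by linarith [hz.1]) (hlpos 0).le
    have h6 : R i ≤ K * (t / l 0) * l i := by
      refine h1.trans (mul_le_mul_of_nonneg_right ?_ (hlpos i).le)
      exact mul_le_mul h3 h4 h5 hKpos.le
    refine ⟨h6.trans ?_, h6.trans ?_⟩
    · nlinarith [hlpos i]
    · refine le_trans ?_ ht2
      exact mul_le_mul_of_nonneg_left (hlle i)
        (mul_nonneg hKpos.le (div_nonneg ht.le (hlpos 0).le))
  -- A bootstrap: bounded distortion keeps the added pieces short, which keeps the images of `[α,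
  -- z]` at distance `η` from `c` and their total length bounded, which in turn bounds the
  -- distortion at the next step.
  have key : ∀ i, F^[i] β ∈ uIcc (F^[i] α) (F^[i] z) ∧
      R i ≤ Real.exp (C * ∑ j ∈ Finset.range i, (l j + R j)) * ((z - β) / l 0) * l i ∧
      ∑ j ∈ Finset.range i, (l j + R j) ≤ 2 * ∑ j ∈ Finset.range i, l j := by
    intro i
    induction i with
    | zero =>
      refine ⟨mem_uIcc.2 (Or.inl ⟨h.lt.le, hz.1.le⟩), ?_, by simp⟩
      have h0 := hlpos 0
      simp only [Finset.range_zero, Finset.sum_empty, mul_zero, Real.exp_zero, one_mul]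
      rw [div_mul_cancel₀ _ h0.ne']
      simp only [hR, Function.iterate_zero, id]
      rw [abs_of_pos (by linarith [hz.1])]
    | succ i ih =>
      obtain ⟨ih1, ih2, ih3⟩ := ih
      obtain ⟨hs1, hs2⟩ := hsmall i ⟨ih2, ih3⟩
      have hnear : ∀ y ∈ uIcc (F^[i] α) (F^[i] z), η ≤ |y - c| := by
        intro y hy
        rcases (uIcc_subset_uIcc_union_uIcc (b := F^[i] β)) hy with hy | hy
        · have := hfar i y hy
          linarith
        · have h1 := hfar i (F^[i] β) ⟨min_le_right _ _, le_max_right _ _⟩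
          have h2 : |y - F^[i] β| ≤ |F^[i] z - F^[i] β| := abs_sub_left_of_mem_uIcc hy
          have h3 := abs_sub_abs_le_abs_sub (F^[i] β - c) (y - c)
          have h4 : F^[i] β - c - (y - c) = -(y - F^[i] β) := by ring
          rw [h4, abs_neg] at h3
          simp only [hR] at hs2
          linarith
      have hside : uIcc (F^[i] α) (F^[i] z) ⊆ Iic (c - η) ∨
          uIcc (F^[i] α) (F^[i] z) ⊆ Ici (c + η) := by
        have hnc : c ∉ uIcc (F^[i] α) (F^[i] z) := fun hh => by
          have := hnear c hh
          simp at this; linarith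
        refine (UnimodalSystem.side_of_notMem ordConnected_uIcc hnc).imp ?_ ?_ <;> intro hh y hy
        · have h1 := hnear y hy
          have h2 : y < c := hh hy
          rw [abs_of_neg (by linarith)] at h1
          simp only [mem_Iic]; linarith
        · have h1 := hnear y hy
          have h2 : c < y := hh hy
          rw [abs_of_pos (by linarith)] at h1
          simp only [mem_Ici]; linarith
      have hzab : z ∈ Icc a b := ⟨by linarith [h.left_lt, h.lt, hz.1], by linarith [hz.2]⟩
      have hab' : uIcc (F^[i] α) (F^[i] z) ⊆ Icc a b :=
        ordConnected_Icc.uIcc_subset (h.iterate_mem h.left_mem i) (h.iterate_mem hzab i)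
      have hinj : InjOn F (uIcc (F^[i] α) (F^[i] z)) := by
        refine h.injOn_side (hside.imp ?_ ?_)
        · exact fun hh => hh.trans (Iic_subset_Iic.2 (by linarith))
        · exact fun hh => hh.trans (Ici_subset_Ici.2 (by linarith))
      have hd := hdist _ _ _ ih1 hab' hside
      simp only [Function.iterate_succ_apply', hl, hR]
      refine ⟨mem_uIcc_of_injOn h.cont hinj ih1, ?_, ?_⟩
      · have hlen : |F^[i] z - F^[i] α| ≤ l i + R i := by
          have : F^[i] z - F^[i] α = (F^[i] β - F^[i] α) + (F^[i] z - F^[i] β) := by ring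
          rw [this]; exact abs_add_le _ _
        rw [Finset.sum_range_succ, mul_add, Real.exp_add]
        have hli := hlpos i
        have h1 : |F (F^[i] z) - F (F^[i] β)| * l i ≤
            Real.exp (C * (l i + R i)) * (|F (F^[i] β) - F (F^[i] α)| * R i) := by
          refine hd.trans ?_
          gcongr
        have h2 : |F (F^[i] z) - F (F^[i] β)| * l i ≤
            Real.exp (C * (l i + R i)) * (|F (F^[i] β) - F (F^[i] α)| *
            (Real.exp (C * ∑ j ∈ Finset.range i, (l j + R j)) * ((z - β) / l 0) * l i)) := by
          refine h1.trans ?_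
          gcongr
        refine le_of_mul_le_mul_right (h2.trans_eq ?_) hli
        simp only [hl, hR]
        ring
      · have := ih3
        have h2 := hs1
        simp only [hl, hR] at this h2
        rw [Finset.sum_range_succ, Finset.sum_range_succ]
        linarith
  -- When `z` reaches `c`, the image of `β` is within `η` of `c`, although all images of `[α, β]`
  -- stay at distance at least `2 * η`.
  have h1 := hfar i₀ (F^[i₀] β) ⟨min_le_right _ _, le_max_right _ _⟩
  have h2 := (hsmall i₀ (key i₀).2).2
  simp only [hR, hzc] at h2
  rw [abs_sub_comm] at h2
  linarith

theorem exists_isNext (h : WanderingSystem F a c b α β x) (hD : DistortionBound F a c b) (n : ℕ) :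
    ∃ m, IsNext F c α β n m := by
  classical
  -- A time that beats the best of all times up to `n` necessarily comes after `n`.
  obtain ⟨i₀, hi₀, hmin⟩ := Finset.exists_min_image (Finset.range (n + 1)) (inGap F c α β)
    ⟨0, by simp⟩
  obtain ⟨m₀, hm₀⟩ := h.exists_inGap_lt hD (h.inGap_pos i₀)
  have hex : ∃ m, n < m ∧ inGap F c α β m < inGap F c α β n := by
    refine ⟨m₀, ?_, hm₀.trans_le (hmin n (by simp))⟩
    by_contra! hle
    exact absurd (hmin m₀ (Finset.mem_range.2 (by omega))) (not_le.2 hm₀)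
  refine ⟨Nat.find hex, (Nat.find_spec hex).1, (Nat.find_spec hex).2, fun j hj hjm => ?_⟩
  have := Nat.find_min hex hjm
  refine lt_of_le_of_ne (not_lt.1 fun hh => this ⟨hj, hh⟩) (h.inGap_ne (by omega))

theorem isRecord_of_isNext {n m : ℕ} (hn : IsRecord F c α β n) (hm : IsNext F c α β n m) :
    IsRecord F c α β m := by
  intro i hi
  rcases lt_trichotomy i n with hin | rfl | hin
  · exact hm.2.1.trans (hn i hin)
  · exact hm.2.1
  · exact hm.2.1.trans (hm.2.2 i hin hi)

/-- Take the closest approach before `n`: gaps at different times differ, so it is a record, and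
nothing between it and `n` beats it. -/
theorem exists_prev (h : WanderingSystem F a c b α β x) {n : ℕ} (hn : IsRecord F c α β n)
    (h0 : 0 < n) : ∃ p, IsRecord F c α β p ∧ IsNext F c α β p n := by
  obtain ⟨p, hp, hmin⟩ := Finset.exists_min_image (Finset.range n) (inGap F c α β)
    ⟨0, by simpa using h0⟩
  have hpn := Finset.mem_range.1 hp
  refine ⟨p, fun i hi => ?_, hpn, hn p hpn, fun j hj hjn => ?_⟩
  · exact lt_of_le_of_ne (hmin i (Finset.mem_range.2 (by omega))) (h.inGap_ne (by omega))
  · exact lt_of_le_of_ne (hmin j (Finset.mem_range.2 hjn)) (h.inGap_ne (by omega))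

theorem exists_record_outGap_lt (h : WanderingSystem F a c b α β x) (hD : DistortionBound F a c b)
    {ε : ℝ} (hε : 0 < ε) :
    ∃ N, ∀ n > N, IsRecord F c α β n → outGap F c α β n < ε := by
  obtain ⟨N, hN⟩ := h.exists_inGap_lt hD hε
  exact ⟨N, fun n hn hr => (h.outGap_le (hr N hn)).trans_lt hN⟩

end WanderingSystem

/-! ### Pulling back along consecutive records -/

namespace UnimodalSystem

variable {F : ℝ → ℝ} {a c b : ℝ}

/-- If the extension of a branch of `F^[k]` over the target `(P, Q)` never breaks at `c`, the branch
maps some interval around `y` onto `[P, Q]`. -/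
theorem exists_pullback (h : UnimodalSystem F a c b) {k : ℕ} {y P Q : ℝ}
    (hy : y ∈ Icc a b) (hP : a ≤ P) (hQ : Q ≤ b) (hfree : FreeOn F c k {y})
    (hyM : F^[k] y ∈ Ioo P Q)
    (hno : ∀ z ∈ Icc a b, (∀ x ∈ uIcc y z, x ≠ z → (∀ i < k, F^[i] x ≠ c) ∧ F^[k] x ∈ Ioo P Q) →
      ∀ i < k, F^[i] z ≠ c) :
    ∃ A B, A ∈ Icc a b ∧ B ∈ Icc a b ∧ A < y ∧ y < B ∧ FreeOn F c k (Icc A B) ∧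
      (∀ x ∈ Ioo A B, F^[k] x ∈ Ioo P Q) ∧
      ((F^[k] A = P ∧ F^[k] B = Q) ∨ (F^[k] A = Q ∧ F^[k] B = P)) := by
  obtain ⟨B, hB, hyB, hBgood, hBend⟩ :=
    h.exists_extension (s := 1) (Or.inl rfl) hy hP hQ hfree hyM
  obtain ⟨A, hA, hyA, hAgood, hAend⟩ :=
    h.exists_extension (s := -1) (Or.inr rfl) hy hP hQ hfree hyM
  have hAy : A < y := by linarith
  have hBy : y < B := by linarith
  have hAc := hno A hA hAgood
  have hBc := hno B hB hBgood
  have hAe : F^[k] A = P ∨ F^[k] A = Q := hAend.resolve_left fun ⟨i, hi, hh⟩ => hAc i hi hh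
  have hBe : F^[k] B = P ∨ F^[k] B = Q := hBend.resolve_left fun ⟨i, hi, hh⟩ => hBc i hi hh
  have hf : FreeOn F c k (Icc A B) := by
    intro i hi w hw
    rcases le_total w y with hwy | hwy
    · rcases eq_or_ne w A with rfl | hne
      · exact hAc i hi
      · exact (hAgood w (mem_uIcc.2 (Or.inr ⟨hw.1, hwy⟩)) hne).1 i hi
    · rcases eq_or_ne w B with rfl | hne
      · exact hBc i hi
      · exact (hBgood w (mem_uIcc.2 (Or.inl ⟨hwy, hw.2⟩)) hne).1 i hi
  have hinj := h.injOn_iterate ordConnected_Icc hf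
  have hAB : F^[k] A ≠ F^[k] B := fun hh =>
    (hAy.trans hBy).ne (hinj (left_mem_Icc.2 (by linarith)) (right_mem_Icc.2 (by linarith)) hh)
  refine ⟨A, B, hA, hB, hAy, hBy, hf, ?_, ?_⟩
  · intro w hw
    rcases le_total w y with hwy | hwy
    · exact (hAgood w (mem_uIcc.2 (Or.inr ⟨hw.1.le, hwy⟩)) hw.1.ne').2
    · exact (hBgood w (mem_uIcc.2 (Or.inl ⟨hwy, hw.2.le⟩)) hw.2.ne).2
  · rcases hAe with hAe | hAe <;> rcases hBe with hBe | hBe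
    · exact absurd (hAe.trans hBe.symm) hAB
    · exact Or.inl ⟨hAe, hBe⟩
    · exact Or.inr ⟨hAe, hBe⟩
    · exact absurd (hAe.trans hBe.symm) hAB

/-- An open half-line bounded by `c`, cut at a level of `F`, is an interval. -/
theorem ordConnected_side_inter (h : UnimodalSystem F a c b) {S : Set ℝ} {v : ℝ}
    (hS : S.OrdConnected) (hS' : S ⊆ Iic c ∨ S ⊆ Ici c) : (S ∩ F ⁻¹' Ici v).OrdConnected := by
  refine ⟨fun w₁ h₁ w₂ h₂ w hw => ⟨hS.out h₁.1 h₂.1 hw, ?_⟩⟩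
  have hsub : uIcc w₁ w₂ ⊆ S := hS.uIcc_subset h₁.1 h₂.1
  have := mem_uIcc_of_injOn h.cont ((h.injOn_side hS').mono hsub) (Icc_subset_uIcc hw)
  exact (le_inf (mem_Ici.1 h₁.2) (mem_Ici.1 h₂.2)).trans this.1

end UnimodalSystem

namespace WanderingSystem

variable {F : ℝ → ℝ} {a c b α β x : ℝ}

/-- Before time `n` the closest approach is the one at time `p`. This is the obstruction used
repeatedly below: no earlier image can be carried into a target above `loEnd F α β (p + 1)`. -/
theorem lo_le_of_isNext (h : WanderingSystem F a c b α β x) {p n : ℕ} (hp : IsRecord F c α β p)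
    (hpn : IsNext F c α β p n) {j : ℕ} (hj : j < n) : loEnd F α β (j + 1) ≤ loEnd F α β (p + 1) := by
  rcases eq_or_ne j p with rfl | hne
  · exact le_rfl
  · have hlt : inGap F c α β p < inGap F c α β j := by
      rcases lt_or_gt_of_ne hne with hjp | hjp
      · exact hp j hjp
      · exact hpn.2.2 j hjp hj
    exact (h.lo_lt_hi (j + 1)).le.trans (h.hi_le_lo hlt)

/-- For consecutive records `p < n < q`, a branch of `F^[n+1]` around `[α, β]` covers the interval
between the midpoints of the images of the intervals number `p` and `q`. -/
theorem exists_pullback_record (h : WanderingSystem F a c b α β x) {p n q : ℕ}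
    (hp : IsRecord F c α β p) (hpn : IsNext F c α β p n) (hnq : IsNext F c α β n q) {P Q : ℝ}
    (hP : P = (loEnd F α β (p + 1) + hiEnd F α β (p + 1)) / 2)
    (hQ : Q = (loEnd F α β (q + 1) + hiEnd F α β (q + 1)) / 2) :
    ∃ A B, A ∈ Icc a b ∧ B ∈ Icc a b ∧ A < x ∧ x < B ∧ FreeOn F c (n + 1) (Icc A B) ∧
      (∀ w ∈ Ioo A B, F^[n + 1] w ∈ Ioo P Q) ∧
      ((F^[n + 1] A = P ∧ F^[n + 1] B = Q) ∨ (F^[n + 1] A = Q ∧ F^[n + 1] B = P)) := by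
  have hlow := fun j => h.lo_le_of_isNext hp hpn (j := j)
  have hp1 := h.lo_lt_hi (p + 1)
  have hq1 := h.lo_lt_hi (q + 1)
  have hn1 := h.lo_lt_hi (n + 1)
  have hpn1 := h.hi_le_lo hpn.2.1
  have hnq1 := h.hi_le_lo hnq.2.1
  have hxab : x ∈ Icc a b :=
    ⟨(h.left_lt.trans h.lt_mid).le, (h.mid_lt.trans h.lt_right_end).le⟩
  have hxn := h.mid_mem (n + 1)
  have hQc : Q < F c := by linarith [h.hi_lt_peak q]
  refine h.exists_pullback hxab (by linarith [(h.lo_mem (p + 1)).1])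
    (by linarith [(h.hi_mem (q + 1)).2])
    (fun i _ y hy => hy ▸ h.free i x ⟨h.lt_mid.le, h.mid_lt.le⟩)
    ⟨by linarith [hxn.1], by linarith [hxn.2]⟩ ?_
  intro z hz hgood i hi hzc
  have hFz : F^[i + 1] z = F c := by rw [Function.iterate_succ_apply', hzc]
  -- values between the orbit point and the peak are attained before the break
  have hval : ∀ v, F^[i + 1] x ≤ v → v < F c → ∃ w ∈ uIcc x z, w ≠ z ∧ F^[i + 1] w = v := by
    intro v hv1 hv2
    have hv : v ∈ uIcc (F^[i + 1] x) (F^[i + 1] z) := by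
      rw [hFz]; exact mem_uIcc.2 (Or.inl ⟨hv1, hv2.le⟩)
    obtain ⟨w, hw, hwv⟩ := intermediate_value_uIcc (h.cont_iterate (i + 1)).continuousOn hv
    refine ⟨w, hw, ?_, hwv⟩
    rintro rfl
    exact hv2.ne (hwv.symm.trans hFz)
  -- A break at the last time `i = n` is impossible: on its way to the peak the branch would take
  -- the value `Q`, which is not in the open target.
  rcases Nat.lt_succ_iff_lt_or_eq.1 hi with hin | rfl
  swap
  · obtain ⟨w, hw, hwz, hwv⟩ := hval Q (by linarith [hxn.2]) hQc
    have := (hgood w hw hwz).2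
    rw [hwv] at this
    exact lt_irrefl _ this.2
  have hstar : ∀ v, F^[i + 1] x ≤ v → v < F c →
      (∀ l < n - i, F^[l] v ≠ c) ∧ F^[n - i] v ∈ Ioo P Q := by
    intro v hv1 hv2
    obtain ⟨w, hw, hwz, rfl⟩ := hval v hv1 hv2
    obtain ⟨h1, h2⟩ := hgood w hw hwz
    refine ⟨fun l hl => ?_, ?_⟩
    · rw [← Function.iterate_add_apply]; exact h1 _ (by omega)
    · rw [← Function.iterate_add_apply]
      rwa [show n - i + (i + 1) = n + 1 by omega]
  -- If some earlier image is closer to the critical value than the one at time `i`, then `hstar`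
  -- carries its points into `(P, Q)`, against `hlow`.
  by_cases hrec : IsRecord F c α β i
  swap
  · unfold IsRecord at hrec
    push Not at hrec
    obtain ⟨i', hi', hle⟩ := hrec
    have hlt := lt_of_le_of_ne hle (h.inGap_ne hi'.ne)
    have hhl := h.hi_le_lo hlt
    have hmem : loEnd F α β (i' + 1 + (n - i)) ∈ F^[n - i] '' Icc (loEnd F α β (i' + 1))
        (hiEnd F α β (i' + 1)) := by
      rw [h.image_Icc]; exact left_mem_Icc.2 (h.lo_lt_hi _).le
    obtain ⟨v, hv, hvv⟩ := hmem
    have := (hstar v (by linarith [(h.mid_mem (i + 1)).2, hv.1])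
      (hv.2.trans_lt (h.hi_lt_peak i'))).2.1
    rw [hvv, show i' + 1 + (n - i) = (i' + (n - i)) + 1 by omega] at this
    linarith [hlow (i' + (n - i)) (by omega)]
  obtain ⟨t, ht⟩ : ∃ t, n - i = t + 1 := ⟨n - i - 1, by omega⟩
  have hli := hlow i hin
  set v₀ := loEnd F α β (i + 1) with hv₀
  -- What is left is an injective return. On the side `S` of `c` containing `F^[n] x`, take the part
  -- where `F ≥ v₀`. Its image under `F` lies in `[v₀, F c)`; the part of that above `F^[i + 1] x`
  -- is controlled by `hstar`, the part below lies in an image of `[α, β]`. Hence `F^[n - i]` maps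
  -- the set injectively into itself.
  obtain ⟨S, hS, hSord, hxS, hcS⟩ : ∃ S : Set ℝ, (S ⊆ Iic c ∨ S ⊆ Ici c) ∧ S.OrdConnected ∧
      F^[n] x ∈ S ∧ ∀ I : Set ℝ, I.OrdConnected → c ∉ I → F^[n] x ∈ I → I ⊆ S ∧ c ∉ S := by
    have hxc : F^[n] x ≠ c := h.free n x ⟨h.lt_mid.le, h.mid_lt.le⟩
    rcases lt_or_gt_of_ne hxc with hlt | hlt
    · refine ⟨Iio c, Or.inl Iio_subset_Iic_self, ordConnected_Iio, hlt, fun I hI hcI hxI =>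
        ⟨?_, self_notMem_Iio⟩⟩
      rcases UnimodalSystem.side_of_notMem hI hcI with hh | hh
      · exact hh
      · exact absurd (hh hxI) (not_lt.2 hlt.le)
    · refine ⟨Ioi c, Or.inr Ioi_subset_Ici_self, ordConnected_Ioi, hlt, fun I hI hcI hxI =>
        ⟨?_, self_notMem_Ioi⟩⟩
      rcases UnimodalSystem.side_of_notMem hI hcI with hh | hh
      · exact absurd (hh hxI) (not_lt.2 hlt.le)
      · exact hh
  have hcS' : c ∉ S := (hcS {F^[n] x} ordConnected_singleton
    (fun hh => h.free n x ⟨h.lt_mid.le, h.mid_lt.le⟩ hh.symm) rfl).2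
  have hiter : F^[t] (F^[i + 1] x) = F^[n] x := by
    rw [← Function.iterate_add_apply, show t + (i + 1) = n by omega]
  have hfreev : FreeOn F c t (Ico v₀ (F c)) := by
    intro l hl v hv
    rcases le_total (F^[i + 1] x) v with hxv | hxv
    · exact (hstar v hxv hv.2).1 l (by omega)
    · exact h.freeOn_Icc (l + 1) (i + 1) l (Nat.lt_succ_self l) v
        ⟨hv.1, hxv.trans (h.mid_mem (i + 1)).2.le⟩
  refine h.noReturn n (n - i) (S ∩ F ⁻¹' Ici v₀) (by omega)
    (h.ordConnected_side_inter hSord hS) ⟨hxS, ?_⟩ ?_ ?_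
  · have : F (F^[n] x) = F^[n + 1] x := (Function.iterate_succ_apply' F n x).symm
    rw [mem_preimage, this, mem_Ici]
    linarith [hxn.1]
  · rintro w ⟨hwS, hwv⟩
    have hwc : w ≠ c := fun hh => hcS' (hh ▸ hwS)
    have hv1 : v₀ ≤ F w := hwv
    have hv2 : F w < F c := h.lt_peak hwc
    have hsucc : F (F^[t] (F w)) = F^[n - i] (F w) := by
      rw [ht, Function.iterate_succ_apply']
    rw [ht, Function.iterate_succ_apply]
    rcases le_total (F^[i + 1] x) (F w) with hxv | hxv
    · refine ⟨?_, ?_⟩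
      · have hI : (F^[t] '' Icc (F^[i + 1] x) (F w)).OrdConnected :=
          ordConnected_image (h.cont_iterate t) ordConnected_Icc
        refine (hcS _ hI ?_ ?_).1 (mem_image_of_mem _ (right_mem_Icc.2 hxv))
        · rintro ⟨v, hv, hvc⟩
          exact (hstar v hv.1 (hv.2.trans_lt hv2)).1 t (by omega) hvc
        · exact ⟨_, left_mem_Icc.2 hxv, hiter⟩
      · rw [mem_preimage, hsucc, mem_Ici]
        linarith [(hstar _ hxv hv2).2.1]
    · have hmem : F w ∈ Icc (loEnd F α β (i + 1)) (hiEnd F α β (i + 1)) :=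
        ⟨hv1, hxv.trans (h.mid_mem (i + 1)).2.le⟩
      refine ⟨?_, ?_⟩
      · have h1 := h.iterate_mem_Icc hmem t
        rw [show i + 1 + t = n by omega] at h1
        exact (hcS _ ordConnected_Icc (h.notMem n) (h.mid_mem_Icc n)).1 h1
      · have h1 := h.iterate_mem_Icc hmem (n - i)
        rw [show i + 1 + (n - i) = n + 1 by omega] at h1
        rw [mem_preimage, hsucc, mem_Ici]
        linarith [h1.1]
  · rw [ht, Function.iterate_succ]
    refine InjOn.comp (t := Ico v₀ (F c)) (h.injOn_iterate ordConnected_Ico hfreev)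
      ((h.injOn_side hS).mono inter_subset_left) ?_
    rintro w ⟨hwS, hwv⟩
    exact ⟨hwv, h.lt_peak fun hh => hcS' (hh ▸ hwS)⟩

/-- The branch of `exists_pullback_record` has bounded overlap, so it distorts cross-ratios by a
bounded factor. -/
theorem koebe_record (h : WanderingSystem F a c b α β x) {C : ℝ} (hC : 0 ≤ C)
    (hCR : CrossRatioBound F a c b C) {p n q : ℕ} (hp : IsRecord F c α β p)
    (hpn : IsNext F c α β p n) (hnq : IsNext F c α β n q) {P Q : ℝ}
    (hP : P = (loEnd F α β (p + 1) + hiEnd F α β (p + 1)) / 2)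
    (hQ : Q = (loEnd F α β (q + 1) + hiEnd F α β (q + 1)) / 2) :
    ∃ A B, A < α ∧ β < B ∧ FreeOn F c (n + 1) (Icc A B) ∧
      crossRatio A α β B ≤ Real.exp (C * (3 * (b - a))) *
        crossRatio P (loEnd F α β (n + 1)) (hiEnd F α β (n + 1)) Q := by
  have hlow := fun j => h.lo_le_of_isNext hp hpn (j := j)
  have hp1 := h.lo_lt_hi (p + 1)
  have hq1 := h.lo_lt_hi (q + 1)
  have hn1 := h.lo_lt_hi (n + 1)
  have hpn1 := h.hi_le_lo hpn.2.1
  have hnq1 := h.hi_le_lo hnq.2.1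
  have hpn0 := hpn.1
  have hPQ : P ≤ Q := by linarith
  obtain ⟨A, B, hA, hB, hAx, hxB, hf, -, hends⟩ := h.exists_pullback_record hp hpn hnq hP hQ
  have hAB : A ≤ B := by linarith
  have hu : Icc A B = uIcc A B := (uIcc_of_le hAB).symm
  have hvals : ∀ w, F^[n + 1] w = P ∨ F^[n + 1] w = Q → w ∉ Icc α β := by
    intro w hw hmem
    have hmem' : F^[n + 1] w ∈ Icc (loEnd F α β (n + 1)) (hiEnd F α β (n + 1)) := by
      rw [← h.image_eq]; exact mem_image_of_mem _ hmem
    rcases hw with hw | hw <;> rw [hw] at hmem' <;> linarith [hmem'.1, hmem'.2]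
  have hAα : A < α := by
    by_contra! hcon
    exact hvals A (hends.imp (fun h => h.1) (fun h => h.1)) ⟨hcon, (hAx.trans h.mid_lt).le⟩
  have hβB : β < B := by
    by_contra! hcon
    exact hvals B (hends.symm.imp (fun h => h.2) (fun h => h.2))
      ⟨(h.lt_mid.trans hxB).le, hcon⟩
  set T : ℕ → Set ℝ := fun j => uIcc (F^[j] A) (F^[j] B) with hT
  have hTimg : ∀ j ≤ n + 1, F^[j] '' Icc A B = T j := fun j hj => by
    rw [hu]; exact h.image_uIcc (hu ▸ hf.mono hj Subset.rfl)
  have hTord : ∀ j, (T j).OrdConnected := fun j => ordConnected_uIcc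
  have hTmap : ∀ j l, j + l ≤ n + 1 → F^[l] '' T j = T (j + l) := by
    intro j l hjl
    rw [← hTimg j (by omega), ← hTimg (j + l) hjl, ← image_comp, ← Function.iterate_add, add_comm l]
  have hmap : ∀ i j l, j + l ≤ n + 1 → Icc (loEnd F α β i) (hiEnd F α β i) ⊆ T j →
      Icc (loEnd F α β (i + l)) (hiEnd F α β (i + l)) ⊆ T (j + l) := by
    intro i j l hjl hsub
    rw [← h.image_Icc, ← hTmap j l hjl]
    exact image_mono hsub
  have hself : ∀ j ≤ n + 1, Icc (loEnd F α β j) (hiEnd F α β j) ⊆ T j := by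
    intro j hj
    rw [← h.image_eq, ← hTimg j hj]
    exact image_mono (Icc_subset_Icc hAα.le hβB.le)
  have hTlast : T (n + 1) = Icc P Q := by
    rcases hends with ⟨h1, h2⟩ | ⟨h1, h2⟩ <;> simp only [hT, h1, h2]
    · exact uIcc_of_le hPQ
    · exact uIcc_of_ge hPQ
  have hsubhull : ∀ i j k l, Icc (loEnd F α β i) (hiEnd F α β i) ⊆ T l →
      Icc (loEnd F α β k) (hiEnd F α β k) ⊆ T l → loEnd F α β i ≤ loEnd F α β j →
      hiEnd F α β j ≤ hiEnd F α β k → Icc (loEnd F α β j) (hiEnd F α β j) ⊆ T l := by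
    intro i j k l hi hk h1 h2
    exact (Icc_subset_Icc h1 h2).trans ((hTord l).out (hi (left_mem_Icc.2 (h.lo_lt_hi i).le))
      (hk (right_mem_Icc.2 (h.lo_lt_hi k).le)))
  -- Pushed forward until `T j` becomes `[P, Q]`, the image number `i` would have reached a number
  -- at most `n` and still lie above `P`.
  have hearly : ∀ i j, i < j → j ≤ n → ¬ Icc (loEnd F α β i) (hiEnd F α β i) ⊆ T j := by
    intro i j hij hjn hsub
    have h1 := hmap i j (n + 1 - j) (by omega) hsub
    rw [show j + (n + 1 - j) = n + 1 by omega, hTlast,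
      show i + (n + 1 - j) = (i + n - j) + 1 by omega] at h1
    have h2 := (h1 (left_mem_Icc.2 (h.lo_lt_hi _).le)).1
    linarith [hlow (i + n - j) (by omega)]
  -- Push the inclusion forward by `n - p`. If the resulting image is farther from the critical
  -- value than the image number `n + 1`, then `[loEnd F α β (p + 1), hiEnd F α β (n + 1)]` is
  -- mapped injectively into itself. If it is closer, then `q ≤ n + (n - p)`. Equality fails because
  -- `Q` cuts the image number `q + 1` in its middle; otherwise pushing forward by `q - n` only
  -- traps the image number `p + 1` in a later `T`, against `hearly`.
  have hdrift : ¬ Icc (loEnd F α β (n + 1)) (hiEnd F α β (n + 1)) ⊆ T (p + 1) := by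
    intro hsub
    have hselfp := hself (p + 1) (by omega)
    have hVm := hmap (n + 1) (p + 1) (n - p) (by omega) hsub
    rw [show p + 1 + (n - p) = n + 1 by omega, hTlast,
      show n + 1 + (n - p) = (n + (n - p)) + 1 by omega] at hVm
    have hVm1 := (hVm (left_mem_Icc.2 (h.lo_lt_hi _).le)).1
    have hVm2 := (hVm (right_mem_Icc.2 (h.lo_lt_hi _).le)).2
    rcases lt_or_gt_of_ne (h.inGap_ne (show n ≠ n + (n - p) by omega)) with hlt | hlt
    · have hle := h.hi_le_lo hlt
      have hIsub : Icc (loEnd F α β (p + 1)) (hiEnd F α β (n + 1)) ⊆ T (p + 1) :=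
        (hTord _).out (hselfp (left_mem_Icc.2 hp1.le)) (hsub (right_mem_Icc.2 hn1.le))
      have hle' : loEnd F α β (p + 1) ≤ hiEnd F α β (n + 1) := by linarith
      have hIf : FreeOn F c (n - p) (Icc (loEnd F α β (p + 1)) (hiEnd F α β (n + 1))) := by
        refine FreeOn.mono (FreeOn.image (k := n - p) (j := p + 1)
          (hf.mono (by omega) Subset.rfl)) le_rfl ?_
        rw [hTimg _ (by omega)]; exact hIsub
      refine h.noReturn (n + 1) (n - p) _ (by omega) ordConnected_Icc
        (⟨by linarith [(h.mid_mem (n + 1)).1], (h.mid_mem (n + 1)).2.le⟩ :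
          F^[n + 1] x ∈ Icc (loEnd F α β (p + 1)) (hiEnd F α β (n + 1))) ?_
        (h.injOn_iterate ordConnected_Icc hIf)
      intro w hw
      have hw' := h.mem_uIcc_iterate (x := loEnd F α β (p + 1)) (y := hiEnd F α β (n + 1))
        (by rw [uIcc_of_le hle']; exact hIf) (by rw [uIcc_of_le hle']; exact hw)
      refine ordConnected_Icc.uIcc_subset ?_ ?_ hw'
      · have := h.iterate_mem_Icc (left_mem_Icc.2 hp1.le) (n - p)
        rw [show p + 1 + (n - p) = n + 1 by omega] at this
        exact ⟨by linarith [this.1], this.2⟩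
      · have := h.iterate_mem_Icc (right_mem_Icc.2 hn1.le) (n - p)
        rw [show n + 1 + (n - p) = (n + (n - p)) + 1 by omega] at this
        exact ⟨by linarith [this.1], by linarith [this.2]⟩
    · have hqm : q ≤ n + (n - p) := by
        by_contra! hcon
        exact lt_asymm hlt (hnq.2.2 _ (by omega) hcon)
      rcases hqm.eq_or_lt with heq | hqm
      · rw [← heq] at hVm2
        linarith
      · have hnq0 := hnq.1
        have h1 := hmap (n + 1) (p + 1) (q - n) (by omega) hsub
        rw [show n + 1 + (q - n) = q + 1 by omega] at h1
        have h2 := hself (p + 1 + (q - n)) (by omega)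
        have h3 : inGap F c α β p < inGap F c α β (p + (q - n)) :=
          hpn.2.2 _ (by omega) (by omega)
        have h4 := h.hi_le_lo h3
        have h5 := h.lo_lt_hi (p + (q - n) + 1)
        rw [show p + (q - n) + 1 = p + 1 + (q - n) by omega] at h4 h5
        exact hearly (p + 1) (p + 1 + (q - n)) (by omega) (by omega)
          (hsubhull _ _ _ _ h2 h1 (by linarith) (by linarith))
  -- The image number `p + 1` lies between the images number `s + 1` and `n + 1`, so it is trapped
  -- too. For `s > p` this is excluded by `hearly`; for `s < p`, pushing forward by `n - p` gives
  -- the same situation with a larger `s`.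
  have hlate : ∀ m s, n - s = m → s < n →
      ¬ Icc (loEnd F α β (n + 1)) (hiEnd F α β (n + 1)) ⊆ T (s + 1) := by
    intro m
    induction m using Nat.strong_induction_on with
    | _ m ih =>
      intro s hsm hsn hsub
      rcases eq_or_ne s p with rfl | hsp
      · exact hdrift hsub
      have hVp : Icc (loEnd F α β (p + 1)) (hiEnd F α β (p + 1)) ⊆ T (s + 1) :=
        hsubhull (s + 1) (p + 1) (n + 1) (s + 1) (hself _ (by omega)) hsub (hlow s hsn)
          (by linarith)
      rcases lt_or_gt_of_ne hsp with hlt | hlt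
      · have h1 := hmap (p + 1) (s + 1) (n - p) (by omega) hVp
        rw [show p + 1 + (n - p) = n + 1 by omega,
          show s + 1 + (n - p) = (s + (n - p)) + 1 by omega] at h1
        exact ih (n - (s + (n - p))) (by omega) _ rfl (by omega) h1
      · exact hearly (p + 1) (s + 1) (by omega) (by omega) hVp
  have hord : InOrder A α β B := Or.inl ⟨hAα, h.lt, hβB⟩
  refine ⟨A, B, hAα, hβB, hf, ?_⟩
  refine (h.koebe hC hCR hA hB (hu ▸ hf) (u := loEnd F α β) (v := hiEnd F α β)
    (fun i _ => (h.lo_lt_hi i).le) (fun i hi => hself i hi.le)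
    (fun i _ j _ hij => h.disj i j hij) ?_ hord left_mem_uIcc right_mem_uIcc).trans_eq ?_
  -- An inclusion with `i < j` is pushed forward until the image contained has number `n + 1`, which
  -- is the case of `hlate`.
  · intro i hi j hj hij hsub
    rcases lt_or_gt_of_ne hij with hlt | hlt
    · have h1 := hmap j i (n + 1 - j) (by omega) hsub
      rw [show j + (n + 1 - j) = n + 1 by omega,
        show i + (n + 1 - j) = (i + n - j) + 1 by omega] at h1
      exact hlate _ _ rfl (by omega) h1
    · exact hearly j i hlt (by omega) hsub
  · congr 1
    have himg := hord.image (h.cont_iterate (n + 1)) (hu ▸ h.injOn_iterate ordConnected_Icc hf)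
    rcases hends with ⟨h1, h2⟩ | ⟨h1, h2⟩ <;> rw [h1, h2] at himg ⊢
    · have hlt : F^[n + 1] α < F^[n + 1] β := by
        rcases himg with hh | hh
        · exact hh.2.1
        · linarith
      rw [loEnd, hiEnd, min_eq_left hlt.le, max_eq_right hlt.le]
    · have hlt : F^[n + 1] β < F^[n + 1] α := by
        rcases himg with hh | hh
        · linarith
        · exact hh.2.1
      rw [loEnd, hiEnd, min_eq_right hlt.le, max_eq_left hlt.le, crossRatio_reverse]

end WanderingSystem

/-! ### The relative gap to the critical value tends to zero -/

namespace WanderingSystem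

variable {F : ℝ → ℝ} {a c b α β x : ℝ}

/-- Induction along the sequence of records. -/
theorem record_induction (h : WanderingSystem F a c b α β x) {n₀ : ℕ} (h₀ : IsRecord F c α β n₀)
    {Q : ℕ → Prop} (base : Q n₀)
    (step : ∀ n m, n₀ ≤ n → IsRecord F c α β n → IsNext F c α β n m → Q n → Q m) :
    ∀ m, n₀ ≤ m → IsRecord F c α β m → Q m := by
  intro m
  induction m using Nat.strong_induction_on with
  | _ m ih =>
    intro hm hrec
    rcases hm.eq_or_lt with rfl | hm
    · exact base
    obtain ⟨p, hp, hpm⟩ := h.exists_prev hrec (by omega)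
    have hpn : n₀ ≤ p := by
      by_contra! hcon
      exact lt_asymm (h₀ p hcon) (hpm.2.2 n₀ hcon hm)
    exact step p m hpn hp hpm (ih p hpm.1 hpn hp)

theorem exists_record_gt (h : WanderingSystem F a c b α β x) (hD : DistortionBound F a c b) (N : ℕ) :
    ∃ n > N, IsRecord F c α β n := by
  have key : ∀ M, ∃ n ≥ M, IsRecord F c α β n := by
    intro M
    induction M with
    | zero => exact ⟨0, le_rfl, fun i hi => absurd hi (Nat.not_lt_zero i)⟩
    | succ M ih =>
      obtain ⟨n, hn, hr⟩ := ih
      obtain ⟨m, hm⟩ := h.exists_isNext hD n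
      exact ⟨m, by have := hm.1; omega, isRecord_of_isNext hr hm⟩
  exact key (N + 1)

/-- Branches of high order around `[α, β]` extend only little beyond `α`. -/
theorem exists_extension_lt (h : WanderingSystem F a c b α β x) {D : ℝ} (hD : 0 < D) :
    ∃ N, ∀ n ≥ N, ∀ A B, β ≤ B → FreeOn F c n (Icc A B) → α - A < D := by
  obtain ⟨z, hz, i, hi⟩ := h.max_left D hD
  refine ⟨i + 1, fun n hn A B hB hf => ?_⟩
  by_contra! hcon
  exact hf i (by omega) z ⟨by linarith [hz.1], by linarith [hz.2, h.lt]⟩ hi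

/-- If the record intervals do not grow, their images get close to each other relative to their
size. -/
theorem exists_next_gap_lt (h : WanderingSystem F a c b α β x) {C : ℝ} (hC : 0 ≤ C)
    (hCR : CrossRatioBound F a c b C) {δ : ℝ} (hδ : 0 < δ) :
    ∃ N, ∀ p n q, N ≤ n → IsRecord F c α β p → IsNext F c α β p n → IsNext F c α β n q →
      outGap F c α β n - inGap F c α β n ≤ outGap F c α β p - inGap F c α β p →
      inGap F c α β n - inGap F c α β q < δ * (outGap F c α β n - inGap F c α β n) := by
  -- `X` bounds the cross-ratio of `[α, β]` if the claim fails. On the left, half of the image of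
  -- the `p`-th interval, which is at least as long, lies above `P`; on the right, failure leaves
  -- room `δ / 2` times the length below `Q`. The extension beyond `α` would then be at least `(β -
  -- α) / X`.
  set X := Real.exp (C * (3 * (b - a))) * (2 / δ + 4 / δ + 2) with hX
  have hXpos : 0 < X := by positivity
  have hlt := h.lt
  obtain ⟨N, hN⟩ := h.exists_extension_lt (D := (β - α) / X) (div_pos (by linarith) hXpos)
  refine ⟨N, fun p n q hn hp hpn hnq hle => ?_⟩
  by_contra! hcon
  obtain ⟨A, B, hA, hB, hf, hcr⟩ := h.koebe_record hC hCR hp hpn hnq rfl rfl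
  have hbd := hN (n + 1) (by omega) A B hB.le hf
  have hp1 := h.lo_lt_hi (p + 1)
  have hq1 := h.lo_lt_hi (q + 1)
  have hn1 := h.lo_lt_hi (n + 1)
  have hpn1 := h.hi_le_lo hpn.2.1
  have hnq1 := h.hi_le_lo hnq.2.1
  simp only [inGap, outGap] at hle hcon
  set P := (loEnd F α β (p + 1) + hiEnd F α β (p + 1)) / 2
  set Q := (loEnd F α β (q + 1) + hiEnd F α β (q + 1)) / 2
  set lo := loEnd F α β (n + 1)
  set hi := hiEnd F α β (n + 1)
  have hv : 0 < hi - lo := by linarith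
  have hx : (hi - lo) / 2 ≤ lo - P := by simp only [P]; linarith
  have hy : δ * (hi - lo) / 2 ≤ Q - hi := by simp only [Q]; linarith
  have hx0 : 0 < lo - P := by linarith
  have hy0 : 0 < Q - hi := by have := mul_pos hδ hv; linarith
  have h1 : crossRatio P lo hi Q ≤ 2 / δ + 4 / δ + 2 := by
    have e : crossRatio P lo hi Q = (hi - lo) / (Q - hi) + (hi - lo) / (Q - hi) * ((hi - lo) / (lo - P))
        + (hi - lo) / (lo - P) := by
      rw [crossRatio, abs_of_pos hv, abs_of_pos (by linarith), abs_of_pos hx0, abs_of_pos hy0]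
      field_simp
      ring
    have e1 : (hi - lo) / (Q - hi) ≤ 2 / δ := by
      rw [div_le_div_iff₀ hy0 hδ]; linarith
    have e2 : (hi - lo) / (lo - P) ≤ 2 := by
      rw [div_le_iff₀ hx0]; linarith
    have e3 : (hi - lo) / (Q - hi) * ((hi - lo) / (lo - P)) ≤ 2 / δ * 2 :=
      mul_le_mul e1 e2 (by positivity) (by positivity)
    rw [e]
    have : 2 / δ * 2 = 4 / δ := by ring
    linarith
  have h2 : (β - α) / (α - A) ≤ crossRatio A α β B := by
    rw [crossRatio, abs_of_pos (by linarith), abs_of_pos (by linarith), abs_of_pos (by linarith),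
      abs_of_pos (by linarith), div_le_div_iff₀ (by linarith)
        (mul_pos (by linarith) (by linarith))]
    have : 0 ≤ (β - α) * (α - A) * (α - A + (β - α)) := by
      refine mul_nonneg (mul_nonneg ?_ ?_) ?_ <;> linarith
    nlinarith
  have h3 : (β - α) / (α - A) ≤ X :=
    h2.trans (hcr.trans (mul_le_mul_of_nonneg_left h1 (Real.exp_pos _).le))
  rw [div_le_iff₀ (by linarith)] at h3
  rw [lt_div_iff₀ hXpos] at hbd
  linarith

/-- The image of a record interval is eventually much closer to the critical value than its own
length. -/
theorem exists_inGap_le (h : WanderingSystem F a c b α β x) {C : ℝ} (hC : 0 ≤ C)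
    (hCR : CrossRatioBound F a c b C) (hD : DistortionBound F a c b) {δ : ℝ} (hδ : 0 < δ) :
    ∃ N, ∀ n > N, IsRecord F c α β n →
      inGap F c α β n ≤ δ * (outGap F c α β n - inGap F c α β n) := by
  -- The bound `1 / 2` makes the lengths at least halve from record to record, and `2 * ε` is what
  -- the summed gaps amount to.
  obtain ⟨ε, hε, hε1, hεδ⟩ : ∃ ε, 0 < ε ∧ ε ≤ 1 / 2 ∧ 2 * ε ≤ δ :=
    ⟨min (1 / 2) (δ / 2), by positivity, min_le_left _ _, by
      have := min_le_right (1 / 2) (δ / 2); linarith⟩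
  obtain ⟨N, hN⟩ := h.exists_next_gap_lt hC hCR hε
  set V : ℕ → ℝ := fun n => outGap F c α β n - inGap F c α β n with hV
  have hVpos : ∀ n, 0 < V n := fun n => sub_pos.2 (h.inGap_lt_outGap n)
  have hVlim : Tendsto V atTop (𝓝 0) := by
    have := (tendsto_add_atTop_iff_nat 1).2 h.tendsto_length
    refine this.congr fun n => ?_
    simp only [hV, outGap, inGap]; ring
  have hVnext : ∀ n m, IsNext F c α β n m → V m ≤ inGap F c α β n - inGap F c α β m := by
    intro n m hnm
    have := h.outGap_le hnm.2.1
    simp only [hV]; linarith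
  -- Lengths tend to zero, so they cannot increase at all late records. Once the length has failed
  -- to increase, the gap estimate makes it decrease for ever after.
  obtain ⟨p₀, n₀, hp₀, hp₀N, hpn₀, hle₀⟩ : ∃ p n, IsRecord F c α β p ∧ N < p ∧
      IsNext F c α β p n ∧ V n ≤ V p := by
    by_contra! hcon
    obtain ⟨m₀, hm₀, hr₀⟩ := h.exists_record_gt hD N
    have hall := h.record_induction hr₀ (Q := fun m => V m₀ ≤ V m) le_rfl
      fun n m hn hr hnm hQ => hQ.trans (hcon n m hr (by omega) hnm).le
    obtain ⟨M, hM⟩ := (hVlim.eventually_lt_const (hVpos m₀)).exists_forall_of_atTop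
    obtain ⟨m, hm, hrm⟩ := h.exists_record_gt hD (max m₀ M)
    have := hM m ((le_max_right _ _).trans hm.le)
    exact absurd (hall m ((le_max_left _ _).trans hm.le) hrm) (not_le.2 this)
  have hn₀ := isRecord_of_isNext hp₀ hpn₀
  have hn₀' := hpn₀.1
  have hdec : ∀ m, n₀ ≤ m → IsRecord F c α β m →
      ∃ p, IsRecord F c α β p ∧ IsNext F c α β p m ∧ V m ≤ V p := by
    refine h.record_induction hn₀ ⟨p₀, hp₀, hpn₀, hle₀⟩ ?_
    rintro n m hn hr hnm ⟨p, hp, hpn, hle⟩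
    refine ⟨n, hr, hnm, ?_⟩
    have h1 := hN p n m (by omega) hp hpn hnm hle
    have h2 := hVnext n m hnm
    have h3 : ε * V n ≤ 1 * V n := mul_le_mul_of_nonneg_right (by linarith) (hVpos n).le
    simp only [hV] at h1 h2 h3 ⊢
    linarith
  have hgap : ∀ n m, n₀ ≤ n → IsRecord F c α β n → IsNext F c α β n m →
      inGap F c α β n - inGap F c α β m < ε * V n := by
    intro n m hn hr hnm
    obtain ⟨p, hp, hpn, hle⟩ := hdec n hn hr
    exact hN p n m (by omega) hp hpn hnm hle
  refine ⟨n₀, fun n hn hr => ?_⟩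
  suffices inGap F c α β n - 2 * ε * V n ≤ 0 by
    have := mul_le_mul_of_nonneg_right hεδ (hVpos n).le
    simp only [hV] at this ⊢
    linarith
  by_contra! hpos
  -- Along records `inGap - 2 * ε * V` does not decrease: the gap loses less than `ε * V`, while `V`
  -- at least halves. The gap itself tends to zero, so this quantity is never positive.
  have hall := h.record_induction hr
    (Q := fun m => inGap F c α β n - 2 * ε * V n ≤ inGap F c α β m - 2 * ε * V m) le_rfl ?_
  · obtain ⟨M, hM⟩ := h.exists_record_outGap_lt hD hpos
    obtain ⟨m, hm, hrm⟩ := h.exists_record_gt hD (max n M)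
    have h1 := hall m ((le_max_left _ _).trans hm.le) hrm
    have h2 := hM m ((le_max_right _ _).trans_lt hm) hrm
    have h3 := h.inGap_lt_outGap m
    have h4 := mul_pos hε (hVpos m)
    linarith
  · intro k m hk hrk hkm hQ
    have h1 := hgap k m (by omega) hrk hkm
    have h2 := hVnext k m hkm
    have h3 : ε * V k ≤ 1 / 2 * V k := mul_le_mul_of_nonneg_right hε1 (hVpos k).le
    have h4 : ε * (2 * V m) ≤ ε * V k := mul_le_mul_of_nonneg_left (by linarith) hε.le
    linarith

end WanderingSystem

/-! ### Level sets of the map and the branch between two consecutive records -/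

namespace UnimodalSystem

variable {F : ℝ → ℝ} {a c b : ℝ}

theorem side_lt (h : UnimodalSystem F a c b) {s t t' : ℝ} (hs : s = 1 ∨ s = -1) (ht : 0 ≤ t)
    (htt : t < t') : F (c + s * t') < F (c + s * t) := by
  rcases hs with rfl | rfl
  · exact h.anti (mem_Ici.2 (by linarith)) (mem_Ici.2 (by linarith)) (by linarith)
  · exact h.mono (mem_Iic.2 (by linarith)) (mem_Iic.2 (by linarith)) (by linarith)

theorem side_lt_iff (h : UnimodalSystem F a c b) {s t t' : ℝ} (hs : s = 1 ∨ s = -1) (ht : 0 ≤ t)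
    (ht' : 0 ≤ t') : F (c + s * t') < F (c + s * t) ↔ t < t' := by
  refine ⟨fun hlt => ?_, h.side_lt hs ht⟩
  by_contra! hle
  rcases hle.eq_or_lt with rfl | hlt'
  · exact lt_irrefl _ hlt
  · exact lt_asymm hlt (h.side_lt hs ht' hlt')

theorem exists_level (h : UnimodalSystem F a c b) {s v : ℝ} (hs : s = 1 ∨ s = -1)
    (hv : v ∈ Ico a (F c)) : ∃ w, 0 < w ∧ c + s * w ∈ Icc a b ∧ F (c + s * w) = v := by
  have hac := h.lt_left
  have hcb := h.lt_right
  rcases hs with rfl | rfl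
  · have := intermediate_value_Icc' hcb.le h.cont.continuousOn
    rw [h.right_image] at this
    obtain ⟨z, hz, hzv⟩ := this (Ico_subset_Icc_self hv)
    refine ⟨z - c, ?_, ?_, ?_⟩
    · rcases hz.1.eq_or_lt with rfl | hlt
      · exact absurd hzv hv.2.ne'
      · linarith
    · rw [one_mul, add_sub_cancel]; exact ⟨by linarith [hz.1], hz.2⟩
    · rw [one_mul, add_sub_cancel, hzv]
  · have := intermediate_value_Icc hac.le h.cont.continuousOn
    rw [h.left_fixed] at this
    obtain ⟨z, hz, hzv⟩ := this (Ico_subset_Icc_self hv)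
    have e : c + -1 * (c - z) = z := by ring
    refine ⟨c - z, ?_, ?_, ?_⟩
    · rcases hz.2.eq_or_lt with rfl | hlt
      · exact absurd hzv hv.2.ne'
      · linarith
    · rw [e]; exact ⟨hz.1, by linarith [hz.2]⟩
    · rw [e, hzv]

theorem lt_iff_mem_Ioo (h : UnimodalSystem F a c b) {w₁ w₂ v z : ℝ} (hw₁ : 0 < w₁) (hw₂ : 0 < w₂)
    (h₁ : F (c - w₁) = v) (h₂ : F (c + w₂) = v) : v < F z ↔ z ∈ Ioo (c - w₁) (c + w₂) := by
  rcases le_total z c with hz | hz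
  · rw [← h₁, h.mono.lt_iff_lt (mem_Iic.2 (by linarith)) (mem_Iic.2 hz)]
    exact ⟨fun hh => ⟨hh, by linarith⟩, fun hh => hh.1⟩
  · rw [← h₂, h.anti.lt_iff_gt (mem_Ici.2 (by linarith)) (mem_Ici.2 hz)]
    exact ⟨fun hh => ⟨by linarith, hh⟩, fun hh => hh.2⟩

theorem le_iff_mem_Icc (h : UnimodalSystem F a c b) {w₁ w₂ v z : ℝ} (hw₁ : 0 < w₁) (hw₂ : 0 < w₂)
    (h₁ : F (c - w₁) = v) (h₂ : F (c + w₂) = v) : v ≤ F z ↔ z ∈ Icc (c - w₁) (c + w₂) := by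
  rcases le_total z c with hz | hz
  · rw [← h₁, h.mono.le_iff_le (mem_Iic.2 (by linarith)) (mem_Iic.2 hz)]
    exact ⟨fun hh => ⟨hh, by linarith⟩, fun hh => hh.1⟩
  · rw [← h₂, h.anti.le_iff_ge (mem_Ici.2 (by linarith)) (mem_Ici.2 hz)]
    exact ⟨fun hh => ⟨by linarith, hh⟩, fun hh => hh.2⟩

/-- The set where `F` exceeds a level is an interval. -/
theorem lt_of_mem_uIcc (h : UnimodalSystem F a c b) {v y₁ y₂ z : ℝ} (h₁ : v < F y₁) (h₂ : v < F y₂)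
    (hz : z ∈ uIcc y₁ y₂) : v < F z := by
  have key : ∀ y₁ y₂, v < F y₁ → v < F y₂ → y₁ ≤ z → z ≤ y₂ → v < F z := by
    intro y₁ y₂ h₁ h₂ hz₁ hz₂
    rcases le_total z c with hzc | hzc
    · exact h₁.trans_le (h.mono.monotoneOn (mem_Iic.2 (hz₁.trans hzc)) (mem_Iic.2 hzc) hz₁)
    · exact h₂.trans_le (h.anti.antitoneOn (mem_Ici.2 hzc) (mem_Ici.2 (hzc.trans hz₂)) hz₂)
  rcases mem_uIcc.1 hz with hz | hz
  · exact key _ _ h₁ h₂ hz.1 hz.2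
  · exact key _ _ h₂ h₁ hz.1 hz.2

end UnimodalSystem

namespace WanderingSystem

variable {F : ℝ → ℝ} {a c b α β x : ℝ}

theorem le_lo_of_isNext (h : WanderingSystem F a c b α β x) {n m j : ℕ} (hnm : IsNext F c α β n m)
    (h1 : n < j) (h2 : j < m) : F^[j + 1] x < loEnd F α β (n + 1) :=
  (h.mid_mem (j + 1)).2.trans_le (h.hi_le_lo (hnm.2.2 j h1 h2))

/-- The branch of the return to the level set `{F > lo (n + 1)}` along two consecutive records. -/
theorem exists_pullback_return (h : WanderingSystem F a c b α β x) {n k : ℕ}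
    (hnm : IsNext F c α β n (n + 1 + k)) {w₁ w₂ : ℝ} (hw₁ : 0 < w₁) (hw₂ : 0 < w₂)
    (ha : a ≤ c - w₁) (hb : c + w₂ ≤ b)
    (h₁ : F (c - w₁) = loEnd F α β (n + 1)) (h₂ : F (c + w₂) = loEnd F α β (n + 1)) :
    ∃ A B, A ∈ Icc a b ∧ B ∈ Icc a b ∧ A < loEnd F α β (n + 1) ∧ hiEnd F α β (n + 1) < B ∧
      FreeOn F c k (Icc A B) ∧ (∀ w ∈ Ioo A B, F^[k] w ∈ Ioo (c - w₁) (c + w₂)) ∧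
      ((F^[k] A = c - w₁ ∧ F^[k] B = c + w₂) ∨ (F^[k] A = c + w₂ ∧ F^[k] B = c - w₁)) := by
  have hlev := fun z => h.lt_iff_mem_Ioo (z := z) hw₁ hw₂ h₁ h₂
  have hnext := fun j h1 h2 => h.le_lo_of_isNext hnm (j := j) h1 h2
  have hHm : ∀ z ∈ Icc (loEnd F α β (n + 1 + k)) (hiEnd F α β (n + 1 + k)),
      loEnd F α β (n + 1) < F z := by
    intro z hz
    have h1 := (h.iterate_mem_Icc hz 1).1
    rw [Function.iterate_one] at h1
    linarith [h.hi_le_lo hnm.2.1, h.lo_lt_hi (n + 1)]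
  have hx1 := h.mid_mem (n + 1)
  have hpull := h.exists_pullback (k := k) (y := F^[n + 1] x)
    (P := c - w₁) (Q := c + w₂) ⟨by linarith [(h.lo_mem (n + 1)).1, hx1.1],
      by linarith [(h.hi_mem (n + 1)).2, hx1.2]⟩ ha hb ?_ ?_ ?_
  rotate_left
  · intro i hi y hy
    rw [mem_singleton_iff.1 hy, ← Function.iterate_add_apply]
    exact h.free _ x ⟨h.lt_mid.le, h.mid_lt.le⟩
  · rw [← Function.iterate_add_apply, ← hlev, add_comm k]
    exact hHm _ (h.mid_mem_Icc _)
  -- At a break the branch would take the value `F^[n + 1] x` at time `i + 1`, so an orbit point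
  -- from strictly between the two record times would lie in the level set.
  · intro z hz hgood i hi hzc
    have hFz : F^[i + 1] z = F c := by rw [Function.iterate_succ_apply', hzc]
    have hlt : F^[i + 1] (F^[n + 1] x) < F^[n + 1] x := by
      rw [← Function.iterate_add_apply, show i + 1 + (n + 1) = (n + 1 + i) + 1 by omega]
      exact (hnext (n + 1 + i) (by omega) (by omega)).trans hx1.1
    have hltc : F^[n + 1] x < F c := hx1.2.trans (h.hi_lt_peak n)
    have hv : F^[n + 1] x ∈ uIcc (F^[i + 1] (F^[n + 1] x)) (F^[i + 1] z) := by
      rw [hFz]; exact mem_uIcc.2 (Or.inl ⟨hlt.le, hltc.le⟩)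
    obtain ⟨w, hw, hwv⟩ := intermediate_value_uIcc (h.cont_iterate (i + 1)).continuousOn hv
    have hwz : w ≠ z := by
      rintro rfl
      exact hltc.ne (hwv.symm.trans hFz)
    have h1 := (hgood w hw hwz).2
    rw [show k = (k - (i + 1)) + (i + 1) by omega, Function.iterate_add_apply, hwv,
      ← Function.iterate_add_apply, ← hlev, ← Function.iterate_succ_apply' F,
      show (k - (i + 1) + (n + 1)).succ = (n + k - i) + 1 by omega] at h1
    exact lt_asymm h1 (hnext (n + k - i) (by omega) (by omega))
  obtain ⟨A, B, hA, hB, hAx, hxB, hf, hmap, hends⟩ := hpull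
  have hmem : ∀ z ∈ Icc (loEnd F α β (n + 1)) (hiEnd F α β (n + 1)),
      F^[k] z ∈ Ioo (c - w₁) (c + w₂) := fun z hz => (hlev _).1 (hHm _ (h.iterate_mem_Icc hz k))
  have hnotmem : ∀ z, F^[k] z = c - w₁ ∨ F^[k] z = c + w₂ →
      z ∉ Icc (loEnd F α β (n + 1)) (hiEnd F α β (n + 1)) := by
    intro z hz hz'
    have := hmem z hz'
    rcases hz with hz | hz <;> rw [hz] at this
    · exact lt_irrefl _ this.1
    · exact lt_irrefl _ this.2
  refine ⟨A, B, hA, hB, ?_, ?_, hf, hmap, hends⟩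
  · by_contra! hcon
    exact hnotmem A (hends.imp (fun h => h.1) (fun h => h.1)) ⟨hcon, by linarith [hx1.2]⟩
  · by_contra! hcon
    exact hnotmem B (hends.symm.imp (fun h => h.2) (fun h => h.2)) ⟨by linarith [hx1.1], hcon⟩

/-- The branch of `exists_pullback_return` distorts cross-ratios by a bounded factor. -/
theorem koebe_return (h : WanderingSystem F a c b α β x) {C : ℝ} (hC : 0 ≤ C)
    (hCR : CrossRatioBound F a c b C) {n k : ℕ}
    (hnm : IsNext F c α β n (n + 1 + k)) {w₁ w₂ : ℝ} (hw₁ : 0 < w₁) (hw₂ : 0 < w₂)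
    (ha : a ≤ c - w₁) (hb : c + w₂ ≤ b)
    (h₁ : F (c - w₁) = loEnd F α β (n + 1)) (h₂ : F (c + w₂) = loEnd F α β (n + 1)) :
    ∃ A B, A ∈ Icc a b ∧ B ∈ Icc a b ∧ A < loEnd F α β (n + 1) ∧ hiEnd F α β (n + 1) < B ∧
      FreeOn F c k (Icc A B) ∧ (∀ w ∈ Ioo A B, F^[k] w ∈ Ioo (c - w₁) (c + w₂)) ∧
      ((F^[k] A = c - w₁ ∧ F^[k] B = c + w₂) ∨ (F^[k] A = c + w₂ ∧ F^[k] B = c - w₁)) ∧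
      ∀ x₁ x₂ x₃ x₄, A ≤ x₁ → x₁ < x₂ → x₂ < x₃ → x₃ < x₄ → x₄ ≤ B →
        crossRatio x₁ x₂ x₃ x₄ ≤ Real.exp (C * (3 * (b - a))) *
          crossRatio (F^[k] x₁) (F^[k] x₂) (F^[k] x₃) (F^[k] x₄) := by
  obtain ⟨A, B, hA, hB, hAlo, hhiB, hf, hmap, hends⟩ :=
    h.exists_pullback_return hnm hw₁ hw₂ ha hb h₁ h₂
  refine ⟨A, B, hA, hB, hAlo, hhiB, hf, hmap, hends, fun x₁ x₂ x₃ x₄ hx1 h12 h23 h34 hx4 => ?_⟩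
  have hlohi := h.lo_lt_hi (n + 1)
  have hAB : A ≤ B := by linarith
  have hu : Icc A B = uIcc A B := (uIcc_of_le hAB).symm
  have hlev := fun z => h.le_iff_mem_Icc (z := z) hw₁ hw₂ h₁ h₂
  have hnext := fun j h1 h2 => h.le_lo_of_isNext hnm (j := j) h1 h2
  set T : ℕ → Set ℝ := fun j => uIcc (F^[j] A) (F^[j] B) with hT
  have hTimg : ∀ j ≤ k, F^[j] '' Icc A B = T j := fun j hj => by
    rw [hu]; exact h.image_uIcc (hu ▸ hf.mono hj Subset.rfl)
  have hTmap : ∀ j l, j + l ≤ k → ∀ z ∈ T j, F^[l] z ∈ T (j + l) := by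
    intro j l hjl z hz
    rw [← hTimg j (by omega)] at hz
    obtain ⟨y, hy, rfl⟩ := hz
    rw [← hTimg (j + l) hjl, ← Function.iterate_add_apply, add_comm l]
    exact mem_image_of_mem _ hy
  have hself : ∀ j ≤ k, Icc (loEnd F α β (n + 1 + j)) (hiEnd F α β (n + 1 + j)) ⊆ T j := by
    intro j hj
    rw [← h.image_Icc, ← hTimg j hj]
    exact image_mono (Icc_subset_Icc hAlo.le hhiB.le)
  have horb : ∀ i j, F^[i] (F^[j] x) = F^[j + i] x := fun i j => by
    rw [← Function.iterate_add_apply, add_comm]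
  have hTk : ∀ z ∈ T k, loEnd F α β (n + 1) ≤ F z := by
    intro z hz
    rw [hlev]
    rcases hends with ⟨e1, e2⟩ | ⟨e1, e2⟩ <;> simp only [hT, e1, e2] at hz
    · rwa [uIcc_of_le (by linarith)] at hz
    · rwa [uIcc_of_ge (by linarith)] at hz
  -- orbit points strictly between the two record times stay below the level
  have hout : ∀ j, n < j → j < n + 1 + k → F^[j] x ∉ T k := by
    intro j h1 h2 hmem
    have := hTk _ hmem
    rw [← Function.iterate_succ_apply' F] at this
    exact absurd (hnext j h1 h2) (not_lt.2 this)
  -- Pushing forward to `T k` contradicts `hout` directly if `j < i`. If `i < j`, pushing forward by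
  -- `k - j` puts the record point and an intermediate orbit point into the same `T i'`. Their
  -- images under `F` have `F^[n + 1] x` between them, so this point lies in `T (i' + 1)`, and
  -- pushing it on to `T k` contradicts `hout`.
  have hmult : ∀ i < k, ∀ j < k, i ≠ j → F^[n + 1 + j] x ∉ T i := by
    intro i hi j hj hij hmem
    rcases lt_or_gt_of_ne hij with hlt | hlt
    · set i' := i + (k - j) with hi'
      have hi'k : i' < k := by omega
      have hm1 := hTmap i (k - j) (by omega) _ hmem
      rw [horb, show n + 1 + j + (k - j) = n + 1 + k by omega] at hm1
      have hm2 := hself i' hi'k.le (h.mid_mem_Icc _)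
      have hm1' := hTmap i' 1 (by omega) _ hm1
      have hm2' := hTmap i' 1 (by omega) _ hm2
      rw [horb] at hm1' hm2'
      have hxn : F^[n + 1] x ∈ T (i' + 1) := by
        refine (show (T (i' + 1)).OrdConnected from ordConnected_uIcc).out hm2' hm1' ⟨?_, ?_⟩
        · exact ((hnext (n + 1 + i') (by omega) (by omega)).trans (h.mid_mem (n + 1)).1).le
        · linarith [(h.mid_mem (n + 1)).2, h.hi_le_lo hnm.2.1, (h.mid_mem (n + 1 + k + 1)).1]
      have := hTmap (i' + 1) (k - (i' + 1)) (by omega) _ hxn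
      rw [horb, show i' + 1 + (k - (i' + 1)) = k by omega] at this
      exact hout _ (by omega) (by omega) this
    · have := hTmap i (k - i) (by omega) _ hmem
      rw [horb, show i + (k - i) = k by omega] at this
      exact hout _ (by omega) (by omega) this
  refine h.koebe hC hCR hA hB (hu ▸ hf) (u := fun i => loEnd F α β (n + 1 + i))
    (v := fun i => hiEnd F α β (n + 1 + i)) (fun i _ => (h.lo_lt_hi _).le)
    (fun i hi => hself i hi.le) (fun i _ j _ hij => h.disj _ _ (by omega))
    (fun i hi j hj hij hsub => hmult i hi j hj hij (hsub (h.mid_mem_Icc _)))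
    (Or.inl ⟨h12, h23, h34⟩) ?_ ?_
  · rw [← hu]; exact ⟨hx1, by linarith⟩
  · rw [← hu]; exact ⟨by linarith, hx4⟩

end WanderingSystem

/-! ### The side of the interval and the returns of the critical orbit -/

open Classical in
/-- The side of `c` on which the `n`-th interval lies. -/
noncomputable def sideSign (F : ℝ → ℝ) (c α β : ℝ) (n : ℕ) : ℝ := if c < loEnd F α β n then 1 else -1

/-- Distance from `c` to the near end of the `n`-th interval. -/
noncomputable def nearDist (F : ℝ → ℝ) (c α β : ℝ) (n : ℕ) : ℝ :=
  min |loEnd F α β n - c| |hiEnd F α β n - c|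

/-- Distance from `c` to the far end of the `n`-th interval. -/
noncomputable def farDist (F : ℝ → ℝ) (c α β : ℝ) (n : ℕ) : ℝ :=
  max |loEnd F α β n - c| |hiEnd F α β n - c|

/-- The branch of `F^[k]` along the orbit extends from the image of the `n`-th interval up to the
critical value, which it brings back to the level set `{F > loEnd F α β (n + 1)}`. -/
def IsReturn (F : ℝ → ℝ) (c α β : ℝ) (n k : ℕ) : Prop :=
  FreeOn F c k (Icc (loEnd F α β (n + 1)) (F c)) ∧ loEnd F α β (n + 1) < F (F^[k] (F c))

theorem mem_uIcc_side {s c y z w : ℝ} (hs : s = 1 ∨ s = -1) (h : w ∈ uIcc y z) :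
    s * (w - c) ∈ uIcc (s * (y - c)) (s * (z - c)) := by
  rcases hs with rfl | rfl <;> rcases mem_uIcc.1 h with h | h <;> rw [mem_uIcc]
  · left; constructor <;> linarith
  · right; constructor <;> linarith
  · right; constructor <;> linarith
  · left; constructor <;> linarith

theorem mem_uIcc_of_side {s c y z w : ℝ} (hs : s = 1 ∨ s = -1)
    (h : s * (w - c) ∈ uIcc (s * (y - c)) (s * (z - c))) : w ∈ uIcc y z := by
  rcases hs with rfl | rfl <;> rcases mem_uIcc.1 h with h | h <;> rw [mem_uIcc]
  · left; constructor <;> linarith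
  · right; constructor <;> linarith
  · right; constructor <;> linarith
  · left; constructor <;> linarith

theorem side_add_mul {s c z : ℝ} (hs : s = 1 ∨ s = -1) : c + s * (s * (z - c)) = z := by
  rcases hs with rfl | rfl <;> ring

namespace WanderingSystem

variable {F : ℝ → ℝ} {a c b α β x : ℝ}

theorem sideSign_eq (F : ℝ → ℝ) (c α β : ℝ) (n : ℕ) :
    sideSign F c α β n = 1 ∨ sideSign F c α β n = -1 := by
  unfold sideSign; split_ifs <;> simp

/-- In the coordinate `c + s * t`, `s` being the side of the interval, the two sides of `c` look
alike: `F` decreases in `t`, so the near end has the higher image. All quantitative estimates use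
this coordinate. -/
theorem side_spec (h : WanderingSystem F a c b α β x) (n : ℕ) :
    0 < nearDist F c α β n ∧ nearDist F c α β n < farDist F c α β n ∧
      F (c + sideSign F c α β n * nearDist F c α β n) = hiEnd F α β (n + 1) ∧
      F (c + sideSign F c α β n * farDist F c α β n) = loEnd F α β (n + 1) ∧
      uIcc (c + sideSign F c α β n * nearDist F c α β n) (c + sideSign F c α β n * farDist F c α β n)
        = Icc (loEnd F α β n) (hiEnd F α β n) := by
  have hlt := h.lo_lt_hi n
  have hlt1 := h.lo_lt_hi (n + 1)
  have hc := h.notMem n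
  have himg := h.image_Icc n 1
  rw [Function.iterate_one] at himg
  have hF : ∀ z ∈ Icc (loEnd F α β n) (hiEnd F α β n),
      F z ∈ Icc (loEnd F α β (n + 1)) (hiEnd F α β (n + 1)) := fun z hz =>
    himg ▸ mem_image_of_mem F hz
  obtain ⟨z₁, hz₁, hz₁'⟩ := himg.symm ▸ left_mem_Icc.2 hlt1.le
  obtain ⟨z₂, hz₂, hz₂'⟩ := himg.symm ▸ right_mem_Icc.2 hlt1.le
  have hlm := left_mem_Icc.2 hlt.le
  have hhm := right_mem_Icc.2 hlt.le
  unfold sideSign nearDist farDist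
  split_ifs with hside
  · rw [abs_of_pos (by linarith), abs_of_pos (by linarith), min_eq_left (by linarith),
      max_eq_right (by linarith), one_mul, one_mul, add_sub_cancel, add_sub_cancel]
    refine ⟨by linarith, by linarith, le_antisymm (hF _ hlm).2 ?_, le_antisymm ?_ (hF _ hhm).1,
      uIcc_of_le hlt.le⟩
    · rw [← hz₂']
      exact h.anti.antitoneOn (mem_Ici.2 hside.le) (mem_Ici.2 (by linarith [hz₂.1])) hz₂.1
    · rw [← hz₁']
      exact h.anti.antitoneOn (mem_Ici.2 (by linarith [hz₁.1])) (mem_Ici.2 (by linarith)) hz₁.2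
  · have hhi : hiEnd F α β n < c := by
      by_contra! hcon
      exact hc ⟨not_lt.1 hside, hcon⟩
    rw [abs_of_neg (by linarith), abs_of_neg (by linarith), min_eq_right (by linarith),
      max_eq_left (by linarith)]
    rw [show c + -1 * -(hiEnd F α β n - c) = hiEnd F α β n by ring,
      show c + -1 * -(loEnd F α β n - c) = loEnd F α β n by ring]
    refine ⟨by linarith, by linarith, le_antisymm (hF _ hhm).2 ?_, le_antisymm ?_ (hF _ hlm).1,
      uIcc_of_ge hlt.le⟩
    · rw [← hz₂']
      exact h.mono.monotoneOn (mem_Iic.2 (by linarith [hz₂.2])) (mem_Iic.2 hhi.le) hz₂.2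
    · rw [← hz₁']
      exact h.mono.monotoneOn (mem_Iic.2 (by linarith)) (mem_Iic.2 (by linarith [hz₁.2])) hz₁.1

theorem side_mem (h : WanderingSystem F a c b α β x) {n : ℕ} {z : ℝ}
    (hz : z ∈ Icc (loEnd F α β n) (hiEnd F α β n)) :
    sideSign F c α β n * (z - c) ∈ Icc (nearDist F c α β n) (farDist F c α β n) := by
  obtain ⟨-, hnf, -, -, hu⟩ := h.side_spec n
  have hs := sideSign_eq F c α β n
  rw [← hu] at hz
  have := mem_uIcc_side (c := c) hs hz
  have e : ∀ t, sideSign F c α β n * (c + sideSign F c α β n * t - c) = t := fun t => by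
    rcases hs with hs | hs <;> rw [hs] <;> ring
  rwa [e, e, uIcc_of_le hnf.le] at this

section Return

variable {n k : ℕ}

theorem lo_lt_of_mem (h : WanderingSystem F a c b α β x) (hnm : IsNext F c α β n (n + 1 + k)) {z : ℝ}
    (hz : z ∈ Icc (loEnd F α β (n + 1 + k)) (hiEnd F α β (n + 1 + k))) :
    loEnd F α β (n + 1) < F z := by
  have h1 := (h.iterate_mem_Icc hz 1).1
  rw [Function.iterate_one] at h1
  linarith [h.hi_le_lo hnm.2.1, h.lo_lt_hi (n + 1)]

theorem lo_lt_peak (h : WanderingSystem F a c b α β x) (n : ℕ) : loEnd F α β (n + 1) < F c :=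
  (h.lo_lt_hi (n + 1)).trans (h.hi_lt_peak n)

theorem iterate_mem_uIcc (h : WanderingSystem F a c b α β x) (hr : IsReturn F c α β n k) {u v y : ℝ}
    (hu : loEnd F α β (n + 1) ≤ u) (hv : v ≤ F c) (hy : y ∈ Icc u v) :
    F^[k] y ∈ uIcc (F^[k] u) (F^[k] v) := by
  have huv : u ≤ v := hy.1.trans hy.2
  refine h.mem_uIcc_iterate ?_ (by rwa [uIcc_of_le huv])
  rw [uIcc_of_le huv]
  exact hr.1.mono le_rfl (Icc_subset_Icc hu hv)

/-- The branch is monotone and superlevel sets of `F` are intervals, so only the two ends matter: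
one lands in the interval of the next record, the other is the return of the critical value. -/
theorem lo_lt_return (h : WanderingSystem F a c b α β x) (hnm : IsNext F c α β n (n + 1 + k))
    (hr : IsReturn F c α β n k) {y : ℝ} (hy : y ∈ Icc (loEnd F α β (n + 1)) (F c)) :
    loEnd F α β (n + 1) < F (F^[k] y) :=
  h.lt_of_mem_uIcc (h.lo_lt_of_mem hnm (h.iterate_mem_Icc (left_mem_Icc.2 (h.lo_lt_hi _).le) k)) hr.2
    (h.iterate_mem_uIcc hr le_rfl le_rfl hy)

theorem injOn_return (h : WanderingSystem F a c b α β x) (hr : IsReturn F c α β n k) {s : ℝ}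
    (hs : s = 1 ∨ s = -1) :
    InjOn F^[k + 1] {z | 0 ≤ s * (z - c) ∧ loEnd F α β (n + 1) < F z} := by
  rw [Function.iterate_succ]
  refine InjOn.comp (t := Icc (loEnd F α β (n + 1)) (F c))
    (h.injOn_iterate ordConnected_Icc hr.1) (h.injOn_side ?_) fun z hz => ⟨hz.2.le, h.le_peak z⟩
  rcases hs with rfl | rfl
  · right; intro z hz; exact mem_Ici.2 (by linarith [hz.1])
  · left; intro z hz; exact mem_Iic.2 (by linarith [hz.1])

/-- Before the return, images of the extended interval stay below the level. -/
theorem iterate_le_lo (h : WanderingSystem F a c b α β x) (hnm : IsNext F c α β n (n + 1 + k))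
    (hr : IsReturn F c α β n k) {i : ℕ} (hi : 0 < i) (hik : i ≤ k) {y : ℝ}
    (hy : y ∈ Icc (loEnd F α β (n + 1)) (F c)) : F^[i] y ≤ loEnd F α β (n + 1) := by
  by_contra! hcon
  have hlow : ∀ j, 0 < j → j ≤ k → F^[j] (loEnd F α β (n + 1)) ≤ loEnd F α β (n + 1) := by
    intro j h1 h2
    have := (h.iterate_mem_Icc (left_mem_Icc.2 (h.lo_lt_hi (n + 1)).le) j).2
    rw [show n + 1 + j = (n + j) + 1 by omega] at this
    exact this.trans (h.hi_le_lo (hnm.2.2 _ (by omega) (by omega)))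
  -- A point that is exactly at the level at time `i` must be above it at time `k + 1`; but an
  -- intermediate image of the low end itself stays at or below the level.
  obtain ⟨z, hz, hzv⟩ := intermediate_value_Icc hy.1 (h.cont_iterate i).continuousOn
    ⟨hlow i hi hik, hcon.le⟩
  have h1 := h.lo_lt_return hnm hr ⟨hz.1, hz.2.trans hy.2⟩
  rw [← Function.iterate_succ_apply' F, show k.succ = (k + 1 - i) + i by omega,
    Function.iterate_add_apply, hzv] at h1
  exact absurd (hlow _ (by omega) (by omega)) (not_le.2 h1)

/-- The returning critical orbit lands on the side of `c` opposite to the interval. -/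
theorem return_opposite (h : WanderingSystem F a c b α β x) (hnm : IsNext F c α β n (n + 1 + k))
    (hr : IsReturn F c α β n k) : sideSign F c α β (n + 1 + k) * (F^[k] (F c) - c) < 0 := by
  by_contra! hcon
  have hs := sideSign_eq F c α β (n + 1 + k)
  set s := sideSign F c α β (n + 1 + k) with hsdef
  have hsp := h.side_spec (n + 1 + k)
  -- If the critical value returned to the same side, that half of the level set would be mapped
  -- injectively into itself by `F^[k + 1]`.
  refine h.noReturn (n + 1 + k) (k + 1) {z | 0 ≤ s * (z - c) ∧ loEnd F α β (n + 1) < F z} (by omega)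
    ?_ ?_ ?_ (h.injOn_return hr hs)
  · refine ⟨fun y hy z hz w hw => ⟨?_, h.lt_of_mem_uIcc hy.2 hz.2 (Icc_subset_uIcc hw)⟩⟩
    have h1 := mem_uIcc_side (c := c) hs (Icc_subset_uIcc hw)
    exact (le_inf hy.1 hz.1).trans h1.1
  · exact ⟨hsp.1.le.trans (h.side_mem (h.mid_mem_Icc _)).1, h.lo_lt_of_mem hnm (h.mid_mem_Icc _)⟩
  · intro z hz
    have hFz : F z ∈ Icc (loEnd F α β (n + 1)) (F c) := ⟨hz.2.le, h.le_peak z⟩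
    refine ⟨?_, ?_⟩
    · rw [Function.iterate_succ_apply]
      have h1 := mem_uIcc_side (c := c) hs (h.iterate_mem_uIcc hr le_rfl le_rfl hFz)
      refine (le_inf ?_ hcon).trans h1.1
      exact hsp.1.le.trans (h.side_mem (h.iterate_mem_Icc (left_mem_Icc.2 (h.lo_lt_hi _).le) k)).1
    · rw [Function.iterate_succ_apply]
      exact h.lo_lt_return hnm hr hFz

/-- The critical value returns across `c`, which fixes the orientation of the branch: the low end
goes to the far end, and the high end to the near one. -/
theorem return_lo (h : WanderingSystem F a c b α β x) (hnm : IsNext F c α β n (n + 1 + k))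
    (hr : IsReturn F c α β n k) :
    sideSign F c α β (n + 1 + k) * (F^[k] (loEnd F α β (n + 1)) - c) = farDist F c α β (n + 1 + k) := by
  have hs := sideSign_eq F c α β (n + 1 + k)
  have hop := h.return_opposite hnm hr
  have hsp := h.side_spec (n + 1 + k)
  have hlt := h.lo_lt_hi (n + 1)
  refine le_antisymm (h.side_mem (h.iterate_mem_Icc (left_mem_Icc.2 hlt.le) k)).2 ?_
  have hmem : c + sideSign F c α β (n + 1 + k) * farDist F c α β (n + 1 + k) ∈
      F^[k] '' Icc (loEnd F α β (n + 1)) (hiEnd F α β (n + 1)) := by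
    rw [h.image_Icc, ← hsp.2.2.2.2]; exact right_mem_uIcc
  obtain ⟨z, hz, hzv⟩ := hmem
  have h1 := mem_uIcc_side (c := c) hs (h.iterate_mem_uIcc hr le_rfl le_rfl
    ⟨hz.1, hz.2.trans (h.hi_lt_peak n).le⟩)
  have e : sideSign F c α β (n + 1 + k) * (F^[k] z - c) = farDist F c α β (n + 1 + k) := by
    rw [hzv]; rcases hs with hs | hs <;> rw [hs] <;> ring
  rw [e] at h1
  rcases mem_uIcc.1 h1 with h1 | h1 <;> linarith

theorem return_hi (h : WanderingSystem F a c b α β x) (hnm : IsNext F c α β n (n + 1 + k))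
    (hr : IsReturn F c α β n k) :
    sideSign F c α β (n + 1 + k) * (F^[k] (hiEnd F α β (n + 1)) - c) =
      nearDist F c α β (n + 1 + k) := by
  have hs := sideSign_eq F c α β (n + 1 + k)
  have hop := h.return_opposite hnm hr
  have hsp := h.side_spec (n + 1 + k)
  have hlt := h.lo_lt_hi (n + 1)
  refine le_antisymm ?_ (h.side_mem (h.iterate_mem_Icc (right_mem_Icc.2 hlt.le) k)).1
  have hmem : c + sideSign F c α β (n + 1 + k) * nearDist F c α β (n + 1 + k) ∈
      F^[k] '' Icc (loEnd F α β (n + 1)) (hiEnd F α β (n + 1)) := by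
    rw [h.image_Icc, ← hsp.2.2.2.2]; exact left_mem_uIcc
  obtain ⟨z, hz, hzv⟩ := hmem
  have h1 := mem_uIcc_side (c := c) hs (h.iterate_mem_uIcc hr hz.1 le_rfl
    ⟨hz.2, (h.hi_lt_peak n).le⟩)
  have e : sideSign F c α β (n + 1 + k) * (F^[k] z - c) = nearDist F c α β (n + 1 + k) := by
    rw [hzv]; rcases hs with hs | hs <;> rw [hs] <;> ring
  rw [e] at h1
  rcases mem_uIcc.1 h1 with h1 | h1 <;> linarith

theorem return_mem (h : WanderingSystem F a c b α β x) (hnm : IsNext F c α β n (n + 1 + k))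
    (hr : IsReturn F c α β n k) {y : ℝ} (hy : y ∈ Ioc (loEnd F α β (n + 1)) (F c)) :
    sideSign F c α β (n + 1 + k) * (F^[k] (F c) - c) ≤
      sideSign F c α β (n + 1 + k) * (F^[k] y - c) ∧
    sideSign F c α β (n + 1 + k) * (F^[k] y - c) < farDist F c α β (n + 1 + k) := by
  have hs := sideSign_eq F c α β (n + 1 + k)
  have hop := h.return_opposite hnm hr
  have hsp := h.side_spec (n + 1 + k)
  have hlo := h.return_lo hnm hr
  have h1 := mem_uIcc_side (c := c) hs (h.iterate_mem_uIcc hr le_rfl le_rfl (Ioc_subset_Icc_self hy))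
  rw [hlo] at h1
  have hne : sideSign F c α β (n + 1 + k) * (F^[k] y - c) ≠ farDist F c α β (n + 1 + k) := by
    rw [← hlo]
    intro he
    have he' : F^[k] y = F^[k] (loEnd F α β (n + 1)) := by
      rcases hs with hs | hs <;> rw [hs] at he <;> linarith
    exact hy.1.ne' (h.injOn_iterate ordConnected_Icc hr.1 (Ioc_subset_Icc_self hy)
      (left_mem_Icc.2 (h.lo_lt_peak n).le) he')
  rcases mem_uIcc.1 h1 with h1 | h1
  · linarith
  · exact ⟨h1.1, lt_of_le_of_ne h1.2 hne⟩

theorem return_ne (h : WanderingSystem F a c b α β x) (hnm : IsNext F c α β n (n + 1 + k))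
    (hr : IsReturn F c α β n k) : F^[k] (F c) ≠ c := by
  intro he
  have := h.return_opposite hnm hr
  rw [he] at this
  simp at this

/-- The second return of the critical orbit lies on the side of the interval. -/
theorem second_return (h : WanderingSystem F a c b α β x) (hnm : IsNext F c α β n (n + 1 + k))
    (hr : IsReturn F c α β n k) :
    0 < sideSign F c α β (n + 1 + k) * (F^[k] (F (F^[k] (F c))) - c) ∧
      sideSign F c α β (n + 1 + k) * (F^[k] (F (F^[k] (F c))) - c) < farDist F c α β (n + 1 + k) := by
  have hs := sideSign_eq F c α β (n + 1 + k)
  have hop := h.return_opposite hnm hr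
  have hsp := h.side_spec (n + 1 + k)
  have hmem := fun y hy => h.return_mem hnm hr (y := y) hy
  have hmem2 := hmem (F (F^[k] (F c))) ⟨hr.2, h.le_peak _⟩
  refine ⟨?_, hmem2.2⟩
  by_contra! hcon
  have hinjS := fun t ht => h.injOn_return hr (s := t) ht
  have hopS : -sideSign F c α β (n + 1 + k) = 1 ∨ -sideSign F c α β (n + 1 + k) = -1 := by
    rcases hs with hs | hs <;> rw [hs] <;> norm_num
  set s := sideSign F c α β (n + 1 + k) with hsdef
  set ca := F^[k] (F c) with hca
  have hside : ∀ z, z ∈ uIcc ca c ↔ s * (ca - c) ≤ s * (z - c) ∧ s * (z - c) ≤ 0 := by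
    intro z
    constructor
    · intro hz
      have := mem_uIcc_side (c := c) hs hz
      rw [sub_self, mul_zero, uIcc_of_le hop.le] at this
      exact this
    · intro hz
      refine mem_uIcc_of_side (c := c) hs ?_
      rw [sub_self, mul_zero, uIcc_of_le hop.le]
      exact hz
  have hlev : ∀ z ∈ uIcc ca c, loEnd F α β (n + 1) < F z := fun z hz =>
    h.lt_of_mem_uIcc hr.2 (h.lo_lt_peak n) hz
  -- If the second return were not on the side of the interval, the segment from the first return to
  -- `c` would be mapped injectively into itself by `F^[k + 1]`.
  have hinj : InjOn F^[k + 1] (uIcc ca c) := by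
    refine (hinjS (-s) hopS).mono fun z hz => ?_
    exact ⟨by linarith [((hside z).1 hz).2], hlev z hz⟩
  have hmaps : MapsTo F^[k + 1] (uIcc ca c) (uIcc ca c) := by
    intro z hz
    have h1 := mem_uIcc_of_injOn (h.cont_iterate (k + 1)) hinj hz
    rw [Function.iterate_succ_apply F k ca, Function.iterate_succ_apply F k c] at h1
    refine uIcc_subset_uIcc ?_ ?_ h1
    · exact (hside _).2 ⟨hmem2.1, hcon⟩
    · exact left_mem_uIcc
  set y : ℕ → ℝ := fun j => F^[n + 1 + k + j * (k + 1)] x with hy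
  have hysucc : ∀ j, F^[k + 1] (y j) = y (j + 1) := by
    intro j
    simp only [hy]
    rw [← Function.iterate_add_apply,
      show k + 1 + (n + 1 + k + j * (k + 1)) = n + 1 + k + (j + 1) * (k + 1) by ring]
  have hylev : ∀ j, loEnd F α β (n + 1) < F (y j) := by
    intro j
    induction j with
    | zero => simpa [hy] using h.lo_lt_of_mem hnm (h.mid_mem_Icc _)
    | succ j ih =>
      rw [← hysucc, Function.iterate_succ_apply]
      exact h.lo_lt_return hnm hr ⟨ih.le, h.le_peak _⟩
  -- Observed at every `(k + 1)`-st time, the orbit either enters that segment or stays on the side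
  -- `s` for ever. In the latter case the convex hull of the observed points is invariant. Both are
  -- injective returns.
  by_cases hex : ∃ j, s * (y j - c) ≤ 0
  · obtain ⟨j, hj⟩ := hex
    obtain ⟨i, rfl⟩ : ∃ i, j = i + 1 := by
      rcases j with - | i
      · have := (h.side_mem (h.mid_mem_Icc (n + 1 + k))).1
        simp only [hy, zero_mul, add_zero] at hj
        linarith [hsp.1]
      · exact ⟨i, rfl⟩
    refine h.noReturn (n + 1 + k + (i + 1) * (k + 1)) (k + 1) (uIcc ca c) (by omega) ordConnected_uIcc
      ((hside _).2 ⟨?_, hj⟩) hmaps hinj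
    change s * (ca - c) ≤ s * (y (i + 1) - c)
    rw [← hysucc, Function.iterate_succ_apply]
    exact (hmem _ ⟨hylev i, h.le_peak _⟩).1
  · push Not at hex
    have hD : ∀ i j z, y i ≤ z → z ≤ y j → 0 ≤ s * (z - c) ∧ loEnd F α β (n + 1) < F z := by
      intro i j z h1 h2
      have hz : z ∈ uIcc (y i) (y j) := Icc_subset_uIcc ⟨h1, h2⟩
      exact ⟨(le_inf (hex i).le (hex j).le).trans (mem_uIcc_side (c := c) hs hz).1,
        h.lt_of_mem_uIcc (hylev i) (hylev j) hz⟩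
    refine h.noReturn (n + 1 + k) (k + 1) {z | ∃ i j, y i ≤ z ∧ z ≤ y j} (by omega) ?_ ?_ ?_ ?_
    · refine ⟨?_⟩
      rintro z ⟨i, -, hi, -⟩ z' ⟨-, j, -, hj⟩ w hw
      exact ⟨i, j, hi.trans hw.1, hw.2.trans hj⟩
    · exact ⟨0, 0, by simp [hy], by simp [hy]⟩
    · rintro z ⟨i, j, hi, hj⟩
      have hij : y i ≤ y j := hi.trans hj
      have h1 := mem_uIcc_of_injOn (h.cont_iterate (k + 1)) (x := y i) (y := y j)
        ((hinjS s hs).mono fun w hw => by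
          rw [uIcc_of_le hij] at hw; exact hD i j w hw.1 hw.2) (Icc_subset_uIcc ⟨hi, hj⟩)
      rw [hysucc, hysucc] at h1
      rcases mem_uIcc.1 h1 with h1 | h1
      · exact ⟨_, _, h1.1, h1.2⟩
      · exact ⟨_, _, h1.1, h1.2⟩
    · refine (hinjS s hs).mono ?_
      rintro z ⟨i, j, hi, hj⟩
      exact hD i j z hi hj

theorem far_level (h : WanderingSystem F a c b α β x) {m : ℕ} {z : ℝ}
    (h0 : 0 ≤ sideSign F c α β m * (z - c))
    (h1 : sideSign F c α β m * (z - c) < farDist F c α β m) : loEnd F α β (m + 1) < F z := by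
  have hs := sideSign_eq F c α β m
  have := h.side_lt hs h0 h1
  rwa [side_add_mul hs, (h.side_spec m).2.2.2.1] at this

/-- If the critical orbit returns close enough to `c`, the next record has the same return time. -/
theorem return_next (h : WanderingSystem F a c b α β x) (hnm : IsNext F c α β n (n + 1 + k))
    (hr : IsReturn F c α β n k) (hlt : loEnd F α β (n + 1 + k + 1) < F (F^[k] (F c))) :
    IsNext F c α β (n + 1 + k) (n + 1 + k + 1 + k) ∧ IsReturn F c α β (n + 1 + k) k := by
  have hs := sideSign_eq F c α β (n + 1 + k)
  have hlo : loEnd F α β (n + 1) < loEnd F α β (n + 1 + k + 1) :=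
    (h.lo_lt_hi _).trans_le (h.hi_le_lo hnm.2.1)
  refine ⟨⟨by omega, ?_, ?_⟩, hr.1.mono le_rfl (Icc_subset_Icc hlo.le le_rfl), hlt⟩
  · have hx1 := h.mid_mem (n + 1 + k + 1)
    have hm := h.return_mem hnm hr (y := F^[n + 1 + k + 1] x)
      ⟨hlo.trans hx1.1, (hx1.2.trans (h.hi_lt_peak _)).le⟩
    have hlev : loEnd F α β (n + 1 + k + 1) < F (F^[k] (F^[n + 1 + k + 1] x)) := by
      rcases le_total 0 (sideSign F c α β (n + 1 + k) * (F^[k] (F^[n + 1 + k + 1] x) - c)) with h0 | h0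
      · exact h.far_level h0 hm.2
      · refine h.lt_of_mem_uIcc hlt (h.lo_lt_peak _) (mem_uIcc_of_side (c := c) hs ?_)
        rw [sub_self, mul_zero]
        exact Icc_subset_uIcc ⟨hm.1, h0⟩
    rw [← Function.iterate_add_apply, ← Function.iterate_succ_apply' F,
      show (k + (n + 1 + k + 1)).succ = n + 1 + k + 1 + k + 1 by omega] at hlev
    by_contra! hcon
    have := h.hi_le_lo (lt_of_le_of_ne hcon (h.inGap_ne (by omega)))
    linarith [(h.mid_mem (n + 1 + k + 1 + k + 1)).2]
  · intro j hj1 hj2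
    by_contra! hcon
    have h1 := h.hi_le_lo (lt_of_le_of_ne hcon (h.inGap_ne (by omega)))
    have hx1 := h.mid_mem (n + 1 + k + 1)
    have h2 := h.iterate_le_lo hnm hr (i := j - (n + 1 + k)) (by omega) (by omega)
      (y := F^[n + 1 + k + 1] x) ⟨(hlo.trans hx1.1).le, (hx1.2.trans (h.hi_lt_peak _)).le⟩
    rw [← Function.iterate_add_apply, show j - (n + 1 + k) + (n + 1 + k + 1) = j + 1 by omega] at h2
    linarith [(h.mid_mem (j + 1)).1, h.lo_lt_hi (n + 1 + k + 1)]

/-- The side is opposite to that of `F^[k] (F c)`, which depends only on `k`. -/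
theorem return_side_eq (h : WanderingSystem F a c b α β x) {m : ℕ}
    (hnm : IsNext F c α β n (n + 1 + k)) (hr : IsReturn F c α β n k)
    (hnm' : IsNext F c α β m (m + 1 + k)) (hr' : IsReturn F c α β m k) :
    sideSign F c α β (m + 1 + k) = sideSign F c α β (n + 1 + k) := by
  have h1 := h.return_opposite hnm hr
  have h2 := h.return_opposite hnm' hr'
  rcases sideSign_eq F c α β (n + 1 + k) with e1 | e1 <;>
    rcases sideSign_eq F c α β (m + 1 + k) with e2 | e2 <;> rw [e1] at h1 ⊢ <;> rw [e2] at h2 ⊢ <;>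
    linarith

/-- A run of records with the same return time ends. -/
theorem exists_run_end (h : WanderingSystem F a c b α β x) (hD : DistortionBound F a c b)
    (hn : IsRecord F c α β n) (hnm : IsNext F c α β n (n + 1 + k)) (hr : IsReturn F c α β n k) :
    ∃ n', n ≤ n' ∧ IsRecord F c α β n' ∧ IsNext F c α β n' (n' + 1 + k) ∧ IsReturn F c α β n' k ∧
      F (F^[k] (F c)) ≤ loEnd F α β (n' + 1 + k + 1) := by
  by_contra! hcon
  have hall : ∀ j, IsRecord F c α β (n + j * (k + 1)) ∧
      IsNext F c α β (n + j * (k + 1)) (n + j * (k + 1) + 1 + k) ∧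
      IsReturn F c α β (n + j * (k + 1)) k := by
    intro j
    induction j with
    | zero => simpa using ⟨hn, hnm, hr⟩
    | succ j ih =>
      obtain ⟨h1, h2, h3⟩ := ih
      have := h.return_next h2 h3 (hcon _ (by omega) h1 h2 h3)
      rw [show n + (j + 1) * (k + 1) = n + j * (k + 1) + 1 + k by ring]
      exact ⟨isRecord_of_isNext h1 h2, this⟩
  -- In an endless run the outer gaps tend to zero, yet they exceed the gap of the returning
  -- critical point, which is fixed throughout the run.
  have hpos : 0 < F c - F (F^[k] (F c)) := sub_pos.2 (h.lt_peak (h.return_ne hnm hr))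
  obtain ⟨N, hN⟩ := h.exists_record_outGap_lt hD hpos
  obtain ⟨h1, h2, h3⟩ := hall (N + 1)
  have h4 := hN (n + (N + 1) * (k + 1)) (by nlinarith) h1
  have h5 := h3.2
  rw [outGap] at h4
  linarith

/-- After a run has ended there is no return. -/
theorem not_isReturn_of_run_end (h : WanderingSystem F a c b α β x) {k' : ℕ}
    (hnm : IsNext F c α β n (n + 1 + k)) (hr : IsReturn F c α β n k)
    (hend : F (F^[k] (F c)) ≤ loEnd F α β (n + 1 + k + 1))
    (hnm' : IsNext F c α β (n + 1 + k) (n + 1 + k + 1 + k'))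
    (hside : sideSign F c α β (n + 1 + k + 1 + k') = sideSign F c α β (n + 1 + k)) :
    ¬ IsReturn F c α β (n + 1 + k) k' := by
  intro hr'
  have hlo : loEnd F α β (n + 1) < loEnd F α β (n + 1 + k + 1) :=
    (h.lo_lt_hi _).trans_le (h.hi_le_lo hnm.2.1)
  have hpk := h.lo_lt_peak n
  have h2 := hr'.2
  rw [← Function.iterate_succ_apply' F] at h2
  have hc : F c ∈ Icc (loEnd F α β (n + 1)) (F c) := ⟨hpk.le, le_rfl⟩
  -- The new return time `k'` is compared with the first return of the critical value at time `k`
  -- and the second at `2 * k + 1`. Other times up to `2 * k` are too low, by `iterate_le_lo`; `k' =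
  -- k` contradicts the end of the run; at `2 * k + 1` the critical orbit is on the wrong side; and
  -- for larger `k'` it would rise above the level too early.
  rcases lt_trichotomy k' k with hlt | heq | hgt
  · have := h.iterate_le_lo hnm hr (i := k' + 1) (by omega) (by omega) hc
    exact absurd h2 (not_lt.2 (this.trans hlo.le))
  · subst heq
    rw [Function.iterate_succ_apply'] at h2
    linarith
  · rcases lt_trichotomy k' (2 * k + 1) with hlt | heq | hgt
    · have := h.iterate_le_lo hnm hr (i := k' - k) (by omega) (by omega) (y := F (F^[k] (F c)))
        ⟨hr.2.le, h.le_peak _⟩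
      rw [← Function.iterate_succ_apply' F, ← Function.iterate_add_apply,
        show k' - k + k.succ = k'.succ by omega] at this
      linarith
    · have h3 := h.return_opposite hnm' hr'
      have h4 := (h.second_return hnm hr).1
      rw [hside] at h3
      rw [← Function.iterate_succ_apply' F, ← Function.iterate_add_apply,
        show k + k.succ = k' by omega] at h4
      linarith
    · have h3 := h.iterate_le_lo hnm' hr' (i := 2 * k + 2) (by omega) (by omega)
        (right_mem_Icc.2 (h.lo_lt_peak _).le)
      have h4 := h.second_return hnm hr
      have h5 := h.far_level h4.1.le h4.2
      rw [← Function.iterate_succ_apply' F k (F c), ← Function.iterate_add_apply,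
        ← Function.iterate_succ_apply' F, show (k + k.succ).succ = 2 * k + 2 by omega] at h5
      linarith

end Return

end WanderingSystem

/-! ### Power laws and the geometry of a single step -/

/-- Near `c` the map `F` behaves like a power of order `ℓ s` on the side `s = ±1`. -/
structure PowerLaw (F : ℝ → ℝ) (c : ℝ) (ℓ : ℝ → ℝ) (K η : ℝ) : Prop where
  one_le_const : 1 ≤ K
  pos : 0 < η
  le_one : η ≤ 1
  one_le : ∀ s, 1 ≤ ℓ s
  lower : ∀ s, s = 1 ∨ s = -1 → ∀ t ∈ Icc 0 η, t ^ ℓ s ≤ K * (F c - F (c + s * t))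
  upper : ∀ s, s = 1 ∨ s = -1 → ∀ t ∈ Icc 0 η, F c - F (c + s * t) ≤ K * t ^ ℓ s

theorem crossRatio_side {s c p₁ p₂ p₃ p₄ : ℝ} (hs : s = 1 ∨ s = -1) :
    crossRatio (c + s * p₁) (c + s * p₂) (c + s * p₃) (c + s * p₄) = crossRatio p₁ p₂ p₃ p₄ := by
  have key : ∀ u v, |c + s * u - (c + s * v)| = |u - v| := by
    intro u v
    rw [show c + s * u - (c + s * v) = s * (u - v) by ring, abs_mul]
    rcases hs with rfl | rfl <;> simp
  simp only [crossRatio, key]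

theorem crossRatio_eq_of_lt {w h e ξ : ℝ} (hwh : h < w) (heh : e < h) (hξ : -ξ < e) :
    crossRatio w h e (-ξ) = (h - e) * (w + ξ) / ((w - h) * (e + ξ)) := by
  rw [crossRatio, abs_of_neg (by linarith), abs_of_neg (by linarith), abs_of_neg (by linarith),
    abs_of_neg (by linarith)]
  congr 1 <;> ring

/-- Here `h` and `e` are the far and near distances of the interval and `w`, `-ξ` end the
surrounding interval. The room `2 * h ≤ w` makes `w - h` comparable to `w`, and smallness excludes
`ξ ≥ w`. The cross-ratio can then be large only if `e + ξ` is small relative to `h`. -/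
theorem add_le_of_crossRatio {w h e ξ δ M : ℝ} (he : 0 < e) (heh : e < h) (hw : 2 * h ≤ w) (hξ : 0 < ξ)
    (hM : 0 ≤ M) (hδ : 0 < δ) (hsmall : 4 * M * δ < 1)
    (hcr : 1 ≤ 2 * δ * (M * ((h - e) * (w + ξ) / ((w - h) * (e + ξ))))) : e + ξ ≤ 8 * M * δ * h := by
  have hden : 0 < (w - h) * (e + ξ) := mul_pos (by linarith) (by linarith)
  have hMδ : 0 ≤ M * δ := mul_nonneg hM hδ.le
  have h1 : (w - h) * (e + ξ) ≤ 2 * (M * δ) * ((h - e) * (w + ξ)) := by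
    rw [show 2 * δ * (M * ((h - e) * (w + ξ) / ((w - h) * (e + ξ)))) =
      2 * (M * δ) * ((h - e) * (w + ξ)) / ((w - h) * (e + ξ)) by ring, le_div_iff₀ hden, one_mul] at hcr
    exact hcr
  have h2 : w * (e + ξ) ≤ 2 * ((w - h) * (e + ξ)) := by nlinarith
  have h3 : (h - e) * (w + ξ) ≤ h * (w + ξ) := mul_le_mul_of_nonneg_right (by linarith) (by linarith)
  have h4 : w * (e + ξ) ≤ 4 * (M * δ) * (h * (w + ξ)) := by nlinarith
  rcases le_total ξ w with hle | hle
  · have h5 : h * (w + ξ) ≤ h * (2 * w) := mul_le_mul_of_nonneg_left (by linarith) (by linarith)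
    have h6 : w * (e + ξ) ≤ w * (8 * M * δ * h) := by nlinarith
    exact le_of_mul_le_mul_left h6 (by linarith)
  · exfalso
    have h5 : h * (w + ξ) ≤ w * ξ := by nlinarith
    have h6 : 0 < w * ξ := mul_pos (by linarith) hξ
    have h7 : w * (e + ξ) ≤ 4 * (M * δ) * (w * ξ) := by nlinarith
    have h8 : w * ξ ≤ w * (e + ξ) := by nlinarith
    nlinarith

/-- Applied with `-ζ` and `g` the first and second return of the critical orbit, `d` the outer gap
and `Y` the gap of the image of the first return. The cross-ratio is at most `4 * f / ζ`, and `Y ≤ K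
* ζ` cancels the unknown `ζ`. -/
theorem le_of_crossRatio_le {w f g ζ d Y M K : ℝ} (hg : 0 < g) (hgf : g < f) (hfw : 2 * f ≤ w)
    (hζ : 0 < ζ) (hζf : ζ ≤ f) (hY : 0 < Y) (hYd : 2 * Y ≤ d) (hYζ : Y ≤ K * ζ) (hM : 1 ≤ M)
    (hK : 1 ≤ K) (hcr : (d - Y) / Y ≤ M * ((f - g) * (w + ζ) / ((w - f) * (g + ζ)))) :
    d ≤ 16 * M * K * f := by
  have hf : 0 < f := by linarith
  have h6 : (f - g) * (w + ζ) / ((w - f) * (g + ζ)) ≤ 4 * f / ζ := by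
    rw [div_le_div_iff₀ (mul_pos (by linarith) (by linarith)) hζ]
    have i1 : (f - g) * (w + ζ) ≤ f * (2 * w) :=
      mul_le_mul (by linarith) (by linarith) (by linarith) hf.le
    have i2 : w * ζ ≤ 2 * ((w - f) * (g + ζ)) := by
      have : (w / 2) * ζ ≤ (w - f) * (g + ζ) :=
        mul_le_mul (by linarith) (by linarith) hζ.le (by linarith)
      linarith
    calc (f - g) * (w + ζ) * ζ ≤ f * (2 * w) * ζ := mul_le_mul_of_nonneg_right i1 hζ.le
      _ = 2 * f * (w * ζ) := by ring
      _ ≤ 2 * f * (2 * ((w - f) * (g + ζ))) := mul_le_mul_of_nonneg_left i2 (by linarith)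
      _ = _ := by ring
  have h7 : (d - Y) / Y ≤ M * (4 * f / ζ) :=
    hcr.trans (mul_le_mul_of_nonneg_left h6 (by linarith))
  rw [← mul_div_assoc, div_le_div_iff₀ hY hζ] at h7
  have h8 : d * ζ ≤ 8 * M * f * Y := by
    have : 2 * Y * ζ ≤ d * ζ := mul_le_mul_of_nonneg_right hYd hζ.le
    linarith
  have h9 : 8 * M * f * Y ≤ 8 * M * f * (K * ζ) :=
    mul_le_mul_of_nonneg_left hYζ (mul_nonneg (by linarith) hf.le)
  have h10 : d ≤ 8 * M * f * K := le_of_mul_le_mul_right (by linarith) hζ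
  have h11 : 0 ≤ M * f * K := mul_nonneg (mul_nonneg (by linarith) hf.le) (by linarith)
  linarith

theorem div_le_crossRatio {x₁ x₂ x₃ x₄ : ℝ} (h12 : x₁ < x₂) (h23 : x₂ < x₃) (h34 : x₃ < x₄) :
    (x₃ - x₂) / (x₄ - x₃) ≤ crossRatio x₁ x₂ x₃ x₄ := by
  rw [crossRatio, abs_of_pos (by linarith), abs_of_pos (by linarith), abs_of_pos (by linarith),
    abs_of_pos (by linarith), div_le_div_iff₀ (by linarith) (mul_pos (by linarith) (by linarith))]
  have h1 : 0 ≤ (x₃ - x₂) * (x₄ - x₃) := mul_nonneg (by linarith) (by linarith)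
  calc (x₃ - x₂) * ((x₂ - x₁) * (x₄ - x₃)) = (x₃ - x₂) * (x₄ - x₃) * (x₂ - x₁) := by ring
    _ ≤ (x₃ - x₂) * (x₄ - x₃) * (x₄ - x₁) := mul_le_mul_of_nonneg_left (by linarith) h1
    _ = _ := by ring

theorem UnimodalSystem.exists_small_gap {F : ℝ → ℝ} {a c b η : ℝ} (h : UnimodalSystem F a c b)
    (hη : 0 < η) : ∃ ε > 0, ∀ s, s = 1 ∨ s = -1 → ∀ t, 0 ≤ t → F c - F (c + s * t) < ε → t < η := by
  have h1 : F (c + 1 * η) < F c := h.lt_peak (by linarith)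
  have h2 : F (c + -1 * η) < F c := h.lt_peak (by linarith)
  refine ⟨min (F c - F (c + 1 * η)) (F c - F (c + -1 * η)), lt_min (by linarith) (by linarith), ?_⟩
  rintro s hs t ht hlt
  have hlt' := lt_min_iff.1 hlt
  rw [← h.side_lt_iff hs ht hη.le]
  rcases hs with rfl | rfl
  · linarith [hlt'.1]
  · linarith [hlt'.2]

namespace WanderingSystem

variable {F : ℝ → ℝ} {a c b α β x : ℝ}

theorem loEnd_add (F : ℝ → ℝ) (α β : ℝ) (i j : ℕ) :
    loEnd F α β (i + j) = min (F^[j] (loEnd F α β i)) (F^[j] (hiEnd F α β i)) := by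
  simp only [loEnd, hiEnd]
  rcases le_total (F^[i] α) (F^[i] β) with h | h
  · rw [min_eq_left h, max_eq_right h, ← Function.iterate_add_apply, ← Function.iterate_add_apply,
      add_comm j]
  · rw [min_eq_right h, max_eq_left h, ← Function.iterate_add_apply, ← Function.iterate_add_apply,
      add_comm j, min_comm]

theorem hiEnd_add (F : ℝ → ℝ) (α β : ℝ) (i j : ℕ) :
    hiEnd F α β (i + j) = max (F^[j] (loEnd F α β i)) (F^[j] (hiEnd F α β i)) := by
  simp only [loEnd, hiEnd]
  rcases le_total (F^[i] α) (F^[i] β) with h | h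
  · rw [min_eq_left h, max_eq_right h, ← Function.iterate_add_apply, ← Function.iterate_add_apply,
      add_comm j]
  · rw [min_eq_right h, max_eq_left h, ← Function.iterate_add_apply, ← Function.iterate_add_apply,
      add_comm j, max_comm]

theorem far_inGap_outGap (h : WanderingSystem F a c b α β x) (n : ℕ) :
    F c - F (c + sideSign F c α β n * nearDist F c α β n) = inGap F c α β n ∧
    F c - F (c + sideSign F c α β n * farDist F c α β n) = outGap F c α β n := by
  obtain ⟨-, -, h1, h2, -⟩ := h.side_spec n
  rw [h1, h2]
  exact ⟨rfl, rfl⟩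

section Return

variable {n k : ℕ}

/-- `koebe_return` in the coordinate `c + s * t` on the side `s` of the later interval. -/
theorem koebe_return_side (h : WanderingSystem F a c b α β x) {C : ℝ} (hC : 0 ≤ C)
    (hCR : CrossRatioBound F a c b C) (hnm : IsNext F c α β n (n + 1 + k)) {s w ξ : ℝ}
    (hs : s = 1 ∨ s = -1) (hw : 0 < w) (hξ : 0 < ξ) (hwI : c + s * w ∈ Icc a b)
    (hξI : c + s * -ξ ∈ Icc a b)
    (h₁ : F (c + s * w) = loEnd F α β (n + 1)) (h₂ : F (c + s * -ξ) = loEnd F α β (n + 1)) :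
    ∃ A B, A < loEnd F α β (n + 1) ∧ hiEnd F α β (n + 1) < B ∧
      FreeOn F c k (Icc A B) ∧ (∀ z ∈ Ioo A B, loEnd F α β (n + 1) < F (F^[k] z)) ∧
      ((F^[k] A = c + s * w ∧ F^[k] B = c + s * -ξ) ∨ (F^[k] A = c + s * -ξ ∧ F^[k] B = c + s * w)) ∧
      ∀ x₁ x₂ x₃ x₄, A ≤ x₁ → x₁ < x₂ → x₂ < x₃ → x₃ < x₄ → x₄ ≤ B →
        crossRatio x₁ x₂ x₃ x₄ ≤ Real.exp (C * (3 * (b - a))) *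
          crossRatio (F^[k] x₁) (F^[k] x₂) (F^[k] x₃) (F^[k] x₄) := by
  rcases hs with rfl | rfl
  · have e1 : c + 1 * w = c + w := by ring
    have e2 : c + 1 * -ξ = c - ξ := by ring
    rw [e1] at hwI h₁ ⊢
    rw [e2] at hξI h₂ ⊢
    obtain ⟨A, B, -, -, hA, hB, hf, hmap, hends, hK⟩ :=
      h.koebe_return hC hCR hnm hξ hw hξI.1 hwI.2 h₂ h₁
    exact ⟨A, B, hA, hB, hf, fun z hz => (h.lt_iff_mem_Ioo hξ hw h₂ h₁).2 (hmap z hz), hends.symm, hK⟩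
  · have e1 : c + -1 * w = c - w := by ring
    have e2 : c + -1 * -ξ = c + ξ := by ring
    rw [e1] at hwI h₁ ⊢
    rw [e2] at hξI h₂ ⊢
    obtain ⟨A, B, -, -, hA, hB, hf, hmap, hends, hK⟩ :=
      h.koebe_return hC hCR hnm hw hξ hwI.1 hξI.2 h₁ h₂
    exact ⟨A, B, hA, hB, hf, fun z hz => (h.lt_iff_mem_Ioo hw hξ h₁ h₂).2 (hmap z hz), hends, hK⟩

/-- An interval that is close to the critical value occupies a large cross-ratio in every interval
reaching to its left and not beyond the critical value. -/
theorem one_le_crossRatio (h : WanderingSystem F a c b α β x) {δ A B : ℝ} (hδ : 0 < δ) (hδ1 : δ ≤ 1 / 2)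
    (hn : inGap F c α β n ≤ δ * outGap F c α β n) (hA : A < loEnd F α β (n + 1))
    (hB : hiEnd F α β (n + 1) < B) (hBc : B ≤ F c) :
    1 ≤ 2 * δ * crossRatio A (loEnd F α β (n + 1)) (hiEnd F α β (n + 1)) B := by
  have hlt := h.lo_lt_hi (n + 1)
  rw [inGap, outGap] at hn
  set lo := loEnd F α β (n + 1)
  set hi := hiEnd F α β (n + 1)
  have h1 := div_le_crossRatio hA hlt hB
  have h2 : 1 ≤ 2 * δ * ((hi - lo) / (B - hi)) := by
    rw [← mul_div_assoc, le_div_iff₀ (by linarith)]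
    nlinarith
  exact h2.trans (mul_le_mul_of_nonneg_left h1 (by linarith))

/-- The image of the later interval lies inside the gap left by the earlier one, hence `f ^ ℓ ≤ K *
δ * outGap ≤ K ^ 2 * δ * w ^ ℓ`; the smallness condition absorbs `2 ^ ℓ`. -/
theorem far_le_half (h : WanderingSystem F a c b α β x) {ℓ : ℝ → ℝ} {K η ε δ s w : ℝ}
    (hpow : PowerLaw F c ℓ K η)
    (hε : ∀ s, s = 1 ∨ s = -1 → ∀ t, 0 ≤ t → F c - F (c + s * t) < ε → t < η)
    (hnε : outGap F c α β n < ε) (hn : inGap F c α β n ≤ δ * outGap F c α β n) (hδ : 0 < δ)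
    (hs : s = sideSign F c α β (n + 1 + k)) (hsmall : K ^ 2 * δ * 2 ^ ℓ s ≤ 1)
    (hnm : IsNext F c α β n (n + 1 + k)) (hw : 0 < w) (hwF : F (c + s * w) = loEnd F α β (n + 1)) :
    farDist F c α β (n + 1 + k) < η ∧ w < η ∧ 2 * farDist F c α β (n + 1 + k) ≤ w := by
  have hsgn : s = 1 ∨ s = -1 := hs ▸ sideSign_eq F c α β _
  obtain ⟨he, heh, -, -, -⟩ := h.side_spec (n + 1 + k)
  have hgap := h.far_inGap_outGap (n + 1 + k)
  rw [← hs] at hgap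
  have hmn := h.outGap_le hnm.2.1
  have hlt := h.inGap_lt_outGap n
  set f := farDist F c α β (n + 1 + k)
  have hwgap : F c - F (c + s * w) = outGap F c α β n := by rw [hwF, outGap]
  have hwη : w < η := hε s hsgn w hw.le (by rw [hwgap]; exact hnε)
  have hfη : f < η := hε s hsgn f (he.trans heh).le (by rw [hgap.2]; linarith)
  refine ⟨hfη, hwη, ?_⟩
  have hK := hpow.one_le_const
  have hℓ := hpow.one_le s
  have h1 := hpow.lower s hsgn f ⟨(he.trans heh).le, hfη.le⟩
  have h2 := hpow.upper s hsgn w ⟨hw.le, hwη.le⟩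
  rw [hgap.2] at h1
  rw [hwgap] at h2
  have h3 : f ^ ℓ s ≤ K ^ 2 * δ * w ^ ℓ s := by
    calc f ^ ℓ s ≤ K * (δ * outGap F c α β n) :=
          h1.trans (mul_le_mul_of_nonneg_left (hmn.trans hn) (by linarith))
      _ ≤ K * (δ * (K * w ^ ℓ s)) := by gcongr
      _ = _ := by ring
  have h4 : (2 * f) ^ ℓ s ≤ w ^ ℓ s := by
    rw [Real.mul_rpow (by norm_num) (he.trans heh).le]
    have h2p : (0 : ℝ) < 2 ^ ℓ s := Real.rpow_pos_of_pos (by norm_num) _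
    have hwp : 0 < w ^ ℓ s := Real.rpow_pos_of_pos hw _
    nlinarith
  by_contra! hcon
  exact absurd h4 (not_le.2 (Real.rpow_lt_rpow hw.le hcon (by linarith)))

/-- The branch of `koebe_return_side` for two consecutive records of small size. -/
theorem exists_return_frame (h : WanderingSystem F a c b α β x) {C M : ℝ} (hC : 0 ≤ C)
    (hCR : CrossRatioBound F a c b C) (hM : M = Real.exp (C * (3 * (b - a))))
    {ℓ : ℝ → ℝ} {K η ε δ s : ℝ} (hpow : PowerLaw F c ℓ K η)
    (hε : ∀ s, s = 1 ∨ s = -1 → ∀ t, 0 ≤ t → F c - F (c + s * t) < ε → t < η)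
    (hnε : outGap F c α β n < ε) (hn : inGap F c α β n ≤ δ * outGap F c α β n) (hδ : 0 < δ)
    (hs : s = sideSign F c α β (n + 1 + k)) (hsmall : K ^ 2 * δ * 2 ^ ℓ s ≤ 1)
    (hnm : IsNext F c α β n (n + 1 + k)) :
    ∃ w ξ A B, 0 < w ∧ 0 < ξ ∧ ξ < η ∧ farDist F c α β (n + 1 + k) < η ∧
      2 * farDist F c α β (n + 1 + k) ≤ w ∧ F (c + -s * ξ) = loEnd F α β (n + 1) ∧
      A < loEnd F α β (n + 1) ∧ hiEnd F α β (n + 1) < B ∧ InjOn F^[k] (uIcc A B) ∧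
      (IsReturn F c α β n k → F c < B) ∧ (¬ IsReturn F c α β n k → B ≤ F c) ∧
      ((F^[k] A = c + s * w ∧ F^[k] B = c + s * -ξ) ∨ (F^[k] A = c + s * -ξ ∧ F^[k] B = c + s * w)) ∧
      ∀ x₁ x₂ x₃ x₄, A ≤ x₁ → x₁ < x₂ → x₂ < x₃ → x₃ < x₄ → x₄ ≤ B →
        crossRatio x₁ x₂ x₃ x₄ ≤ M * crossRatio (F^[k] x₁) (F^[k] x₂) (F^[k] x₃) (F^[k] x₄) := by
  have hsgn : s = 1 ∨ s = -1 := hs ▸ sideSign_eq F c α β _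
  have hsgn' : -s = 1 ∨ -s = -1 := by rcases hsgn with rfl | rfl <;> norm_num
  have hlohi := h.lo_lt_hi (n + 1)
  have hlev : loEnd F α β (n + 1) ∈ Ico a (F c) := ⟨(h.lo_mem _).1, h.lo_lt_peak n⟩
  obtain ⟨w, hw, hwI, hwF⟩ := h.exists_level hsgn hlev
  obtain ⟨ξ, hξ, hξI, hξF⟩ := h.exists_level hsgn' hlev
  obtain ⟨hfη, hwη, hfw⟩ := h.far_le_half hpow hε hnε hn hδ hs hsmall hnm hw hwF
  have eξ : c + s * -ξ = c + -s * ξ := by ring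
  have hξη : ξ < η := hε _ hsgn' ξ hξ.le (by rw [hξF]; exact hnε)
  obtain ⟨A, B, hA, hB, hf, hmap, hends, hK'⟩ :=
    h.koebe_return_side hC hCR hnm hsgn hw hξ hwI (eξ ▸ hξI) hwF (eξ ▸ hξF)
  rw [← hM] at hK'
  refine ⟨w, ξ, A, B, hw, hξ, hξη, hfη, hfw, hξF, hA, hB, ?_, fun hr => ?_, fun hr => ?_, hends, hK'⟩
  · rw [uIcc_of_le (by linarith)]; exact h.injOn_iterate ordConnected_Icc hf
  · by_contra! hcon
    have h1 := h.lo_lt_return hnm hr (y := B) ⟨by linarith, hcon⟩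
    rcases hends with ⟨-, e⟩ | ⟨-, e⟩ <;> rw [e] at h1
    · rw [eξ, hξF] at h1; exact lt_irrefl _ h1
    · rw [hwF] at h1; exact lt_irrefl _ h1
  · by_contra! hcon
    exact hr ⟨hf.mono le_rfl (Icc_subset_Icc hA.le hcon.le),
      hmap _ ⟨by linarith [h.lo_lt_peak n], hcon⟩⟩

theorem ends_of_side (h : WanderingSystem F a c b α β x) (m : ℕ) :
    (loEnd F α β m = c + sideSign F c α β m * farDist F c α β m ∧
      hiEnd F α β m = c + sideSign F c α β m * nearDist F c α β m ∧ sideSign F c α β m = -1) ∨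
    (loEnd F α β m = c + sideSign F c α β m * nearDist F c α β m ∧
      hiEnd F α β m = c + sideSign F c α β m * farDist F c α β m ∧ sideSign F c α β m = 1) := by
  have hlt := h.lo_lt_hi m
  obtain ⟨he, heh, -, -, hHu⟩ := h.side_spec m
  rcases sideSign_eq F c α β m with hs1 | hs1
  · right
    rw [hs1, uIcc_of_le (by linarith), Icc_eq_Icc_iff (by linarith)] at hHu
    rw [hs1]; exact ⟨hHu.1.symm, hHu.2.symm, rfl⟩
  · left
    rw [hs1, uIcc_of_ge (by linarith), Icc_eq_Icc_iff (by linarith)] at hHu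
    rw [hs1]; exact ⟨hHu.1.symm, hHu.2.symm, rfl⟩

/-- Neither the side nor the orientation of the branch is known here. The order of the four image
points leaves only the consistent combinations, and the cross-ratio is the same for all of them. -/
theorem crossRatio_image_eq (h : WanderingSystem F a c b α β x) {s w ξ A B : ℝ}
    (hs : s = sideSign F c α β (n + 1 + k)) (hw : farDist F c α β (n + 1 + k) < w) (hξ : 0 < ξ)
    (hA : A < loEnd F α β (n + 1)) (hB : hiEnd F α β (n + 1) < B) (hinj : InjOn F^[k] (uIcc A B))
    (hends : (F^[k] A = c + s * w ∧ F^[k] B = c + s * -ξ) ∨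
      (F^[k] A = c + s * -ξ ∧ F^[k] B = c + s * w)) :
    crossRatio (F^[k] A) (F^[k] (loEnd F α β (n + 1))) (F^[k] (hiEnd F α β (n + 1))) (F^[k] B) =
      crossRatio w (farDist F c α β (n + 1 + k)) (nearDist F c α β (n + 1 + k)) (-ξ) := by
  have hord : InOrder A (loEnd F α β (n + 1)) (hiEnd F α β (n + 1)) B :=
    Or.inl ⟨hA, h.lo_lt_hi _, hB⟩
  have hsgn : s = 1 ∨ s = -1 := hs ▸ sideSign_eq F c α β _
  have himg := hord.image (h.cont_iterate k) hinj
  have hl := loEnd_add F α β (n + 1) k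
  have hh := hiEnd_add F α β (n + 1) k
  have hlh := h.ends_of_side (n + 1 + k)
  obtain ⟨he, heh, -, -, -⟩ := h.side_spec (n + 1 + k)
  rw [← hs] at hlh
  set f := farDist F c α β (n + 1 + k)
  set e := nearDist F c α β (n + 1 + k)
  rcases himg with ⟨i1, i2, i3⟩ | ⟨i1, i2, i3⟩
  · rw [min_eq_left i2.le] at hl
    rw [max_eq_right i2.le] at hh
    rw [← hl] at i1
    rw [← hl, ← hh]
    rcases hlh with ⟨e1, e2, e3⟩ | ⟨e1, e2, e3⟩
    · rcases hends with ⟨e4, e5⟩ | ⟨e4, e5⟩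
      · rw [e1, e2, e4, e5, crossRatio_side hsgn]
      · rw [e1, e4, e3] at i1; linarith
    · rcases hends with ⟨e4, e5⟩ | ⟨e4, e5⟩
      · rw [e1, e4, e3] at i1; linarith
      · rw [e1, e2, e4, e5, crossRatio_side hsgn, crossRatio_reverse]
  · rw [min_eq_right i2.le] at hl
    rw [max_eq_left i2.le] at hh
    rw [← hh] at i3
    rw [← hl, ← hh]
    rcases hlh with ⟨e1, e2, e3⟩ | ⟨e1, e2, e3⟩
    · rcases hends with ⟨e4, e5⟩ | ⟨e4, e5⟩
      · rw [e2, e4, e3] at i3; linarith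
      · rw [e1, e2, e4, e5, crossRatio_side hsgn, crossRatio_reverse]
    · rcases hends with ⟨e4, e5⟩ | ⟨e4, e5⟩
      · rw [e1, e2, e4, e5, crossRatio_side hsgn]
      · rw [e2, e4, e3] at i3; linarith

/-- If the critical orbit does not return along two consecutive records, the later interval is small
and far away compared with its distance to `c`, on a very asymmetric level set. -/
theorem bounds_of_not_isReturn (h : WanderingSystem F a c b α β x) {C M : ℝ} (hC : 0 ≤ C)
    (hCR : CrossRatioBound F a c b C) (hM : M = Real.exp (C * (3 * (b - a))))
    {ℓ : ℝ → ℝ} {K η ε δ s : ℝ} (hpow : PowerLaw F c ℓ K η)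
    (hε : ∀ s, s = 1 ∨ s = -1 → ∀ t, 0 ≤ t → F c - F (c + s * t) < ε → t < η)
    (hnε : outGap F c α β n < ε) (hn : inGap F c α β n ≤ δ * outGap F c α β n) (hδ : 0 < δ)
    (hs : s = sideSign F c α β (n + 1 + k))
    (hsmall : K ^ 2 * δ * 2 ^ ℓ s ≤ 1) (hδ1 : δ ≤ 1 / 2) (hsmall' : 4 * M * δ < 1)
    (hnm : IsNext F c α β n (n + 1 + k)) (hr : ¬ IsReturn F c α β n k) :
    farDist F c α β (n + 1 + k) < η ∧
    nearDist F c α β (n + 1 + k) ≤ 8 * M * δ * farDist F c α β (n + 1 + k) ∧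
    ∃ ξ, 0 < ξ ∧ ξ < η ∧ F (c + -s * ξ) = loEnd F α β (n + 1) ∧
      ξ ≤ 8 * M * δ * farDist F c α β (n + 1 + k) := by
  obtain ⟨w, ξ, A, B, hw, hξ, hξη, hfη, hfw, hξF, hA, hB, hinj, -, hBc, hends, hK'⟩ :=
    h.exists_return_frame hC hCR hM hpow hε hnε hn hδ hs hsmall hnm
  obtain ⟨he, heh, -, -, -⟩ := h.side_spec (n + 1 + k)
  have hM0 : 0 ≤ M := hM ▸ (Real.exp_pos _).le
  have h1 := h.one_le_crossRatio hδ hδ1 hn hA hB (hBc hr)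
  have h2 := hK' _ _ _ _ le_rfl hA (h.lo_lt_hi _) hB le_rfl
  rw [h.crossRatio_image_eq hs (by linarith) hξ hA hB hinj hends,
    crossRatio_eq_of_lt (by linarith) heh (by linarith)] at h2
  have h3 := add_le_of_crossRatio he heh hfw hξ hM0 hδ hsmall'
    (h1.trans (mul_le_mul_of_nonneg_left h2 (by linarith)))
  exact ⟨hfη, by linarith, ξ, hξ, hξη, hξF, by linarith⟩

/-- If the critical orbit returns along two consecutive records, it returns close to `c` compared with
the size of the later interval, which is large compared with the image of the earlier one. -/
theorem bounds_of_isReturn (h : WanderingSystem F a c b α β x) {C M : ℝ} (hC : 0 ≤ C)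
    (hCR : CrossRatioBound F a c b C) (hM : M = Real.exp (C * (3 * (b - a))))
    {ℓ : ℝ → ℝ} {K η ε δ s : ℝ} (hpow : PowerLaw F c ℓ K η)
    (hε : ∀ s, s = 1 ∨ s = -1 → ∀ t, 0 ≤ t → F c - F (c + s * t) < ε → t < η)
    (hnε : outGap F c α β n < ε) (hn : inGap F c α β n ≤ δ * outGap F c α β n) (hδ : 0 < δ)
    (hs : s = sideSign F c α β (n + 1 + k))
    (hsmall : K ^ 2 * δ * 2 ^ ℓ s ≤ 1) (hδ1 : δ ≤ 1 / 2) (hsmall' : 8 * M * δ < 1)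
    (hnm : IsNext F c α β n (n + 1 + k)) (hr : IsReturn F c α β n k) :
    farDist F c α β (n + 1 + k) < η ∧
    nearDist F c α β (n + 1 + k) ≤ 8 * M * δ * farDist F c α β (n + 1 + k) ∧
    -(s * (F^[k] (F c) - c)) ≤ 8 * M * δ * farDist F c α β (n + 1 + k) ∧
    outGap F c α β n ≤ 16 * M * K * farDist F c α β (n + 1 + k) := by
  obtain ⟨w, ξ, A, B, hw, hξ, hξη, hfη, hfw, hξF, hA, hB, hinj, hBc, -, hends, hK'⟩ :=
    h.exists_return_frame hC hCR hM hpow hε hnε hn hδ hs hsmall hnm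
  replace hBc := hBc hr
  have hlohi := h.lo_lt_hi (n + 1)
  have hhip := h.hi_lt_peak n
  obtain ⟨he, heh, -, -, -⟩ := h.side_spec (n + 1 + k)
  have hM1 : 1 ≤ M := by
    rw [hM]
    have := h.lt_left.trans h.lt_right
    exact Real.one_le_exp (mul_nonneg hC (by linarith))
  have hK := hpow.one_le_const
  have hop := h.return_opposite hnm hr
  have hlo := h.return_lo hnm hr
  have hhi := h.return_hi hnm hr
  have hsec := h.second_return hnm hr
  have hsgn : s = 1 ∨ s = -1 := hs ▸ sideSign_eq F c α β _
  have hsgn' : -s = 1 ∨ -s = -1 := by rcases hsgn with rfl | rfl <;> norm_num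
  rw [← hs] at hop hlo hhi hsec
  obtain ⟨ζ, hζ⟩ : ∃ ζ, ζ = -(s * (F^[k] (F c) - c)) := ⟨_, rfl⟩
  obtain ⟨g, hg⟩ : ∃ g, g = s * (F^[k] (F (F^[k] (F c))) - c) := ⟨_, rfl⟩
  rw [← hζ]
  have hζ0 : 0 < ζ := by linarith
  have hca : F^[k] (F c) = c + s * -ζ := by rw [hζ, neg_neg, side_add_mul hsgn]
  have hc2a : F^[k] (F (F^[k] (F c))) = c + s * g := by rw [hg, side_add_mul hsgn]
  rw [← hg] at hsec
  set f := farDist F c α β (n + 1 + k)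
  set e := nearDist F c α β (n + 1 + k)
  have hlo' : F^[k] (loEnd F α β (n + 1)) = c + s * f := by rw [← hlo, side_add_mul hsgn]
  have hhi' : F^[k] (hiEnd F α β (n + 1)) = c + s * e := by rw [← hhi, side_add_mul hsgn]
  have hAw : F^[k] A = c + s * w := by
    rcases hends with ⟨h1, -⟩ | ⟨h1, -⟩
    · exact h1
    · have hord : InOrder A (loEnd F α β (n + 1)) (hiEnd F α β (n + 1)) B := Or.inl ⟨hA, hlohi, hB⟩
      have himg := hord.image (h.cont_iterate k) hinj
      rw [h1, hlo', hhi'] at himg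
      rcases hsgn with hs1 | hs1 <;> rw [hs1] at himg <;>
        exfalso <;> rcases himg with ⟨i1, i2, i3⟩ | ⟨i1, i2, i3⟩ <;> linarith
  have h1 := h.one_le_crossRatio hδ hδ1 hn hA hhip le_rfl
  have h2 := hK' _ _ _ _ le_rfl hA hlohi hhip hBc.le
  rw [hAw, hlo', hhi', hca, crossRatio_side hsgn, crossRatio_eq_of_lt (by linarith) heh
    (by linarith)] at h2
  have h3 := add_le_of_crossRatio he heh hfw hζ0 (by linarith) hδ (by nlinarith)
    (h1.trans (mul_le_mul_of_nonneg_left h2 (by linarith)))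
  refine ⟨hfη, by linarith, by linarith, ?_⟩
  have hf0 : 0 < f := by linarith
  have hζf : ζ ≤ f := by
    have := mul_le_mul_of_nonneg_right hsmall'.le hf0.le
    linarith
  have hY := hpow.upper (-s) hsgn' ζ ⟨hζ0.le, by linarith⟩
  have hζ1 : ζ ^ ℓ (-s) ≤ ζ := by
    have := Real.rpow_le_rpow_of_exponent_ge hζ0 (by linarith [hpow.le_one]) (hpow.one_le (-s))
    rwa [Real.rpow_one] at this
  have eca : c + -s * ζ = F^[k] (F c) := by rw [hca]; ring
  rw [eca] at hY
  -- The same branch with another third point: the image of the first return, which the branch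
  -- carries to the second return.
  have h4 := hK' A (loEnd F α β (n + 1)) (F (F^[k] (F c))) (F c) le_rfl hA hr.2
    (h.lt_peak (h.return_ne hnm hr)) hBc.le
  rw [hc2a, hAw, hlo'] at h4
  have hYpos : F (F^[k] (F c)) < F c := h.lt_peak (h.return_ne hnm hr)
  have hr2 := hr.2
  generalize F (F^[k] (F c)) = Y' at *
  rw [hca, crossRatio_side hsgn] at h4
  obtain ⟨d, hd⟩ : ∃ d, d = outGap F c α β n := ⟨_, rfl⟩
  rw [← hd]
  obtain ⟨Y, hYdef⟩ : ∃ Y, Y = F c - Y' := ⟨_, rfl⟩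
  rw [← hYdef] at hY
  have hYζ : Y ≤ K * ζ := hY.trans (mul_le_mul_of_nonneg_left hζ1 (by linarith))
  have hKf : 0 < K * f := mul_pos (by linarith) hf0
  have hMKf : K * f ≤ M * (K * f) := le_mul_of_one_le_left hKf.le hM1
  rw [outGap] at hd
  -- If `d` is comparable to `Y`, then `Y ≤ K * ζ ≤ K * f` suffices; otherwise the cross-ratio is
  -- bounded below by `(d - Y) / Y`.
  rcases le_total d (2 * Y) with hcase | hcase
  · have : K * ζ ≤ K * f := mul_le_mul_of_nonneg_left hζf (by linarith)
    linarith
  · have hY0 : 0 < Y := by linarith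
    have h5 := div_le_crossRatio hA hr2 hYpos
    rw [show Y' - loEnd F α β (n + 1) = d - Y by linarith, ← hYdef] at h5
    rw [crossRatio_eq_of_lt (by linarith) hsec.2 (by linarith)] at h4
    exact le_of_crossRatio_le hsec.1 hsec.2 hfw hζ0 hζf hY0 hcase hYζ hM1 hK (h5.trans h4)

end Return

end WanderingSystem

/-- If the order on the side `-s` were at least that on `s`, then `ξ ^ ℓ (-s) ≤ X * f ^ ℓ s`, all
bases being at most 1; the two power laws would give `f ^ ℓ s ≤ K ^ 2 * X * f ^ ℓ s`, against `K ^ 2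
* X < 1`. -/
theorem PowerLaw.order_lt {F : ℝ → ℝ} {c : ℝ} {ℓ : ℝ → ℝ} {K η : ℝ} (hpow : PowerLaw F c ℓ K η)
    {s f ξ X : ℝ} (hs : s = 1 ∨ s = -1) (hf : 0 < f) (hfη : f < η) (hξ : 0 < ξ) (hξη : ξ < η)
    (hX : 0 < X) (hX1 : K ^ 2 * X < 1) (hξf : ξ ≤ X * f)
    (hlev : F c - F (c + s * f) ≤ F c - F (c + -s * ξ)) : ℓ (-s) < ℓ s := by
  have hs' : -s = 1 ∨ -s = -1 := by rcases hs with rfl | rfl <;> norm_num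
  have hK := hpow.one_le_const
  by_contra! hcon
  have h1 := hpow.lower s hs f ⟨hf.le, hfη.le⟩
  have h2 := hpow.upper (-s) hs' ξ ⟨hξ.le, hξη.le⟩
  have hp := hpow.one_le (-s)
  have hX2 : X ≤ 1 := by nlinarith
  have h3 : ξ ^ ℓ (-s) ≤ X * f ^ ℓ s := by
    calc ξ ^ ℓ (-s) ≤ (X * f) ^ ℓ (-s) := Real.rpow_le_rpow hξ.le hξf (by linarith)
      _ = X ^ ℓ (-s) * f ^ ℓ (-s) := Real.mul_rpow hX.le hf.le
      _ ≤ X * f ^ ℓ s := by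
        refine mul_le_mul ?_ ?_ (Real.rpow_pos_of_pos hf _).le hX.le
        · have := Real.rpow_le_rpow_of_exponent_ge hX hX2 hp
          rwa [Real.rpow_one] at this
        · exact Real.rpow_le_rpow_of_exponent_ge hf (hfη.le.trans hpow.le_one) hcon
  have hfp := Real.rpow_pos_of_pos hf (ℓ s)
  have h4 : f ^ ℓ s ≤ K ^ 2 * X * f ^ ℓ s := by
    calc f ^ ℓ s ≤ K * (K * (X * f ^ ℓ s)) := by
          refine h1.trans (mul_le_mul_of_nonneg_left (hlev.trans (h2.trans ?_)) (by linarith))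
          exact mul_le_mul_of_nonneg_left h3 (by linarith)
      _ = _ := by ring
  nlinarith

/-! ### Comparison of growth rates along the records -/

namespace WanderingSystem

variable {F : ℝ → ℝ} {a c b α β x : ℝ}

/-- The relative distance of the image of the `n`-th interval to the critical value. -/
noncomputable def gapRatio (F : ℝ → ℝ) (c α β : ℝ) (n : ℕ) : ℝ := inGap F c α β n / outGap F c α β n

theorem outGap_pos (h : WanderingSystem F a c b α β x) (n : ℕ) : 0 < outGap F c α β n :=
  (h.inGap_pos n).trans (h.inGap_lt_outGap n)

theorem gapRatio_pos (h : WanderingSystem F a c b α β x) (n : ℕ) : 0 < gapRatio F c α β n :=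
  div_pos (h.inGap_pos n) (h.outGap_pos n)

/-- The power law turns a ratio `X` of distances into a ratio of order `X ^ ℓ` of gaps, which is the
source of the superexponential decay of the gap ratio when `ℓ > 1`. -/
theorem gapRatio_le_of_near (h : WanderingSystem F a c b α β x) {ℓ : ℝ → ℝ} {K η X s : ℝ}
    (hpow : PowerLaw F c ℓ K η) {m : ℕ} (hs : s = sideSign F c α β m) (hf : farDist F c α β m < η)
    (hX : 0 < X) (hnear : nearDist F c α β m ≤ X * farDist F c α β m) :
    gapRatio F c α β m ≤ K ^ 2 * X ^ ℓ s := by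
  have hsgn : s = 1 ∨ s = -1 := hs ▸ sideSign_eq F c α β _
  obtain ⟨he, heh, -, -, -⟩ := h.side_spec m
  have hg := h.far_inGap_outGap m
  rw [← hs] at hg
  have hf0 := he.trans heh
  have hK := hpow.one_le_const
  have h1 := hpow.upper s hsgn _ ⟨he.le, (heh.trans hf).le⟩
  have h2 := hpow.lower s hsgn _ ⟨hf0.le, hf.le⟩
  rw [hg.1] at h1
  rw [hg.2] at h2
  rw [gapRatio, div_le_iff₀ (h.outGap_pos m)]
  have hXp := Real.rpow_pos_of_pos hX (ℓ s)
  calc inGap F c α β m ≤ K * nearDist F c α β m ^ ℓ s := h1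
    _ ≤ K * (X * farDist F c α β m) ^ ℓ s := by
      refine mul_le_mul_of_nonneg_left (Real.rpow_le_rpow he.le hnear ?_) (by linarith)
      linarith [hpow.one_le s]
    _ = K * (X ^ ℓ s * farDist F c α β m ^ ℓ s) := by rw [Real.mul_rpow hX.le hf0.le]
    _ ≤ K * (X ^ ℓ s * (K * outGap F c α β m)) := by gcongr
    _ = _ := by ring

theorem far_rpow_le (h : WanderingSystem F a c b α β x) {ℓ : ℝ → ℝ} {K η : ℝ}
    (hpow : PowerLaw F c ℓ K η) {m : ℕ} (hf : farDist F c α β m < η) :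
    farDist F c α β m ^ ℓ (sideSign F c α β m) ≤ K * outGap F c α β m := by
  obtain ⟨he, heh, -, -, -⟩ := h.side_spec m
  have h2 := hpow.lower _ (sideSign_eq F c α β m) _ ⟨(he.trans heh).le, hf.le⟩
  rwa [(h.far_inGap_outGap m).2] at h2

/-- What happens between two consecutive late records. -/
theorem step_bounds (h : WanderingSystem F a c b α β x) {C M : ℝ} (hC : 0 ≤ C)
    (hCR : CrossRatioBound F a c b C) (hM : M = Real.exp (C * (3 * (b - a))))
    {ℓ : ℝ → ℝ} {K η ε s : ℝ} (hpow : PowerLaw F c ℓ K η)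
    (hε : ∀ s, s = 1 ∨ s = -1 → ∀ t, 0 ≤ t → F c - F (c + s * t) < ε → t < η) {n k : ℕ}
    (hnε : outGap F c α β n < ε) (hs : s = sideSign F c α β (n + 1 + k))
    (hsmall : 8 * M * K ^ 2 * 2 ^ ℓ s * gapRatio F c α β n < 1)
    (hnm : IsNext F c α β n (n + 1 + k)) :
    gapRatio F c α β (n + 1 + k) ≤ K ^ 2 * (8 * M * gapRatio F c α β n) ^ ℓ s ∧
    outGap F c α β n ≤ 16 * M * K * farDist F c α β (n + 1 + k) ∧
    (¬ IsReturn F c α β n k →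
      outGap F c α β n ≤ 16 * M * K * (gapRatio F c α β n * farDist F c α β (n + 1 + k)) ∧
      ℓ (-s) < ℓ s) ∧
    (IsReturn F c α β n k → F (F^[k] (F c)) ≤ loEnd F α β (n + 1 + k + 1) → ℓ (-s) < ℓ s) := by
  have hsgn : s = 1 ∨ s = -1 := hs ▸ sideSign_eq F c α β _
  have hsgn' : -s = 1 ∨ -s = -1 := by rcases hsgn with rfl | rfl <;> norm_num
  have hδ := h.gapRatio_pos n
  have hn : inGap F c α β n ≤ gapRatio F c α β n * outGap F c α β n := by
    rw [gapRatio, div_mul_cancel₀ _ (h.outGap_pos n).ne']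
  obtain ⟨he, heh, -, -, -⟩ := h.side_spec (n + 1 + k)
  have hgap := h.far_inGap_outGap (n + 1 + k)
  rw [← hs] at hgap
  have hmn := h.outGap_le hnm.2.1
  have hin := h.inGap_lt_outGap n
  set δ := gapRatio F c α β n
  set f := farDist F c α β (n + 1 + k)
  have hf : 0 < f := he.trans heh
  have hK := hpow.one_le_const
  have hM1 : 1 ≤ M := by
    rw [hM]
    have := h.lt_left.trans h.lt_right
    exact Real.one_le_exp (mul_nonneg hC (by linarith))
  have h2p : (1 : ℝ) ≤ 2 ^ ℓ s := Real.one_le_rpow (by norm_num) (by linarith [hpow.one_le s])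
  have hK2 : 1 ≤ K ^ 2 := one_le_pow₀ hK
  have hP : 1 ≤ K ^ 2 * 2 ^ ℓ s := one_le_mul_of_one_le_of_one_le hK2 h2p
  have hMδ : 0 < M * δ := mul_pos (by linarith) hδ
  have hPδ : 0 < K ^ 2 * 2 ^ ℓ s * δ := mul_pos (by linarith) hδ
  have hKδ : 0 < K ^ 2 * (M * δ) := mul_pos (by linarith) hMδ
  -- All smallness conditions needed in the two cases follow from `hsmall`, because `M`, `K` and `2
  -- ^ ℓ s` are at least 1.
  have c1 : 8 * M * δ < 1 := by
    have := mul_le_mul_of_nonneg_right hP hMδ.le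
    linarith
  have c2 : K ^ 2 * δ * 2 ^ ℓ s ≤ 1 := by
    have := mul_le_mul_of_nonneg_right hM1 hPδ.le
    linarith
  have c3 : K ^ 2 * (8 * M * δ) < 1 := by
    have := mul_le_mul_of_nonneg_right h2p hKδ.le
    linarith
  have c4 : δ ≤ 1 / 2 := by
    have := mul_le_mul_of_nonneg_right hM1 hδ.le
    linarith
  have c5 : 4 * M * δ < 1 := by linarith
  have hX : 0 < 8 * M * δ := by linarith
  have hη := hpow.le_one
  by_cases hr : IsReturn F c α β n k
  · obtain ⟨hfη, hnear, hζ, hd⟩ := h.bounds_of_isReturn hC hCR hM hpow hε hnε hn hδ hs c2 c4 c1 hnm hr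
    refine ⟨h.gapRatio_le_of_near hpow hs hfη hX hnear, hd, fun hr' => absurd hr hr', fun _ hend => ?_⟩
    have hop := h.return_opposite hnm hr
    rw [← hs] at hop
    have e : c + -s * -(s * (F^[k] (F c) - c)) = F^[k] (F c) := by
      rcases hsgn with hs1 | hs1 <;> rw [hs1] <;> ring
    refine hpow.order_lt hsgn hf hfη (ξ := -(s * (F^[k] (F c) - c))) (by linarith) ?_ hX c3 hζ ?_
    · have := mul_le_mul_of_nonneg_right c1.le hf.le
      linarith
    · rw [e, hgap.2, outGap]
      linarith
  · obtain ⟨hfη, hnear, ξ, hξ, hξη, hξF, hξf⟩ :=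
      h.bounds_of_not_isReturn hC hCR hM hpow hε hnε hn hδ hs c2 c4 c5 hnm hr
    have hgξ : F c - F (c + -s * ξ) = outGap F c α β n := by rw [hξF, outGap]
    have hY := hpow.upper (-s) hsgn' ξ ⟨hξ.le, hξη.le⟩
    rw [hgξ] at hY
    have hξ1 : ξ ^ ℓ (-s) ≤ ξ := by
      have := Real.rpow_le_rpow_of_exponent_ge hξ (by linarith) (hpow.one_le (-s))
      rwa [Real.rpow_one] at this
    have hd : outGap F c α β n ≤ K * (8 * M * δ * f) :=
      hY.trans (mul_le_mul_of_nonneg_left (hξ1.trans hξf) (by linarith))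
    have hpos : 0 < K * (M * (δ * f)) := by positivity
    have hd' : outGap F c α β n ≤ 16 * M * K * (δ * f) := by linarith
    refine ⟨h.gapRatio_le_of_near hpow hs hfη hX hnear, hd'.trans ?_, fun _ => ⟨hd', ?_⟩,
      fun hr' => absurd hr' hr⟩
    · have : δ * f ≤ 1 * f := mul_le_mul_of_nonneg_right (by linarith) hf.le
      have hMK : 0 < 16 * M * K := by positivity
      nlinarith
    · refine hpow.order_lt hsgn hf hfη hξ hξη hX c3 hξf ?_
      rw [hgξ, hgap.2]
      linarith

/-- A comparison of growth rates along the records that cannot hold for ever. -/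
theorem false_of_growth (h : WanderingSystem F a c b α β x) (hD : DistortionBound F a c b) {N : ℕ}
    {U V : ℕ → ℝ} {L : ℝ} (hL : 0 < L)
    (hU : ∀ n > N, IsRecord F c α β n → 0 < U n) (hV : ∀ n > N, IsRecord F c α β n → 0 < V n)
    (hstep : ∀ n m, n > N → IsRecord F c α β n → IsNext F c α β n m → U m ≤ L * U n ∧ L * V n ≤ V m)
    (hstrict : ∀ n > N, IsRecord F c α β n → ∃ n' m', n ≤ n' ∧ IsRecord F c α β n' ∧
      IsNext F c α β n' m' ∧ U m' ≤ L * U n' - V n') : False := by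
  obtain ⟨n₀, hn₀, hr₀⟩ := h.exists_record_gt hD N
  set T := U n₀ / V n₀ with hT
  have key : ∀ j : ℕ, ∃ n > N, IsRecord F c α β n ∧ U n ≤ (T - j / L) * V n := by
    intro j
    induction j with
    | zero => exact ⟨n₀, hn₀, hr₀, by simp [hT, div_mul_cancel₀ _ (hV n₀ hn₀ hr₀).ne']⟩
    | succ j ih =>
      obtain ⟨n, hn, hr, hUV⟩ := ih
      obtain ⟨n', m', hnn', hr', hnm', hstr⟩ := hstrict n hn hr
      have hprop := h.record_induction hr (Q := fun m => U m ≤ (T - j / L) * V m) hUV ?_ n' hnn' hr'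
      · have hm' := isRecord_of_isNext hr' hnm'
        have hlt := hnm'.1
        have hVn := hV n' (by omega) hr'
        have hUm := hU m' (by omega) hm'
        have hVm := (hstep n' m' (by omega) hr' hnm').2
        refine ⟨m', by omega, hm', ?_⟩
        have e : U m' ≤ (T - (j + 1 : ℕ) / L) * (L * V n') := by
          have e1 : (T - (j + 1 : ℕ) / L) * (L * V n') = L * ((T - j / L) * V n') - V n' := by
            push_cast
            field_simp
            ring
          rw [e1]
          have := mul_le_mul_of_nonneg_left hprop hL.le
          linarith
        have hpos : 0 < T - (j + 1 : ℕ) / L := by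
          by_contra! hcon
          have := mul_nonpos_of_nonpos_of_nonneg hcon (mul_pos hL hVn).le
          linarith
        exact e.trans (mul_le_mul_of_nonneg_left hVm hpos.le)
      · intro p q hp hrp hpq hQ
        have h1 := hstep p q (by omega) hrp hpq
        have hVp := hV p (by omega) hrp
        have hUp := hU p (by omega) hrp
        have hpos : 0 < T - j / L := by
          by_contra! hcon
          have := mul_nonpos_of_nonpos_of_nonneg hcon hVp.le
          linarith
        calc U q ≤ L * U p := h1.1
          _ ≤ L * ((T - j / L) * V p) := mul_le_mul_of_nonneg_left hQ hL.le
          _ = (T - j / L) * (L * V p) := by ring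
          _ ≤ _ := mul_le_mul_of_nonneg_left h1.2 hpos.le
  obtain ⟨j, hj⟩ := exists_nat_gt (T * L)
  obtain ⟨n, hn, hr, hUV⟩ := key j
  have : T - j / L < 0 := by
    rw [sub_neg, lt_div_iff₀ hL]; exact hj
  have := mul_neg_of_neg_of_pos this (hV n hn hr)
  linarith [hU n hn hr]

/-- A wandering system with bounded cross-ratio distortion and power-law behaviour at the turning
point does not exist. -/
theorem false_of_bounds (h : WanderingSystem F a c b α β x) {C : ℝ} (hC : 0 ≤ C)
    (hCR : CrossRatioBound F a c b C) (hD : DistortionBound F a c b)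
    {ℓ : ℝ → ℝ} {K η : ℝ} (hpow : PowerLaw F c ℓ K η) : False := by
  obtain ⟨M, hM⟩ : ∃ M, M = Real.exp (C * (3 * (b - a))) := ⟨_, rfl⟩
  have hM1 : 1 ≤ M := by
    rw [hM]
    have := h.lt_left.trans h.lt_right
    exact Real.one_le_exp (mul_nonneg hC (by linarith))
  have hK := hpow.one_le_const
  obtain ⟨ε, hε0, hε⟩ := h.exists_small_gap hpow.pos
  -- smallness of the ratio
  have hratio : ∀ δ > 0, ∃ N, ∀ n > N, IsRecord F c α β n → gapRatio F c α β n < δ := by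
    intro δ hδ
    obtain ⟨N, hN⟩ := h.exists_inGap_le hC hCR hD (δ := δ) hδ
    refine ⟨N, fun n hn hr => ?_⟩
    have h1 := hN n hn hr
    have h2 := mul_pos hδ (h.inGap_pos n)
    rw [gapRatio, div_lt_iff₀ (h.outGap_pos n)]
    linarith
  obtain ⟨N₁, hN₁⟩ := h.exists_record_outGap_lt hD hε0
  -- `E` serves both sides of `c` at once, since the side of the next record is not yet known.
  set E := 8 * M * K ^ 2 * (2 ^ ℓ 1 + 2 ^ ℓ (-1)) with hE
  have hE0 : 0 < E := by positivity
  obtain ⟨N₂, hN₂⟩ := hratio (1 / E) (by positivity)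
  have hstep := fun n k (hn : n > max N₁ N₂) (hr : IsRecord F c α β n)
      (hnm : IsNext F c α β n (n + 1 + k)) =>
    h.step_bounds hC hCR hM hpow hε (s := sideSign F c α β (n + 1 + k))
      (hN₁ n ((le_max_left _ _).trans_lt hn) hr) rfl (by
        have h1 := hN₂ n ((le_max_right _ _).trans_lt hn) hr
        rw [lt_div_iff₀ hE0] at h1
        refine lt_of_le_of_lt ?_ h1
        rw [mul_comm]
        refine mul_le_mul_of_nonneg_left ?_ (h.gapRatio_pos n).le
        refine mul_le_mul_of_nonneg_left ?_ (by positivity)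
        have p1 : (0 : ℝ) < 2 ^ ℓ 1 := Real.rpow_pos_of_pos (by norm_num) _
        have p2 : (0 : ℝ) < 2 ^ ℓ (-1) := Real.rpow_pos_of_pos (by norm_num) _
        rcases sideSign_eq F c α β (n + 1 + k) with e | e <;> rw [e] <;> linarith) hnm
  have hsplit : ∀ n m, IsNext F c α β n m → ∃ k, m = n + 1 + k := fun n m hnm =>
    ⟨m - (n + 1), by have := hnm.1; omega⟩
  have hflat : ∀ n m, n > max N₁ N₂ → IsRecord F c α β n → IsNext F c α β n m →
      ℓ (-sideSign F c α β m) < ℓ (sideSign F c α β m) := by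
    intro n m hn hr hnm
    obtain ⟨k, rfl⟩ := hsplit n m hnm
    -- After a return the orders are compared at the end of the run; the side of the next record is
    -- the same throughout the run.
    by_cases hret : IsReturn F c α β n k
    · obtain ⟨n', hn', hr', hnm', hret', hend⟩ := h.exists_run_end hD hr hnm hret
      have := (hstep n' k (by omega) hr' hnm').2.2.2 hret' hend
      rwa [h.return_side_eq hnm hret hnm' hret'] at this
    · exact ((hstep n k hn hr hnm).2.2.1 hret).2
  obtain ⟨n₁, hn₁, hr₁⟩ := h.exists_record_gt hD (max N₁ N₂)
  have hflat' : ∀ m > n₁, IsRecord F c α β m →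
      ℓ (-sideSign F c α β m) < ℓ (sideSign F c α β m) := by
    intro m hm hr
    obtain ⟨p, hp, hpm⟩ := h.exists_prev hr (by omega)
    refine hflat p m ?_ hp hpm
    by_contra! hcon
    exact lt_asymm (hr₁ p (by omega)) (hpm.2.2 n₁ (by omega) hm)
  obtain ⟨n₂, hn₂, hr₂⟩ := h.exists_record_gt hD n₁
  obtain ⟨s, hs⟩ : ∃ s, s = sideSign F c α β n₂ := ⟨_, rfl⟩
  have hside : ∀ m > n₁, IsRecord F c α β m → sideSign F c α β m = s := by
    intro m hm hr
    have h1 := hflat' m hm hr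
    have h2 := hflat' n₂ hn₂ hr₂
    rw [hs]
    rcases sideSign_eq F c α β m with e1 | e1 <;> rcases sideSign_eq F c α β n₂ with e2 | e2 <;>
      rw [e1] at h1 ⊢ <;> rw [e2] at h2 ⊢ <;> norm_num at h1 h2 ⊢ <;> linarith
  have hL1 : 1 < ℓ s := by
    have := hflat' n₂ hn₂ hr₂
    rw [← hs] at this
    linarith [hpow.one_le (-s)]
  obtain ⟨L, hL⟩ : ∃ L, L = ℓ s := ⟨_, rfl⟩
  rw [← hL] at hL1
  obtain ⟨D, hDdef⟩ : ∃ D, D = K * (16 * M * K) := ⟨_, rfl⟩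
  obtain ⟨G, hG⟩ : ∃ G, G = K ^ 2 * (8 * M) ^ L := ⟨_, rfl⟩
  have hD1 : 1 ≤ D := by nlinarith
  have hD0 : 0 < D := by linarith
  have hG1 : 1 ≤ G := by
    rw [hG]
    exact one_le_mul_of_one_le_of_one_le (one_le_pow₀ hK)
      (Real.one_le_rpow (by linarith) (by linarith))
  have hG0 : 0 < G := by linarith
  -- The shifts solve `A * L - A = log D` and `B * L - B = log G`, so they absorb the constants and
  -- the logarithmic estimates become `U m ≤ L * U n` and `L * V n ≤ V m`. The threshold `exp (-B)`
  -- then makes `V` positive.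
  set A := Real.log D / (L - 1) with hA
  set B := Real.log G / (L - 1) with hB
  have hA0 : 0 ≤ A := div_nonneg (Real.log_nonneg hD1) (by linarith)
  have hB0 : 0 ≤ B := div_nonneg (Real.log_nonneg hG1) (by linarith)
  have hA1 : A * L - A = Real.log D := by
    rw [← mul_sub_one, hA, div_mul_cancel₀ _ (by linarith)]
  have hB1 : B * L - B = Real.log G := by
    rw [← mul_sub_one, hB, div_mul_cancel₀ _ (by linarith)]
  obtain ⟨N₃, hN₃⟩ := hratio (Real.exp (-B)) (Real.exp_pos _)
  have hfar0 : ∀ n, 0 < farDist F c α β n := fun n => (h.side_spec n).1.trans (h.side_spec n).2.1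
  have hfarη : ∀ n > n₁, IsRecord F c α β n → farDist F c α β n < η := by
    intro n hn hr
    refine hε _ (sideSign_eq F c α β n) _ (hfar0 n).le ?_
    rw [(h.far_inGap_outGap n).2]
    exact hN₁ n (by have := le_max_left N₁ N₂; omega) hr
  have hlate : ∀ n, n > max n₁ N₃ → n > n₁ ∧ n > N₃ ∧ n > max N₁ N₂ := fun n hn =>
    ⟨(le_max_left _ _).trans_lt hn, (le_max_right _ _).trans_lt hn, by omega⟩
  have hlogfar : ∀ n > n₁, IsRecord F c α β n → ∀ X > 0, outGap F c α β n ≤ 16 * M * K * X →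
      L * Real.log (farDist F c α β n) ≤ Real.log D + Real.log X := by
    intro n hn hr X hX hle
    have h1 := h.far_rpow_le hpow (hfarη n hn hr)
    rw [hside n hn hr, ← hL] at h1
    rw [← Real.log_rpow (hfar0 n), ← Real.log_mul hD0.ne' hX.ne']
    refine Real.log_le_log (Real.rpow_pos_of_pos (hfar0 n) _) (h1.trans ?_)
    rw [hDdef, mul_assoc]
    exact mul_le_mul_of_nonneg_left hle (by linarith)
  refine h.false_of_growth hD (N := max n₁ N₃) (L := L)
    (U := fun n => -Real.log (farDist F c α β n) + A)
    (V := fun n => -Real.log (gapRatio F c α β n) - B) (by linarith) ?_ ?_ ?_ ?_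
  · intro n hn hr
    have := Real.log_neg (hfar0 n) ((hfarη n (hlate n hn).1 hr).trans_le hpow.le_one)
    linarith
  · intro n hn hr
    have := Real.log_lt_log (h.gapRatio_pos n) (hN₃ n (hlate n hn).2.1 hr)
    rw [Real.log_exp] at this
    linarith
  · intro n m hn hr hnm
    obtain ⟨k, rfl⟩ := hsplit n m hnm
    obtain ⟨l1, l2, l3⟩ := hlate n hn
    obtain ⟨s1, s2, -, -⟩ := hstep n k l3 hr hnm
    have hsm := hside _ (by omega) (isRecord_of_isNext hr hnm)
    rw [hsm, ← hL] at s1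
    constructor
    · have := hlogfar n l1 hr _ (hfar0 _) s2
      linarith
    · have h8 : (8 * M * gapRatio F c α β n) ^ L = (8 * M) ^ L * gapRatio F c α β n ^ L :=
        Real.mul_rpow (by linarith) (h.gapRatio_pos n).le
      rw [h8, ← mul_assoc, ← hG] at s1
      have h9 := Real.log_le_log (h.gapRatio_pos _) s1
      rw [Real.log_mul hG0.ne' (Real.rpow_pos_of_pos (h.gapRatio_pos n) _).ne',
        Real.log_rpow (h.gapRatio_pos n)] at h9
      linarith
  · intro n hn hr
    have hstr : ∀ n k, n > max n₁ N₃ → IsRecord F c α β n → IsNext F c α β n (n + 1 + k) →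
        ¬ IsReturn F c α β n k → -Real.log (farDist F c α β (n + 1 + k)) + A ≤
          L * (-Real.log (farDist F c α β n) + A) - (-Real.log (gapRatio F c α β n) - B) := by
      intro n k hn hr hnm hret
      obtain ⟨l1, l2, l3⟩ := hlate n hn
      obtain ⟨-, -, s3, -⟩ := hstep n k l3 hr hnm
      have := hlogfar n l1 hr _ (mul_pos (h.gapRatio_pos n) (hfar0 _)) (s3 hret).1
      rw [Real.log_mul (h.gapRatio_pos n).ne' (hfar0 _).ne'] at this
      linarith
    obtain ⟨m, hnm⟩ := h.exists_isNext hD n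
    obtain ⟨k, rfl⟩ := hsplit n m hnm
    by_cases hret : IsReturn F c α β n k
    · obtain ⟨n', hn', hr', hnm', hret', hend⟩ := h.exists_run_end hD hr hnm hret
      have hrm := isRecord_of_isNext hr' hnm'
      obtain ⟨m', hm'⟩ := h.exists_isNext hD (n' + 1 + k)
      obtain ⟨k', rfl⟩ := hsplit _ _ hm'
      have hl := (hlate n hn).1
      -- The step that follows the end of a run is not a return, hence it is a strict one.
      refine ⟨n' + 1 + k, _, by omega, hrm, hm', hstr _ k' (by omega) hrm hm' ?_⟩
      refine h.not_isReturn_of_run_end hnm' hret' hend hm' ?_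
      rw [hside _ (by omega) hrm, hside _ (by omega) (isRecord_of_isNext hrm hm')]
    · exact ⟨n, _, le_rfl, hr, hnm, hstr n k hn hr hnm hret⟩

end WanderingSystem

/-! ### Distortion of maps whose derivative has a Lipschitz logarithm -/

/-- On `[u, v]` the function `g` is continuous, and inside it has a nonzero derivative whose logarithm
is Lipschitz. -/
structure LogDerivLip (g : ℝ → ℝ) (u v C : ℝ) : Prop where
  lt : u < v
  nonneg : 0 ≤ C
  cont : ContinuousOn g (Icc u v)
  deriv_ne : ∀ x ∈ Ioo u v, deriv g x ≠ 0
  lip : ∀ x ∈ Ioo u v, ∀ y ∈ Ioo u v, Real.log |deriv g x| - Real.log |deriv g y| ≤ C * |x - y|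

namespace LogDerivLip

variable {g : ℝ → ℝ} {u v C : ℝ}

theorem slope (h : LogDerivLip g u v C) {x y : ℝ} (hx : u ≤ x) (hxy : x < y) (hy : y ≤ v) :
    ∃ ξ ∈ Ioo x y, ξ ∈ Ioo u v ∧ |g y - g x| = |deriv g ξ| * (y - x) := by
  obtain ⟨ξ, hξ, he⟩ := exists_deriv_eq_slope g hxy (h.cont.mono (Icc_subset_Icc hx hy)) fun z hz =>
    (differentiableAt_of_deriv_ne_zero (h.deriv_ne z ⟨hx.trans_lt hz.1, hz.2.trans_le hy⟩)).differentiableWithinAt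
  refine ⟨ξ, hξ, ⟨hx.trans_lt hξ.1, hξ.2.trans_le hy⟩, ?_⟩
  rw [he, abs_div, abs_of_pos (sub_pos.2 hxy), div_mul_cancel₀ _ (sub_pos.2 hxy).ne']

theorem deriv_le (h : LogDerivLip g u v C) {x y L : ℝ} (hx : x ∈ Ioo u v) (hy : y ∈ Ioo u v)
    (hL : |x - y| ≤ L) : |deriv g x| ≤ Real.exp (C * L) * |deriv g y| := by
  have h1 := h.lip x hx y hy
  have h2 : Real.log |deriv g x| ≤ C * L + Real.log |deriv g y| := by
    have := mul_le_mul_of_nonneg_left hL h.nonneg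
    linarith
  rw [Real.log_le_iff_le_exp (abs_pos.2 (h.deriv_ne x hx)), Real.exp_add,
    Real.exp_log (abs_pos.2 (h.deriv_ne y hy))] at h2
  exact h2

/-- The slopes of `g` over two subintervals are comparable. -/
theorem slope_le (h : LogDerivLip g u v C) {l r x y z w : ℝ} (hl : u ≤ l) (hr : r ≤ v) (hx : l ≤ x)
    (hxy : x < y) (hy : y ≤ r) (hz : l ≤ z) (hzw : z < w) (hw : w ≤ r) :
    |g y - g x| * (w - z) ≤ Real.exp (C * (r - l)) * (|g w - g z| * (y - x)) := by
  obtain ⟨ξ, hξ, hξI, e1⟩ := h.slope (hl.trans hx) hxy (hy.trans hr)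
  obtain ⟨ζ, hζ, hζI, e2⟩ := h.slope (hl.trans hz) hzw (hw.trans hr)
  have h1 := h.deriv_le hξI hζI (L := r - l) (by
    rw [abs_le]; constructor <;> linarith [hξ.1, hξ.2, hζ.1, hζ.2])
  rw [e1, e2]
  have h2 : 0 ≤ (y - x) * (w - z) := mul_nonneg (by linarith) (by linarith)
  calc |deriv g ξ| * (y - x) * (w - z) = |deriv g ξ| * ((y - x) * (w - z)) := by ring
    _ ≤ Real.exp (C * (r - l)) * |deriv g ζ| * ((y - x) * (w - z)) := mul_le_mul_of_nonneg_right h1 h2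
    _ = _ := by ring

theorem image_ne (h : LogDerivLip g u v C) {x y : ℝ} (hx : u ≤ x) (hxy : x < y) (hy : y ≤ v) :
    0 < |g y - g x| := by
  obtain ⟨ξ, hξ, hξI, e1⟩ := h.slope hx hxy hy
  rw [e1]
  exact mul_pos (abs_pos.2 (h.deriv_ne ξ hξI)) (by linarith)

/-- The quotient of the two cross-ratios is a product of two quotients of slopes, each costing one
factor `exp (C * (x₄ - x₁))`; hence the `2`. -/
theorem crossRatio_le (h : LogDerivLip g u v C) {x₁ x₂ x₃ x₄ : ℝ} (h1 : u ≤ x₁) (h12 : x₁ < x₂)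
    (h23 : x₂ < x₃) (h34 : x₃ < x₄) (h4 : x₄ ≤ v) :
    crossRatio x₁ x₂ x₃ x₄ ≤
      Real.exp (2 * C * (x₄ - x₁)) * crossRatio (g x₁) (g x₂) (g x₃) (g x₄) := by
  have p1 := h.slope_le h1 h4 (x := x₁) (y := x₂) (z := x₂) (w := x₃) le_rfl h12 (by linarith) h12.le
    h23 h34.le
  have p2 := h.slope_le h1 h4 (x := x₃) (y := x₄) (z := x₁) (w := x₄) (by linarith) h34 le_rfl le_rfl
    (by linarith) le_rfl
  have q1 := h.image_ne h1 h12 (by linarith)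
  have q2 := h.image_ne (x := x₃) (by linarith) h34 h4
  rw [crossRatio, crossRatio, abs_of_pos (by linarith), abs_of_pos (by linarith),
    abs_of_pos (by linarith), abs_of_pos (by linarith), mul_div_assoc', div_le_div_iff₀
    (mul_pos (by linarith) (by linarith)) (mul_pos q1 q2)]
  have e : Real.exp (2 * C * (x₄ - x₁)) = Real.exp (C * (x₄ - x₁)) * Real.exp (C * (x₄ - x₁)) := by
    rw [← Real.exp_add]; congr 1; ring
  rw [e]
  calc (x₃ - x₂) * (x₄ - x₁) * (|g x₂ - g x₁| * |g x₄ - g x₃|)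
      = (|g x₂ - g x₁| * (x₃ - x₂)) * (|g x₄ - g x₃| * (x₄ - x₁)) := by ring
    _ ≤ (Real.exp (C * (x₄ - x₁)) * (|g x₃ - g x₂| * (x₂ - x₁))) *
        (Real.exp (C * (x₄ - x₁)) * (|g x₄ - g x₁| * (x₄ - x₃))) := by
      refine mul_le_mul p1 p2 (mul_nonneg (abs_nonneg _) (by linarith))
        (mul_nonneg (Real.exp_pos _).le (mul_nonneg (abs_nonneg _) (by linarith)))
    _ = _ := by ring

theorem crossRatio_ge (h : LogDerivLip g u v C) {x₁ x₂ x₃ x₄ : ℝ} (h1 : u ≤ x₁) (h12 : x₁ < x₂)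
    (h23 : x₂ < x₃) (h34 : x₃ < x₄) (h4 : x₄ ≤ v) :
    crossRatio (g x₁) (g x₂) (g x₃) (g x₄) ≤
      Real.exp (2 * C * (x₄ - x₁)) * crossRatio x₁ x₂ x₃ x₄ := by
  have p1 := h.slope_le h1 h4 (x := x₂) (y := x₃) (z := x₁) (w := x₂) h12.le h23 h34.le le_rfl h12
    (by linarith)
  have p2 := h.slope_le h1 h4 (x := x₁) (y := x₄) (z := x₃) (w := x₄) le_rfl (by linarith) le_rfl
    (by linarith) h34 le_rfl
  have q1 := h.image_ne h1 h12 (by linarith)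
  have q2 := h.image_ne (x := x₃) (by linarith) h34 h4
  rw [crossRatio, crossRatio, abs_of_pos (by linarith : 0 < x₃ - x₂),
    abs_of_pos (by linarith : 0 < x₄ - x₁), abs_of_pos (by linarith : 0 < x₂ - x₁),
    abs_of_pos (by linarith : 0 < x₄ - x₃), mul_div_assoc', div_le_div_iff₀ (mul_pos q1 q2)
    (mul_pos (by linarith) (by linarith))]
  have e : Real.exp (2 * C * (x₄ - x₁)) = Real.exp (C * (x₄ - x₁)) * Real.exp (C * (x₄ - x₁)) := by
    rw [← Real.exp_add]; congr 1; ring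
  rw [e]
  calc |g x₃ - g x₂| * |g x₄ - g x₁| * ((x₂ - x₁) * (x₄ - x₃))
      = (|g x₃ - g x₂| * (x₂ - x₁)) * (|g x₄ - g x₁| * (x₄ - x₃)) := by ring
    _ ≤ (Real.exp (C * (x₄ - x₁)) * (|g x₂ - g x₁| * (x₃ - x₂))) *
        (Real.exp (C * (x₄ - x₁)) * (|g x₄ - g x₃| * (x₄ - x₁))) := by
      refine mul_le_mul p1 p2 (mul_nonneg (abs_nonneg _) (by linarith))
        (mul_nonneg (Real.exp_pos _).le (mul_nonneg (abs_nonneg _) (by linarith)))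
    _ = _ := by ring

theorem bilipschitz (h : LogDerivLip g u v C) :
    ∃ m M, 0 < m ∧ 0 < M ∧ ∀ x ∈ Icc u v, ∀ y ∈ Icc u v,
      m * |y - x| ≤ |g y - g x| ∧ |g y - g x| ≤ M * |y - x| := by
  have hw : (u + v) / 2 ∈ Ioo u v := ⟨by linarith [h.lt], by linarith [h.lt]⟩
  set w := (u + v) / 2
  have hd := abs_pos.2 (h.deriv_ne w hw)
  have hE := Real.exp_pos (C * (v - u))
  refine ⟨|deriv g w| / Real.exp (C * (v - u)), Real.exp (C * (v - u)) * |deriv g w|,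
    div_pos hd hE, mul_pos hE hd, ?_⟩
  have key : ∀ x ∈ Icc u v, ∀ y ∈ Icc u v, x < y →
      |deriv g w| / Real.exp (C * (v - u)) * |y - x| ≤ |g y - g x| ∧
      |g y - g x| ≤ Real.exp (C * (v - u)) * |deriv g w| * |y - x| := by
    intro x hx y hy hxy
    obtain ⟨ξ, hξ, hξI, e1⟩ := h.slope hx.1 hxy hy.2
    have hpos : 0 < y - x := by linarith
    rw [e1, abs_of_pos hpos]
    refine ⟨mul_le_mul_of_nonneg_right ?_ hpos.le, mul_le_mul_of_nonneg_right ?_ hpos.le⟩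
    · rw [div_le_iff₀ hE, mul_comm]
      exact h.deriv_le hw hξI (by rw [abs_le]; constructor <;> linarith [hw.1, hw.2, hξI.1, hξI.2])
    · exact h.deriv_le hξI hw (by rw [abs_le]; constructor <;> linarith [hw.1, hw.2, hξI.1, hξI.2])
  intro x hx y hy
  rcases lt_trichotomy x y with hxy | rfl | hxy
  · exact key x hx y hy hxy
  · simp
  · have := key y hy x hx hxy
    rwa [abs_sub_comm x y, abs_sub_comm (g x)] at this

theorem congr (h : LogDerivLip g u v C) {k : ℝ → ℝ} (hk : EqOn k g (Icc u v)) :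
    LogDerivLip k u v C := by
  have hd : ∀ x ∈ Ioo u v, deriv k x = deriv g x := fun x hx =>
    Filter.EventuallyEq.deriv_eq (Filter.mem_of_superset (Icc_mem_nhds hx.1 hx.2) hk)
  exact ⟨h.lt, h.nonneg, h.cont.congr hk, fun x hx => by rw [hd x hx]; exact h.deriv_ne x hx,
    fun x hx y hy => by rw [hd x hx, hd y hy]; exact h.lip x hx y hy⟩

/-- Two functions that are Lipschitz on intervals with a common point. -/
theorem _root_.sub_le_of_glue {L : ℝ → ℝ} {S T : Set ℝ} {w C₁ C₂ : ℝ} (hw : w ∈ S ∩ T)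
    (hS : ∀ x ∈ S, ∀ y ∈ S, L x - L y ≤ C₁ * |x - y|) (hT : ∀ x ∈ T, ∀ y ∈ T, L x - L y ≤ C₂ * |x - y|)
    (h1 : 0 ≤ C₁) (h2 : 0 ≤ C₂) (hlt : ∀ x ∈ S ∪ T, (x ≤ w → x ∈ S) ∧ (w ≤ x → x ∈ T)) :
    ∀ x ∈ S ∪ T, ∀ y ∈ S ∪ T, L x - L y ≤ (C₁ + C₂) * |x - y| := by
  intro x hx y hy
  have n1 := mul_nonneg h1 (abs_nonneg (x - y))
  have n2 := mul_nonneg h2 (abs_nonneg (x - y))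
  rcases le_total x w with hxw | hxw <;> rcases le_total y w with hyw | hyw
  · linarith [hS x ((hlt x hx).1 hxw) y ((hlt y hy).1 hyw)]
  · have e1 := hS x ((hlt x hx).1 hxw) w hw.1
    have e2 := hT w hw.2 y ((hlt y hy).2 hyw)
    have a1 : |x - w| ≤ |x - y| := by
      rw [abs_of_nonpos (by linarith), abs_of_nonpos (by linarith)]; linarith
    have a2 : |w - y| ≤ |x - y| := by
      rw [abs_of_nonpos (by linarith), abs_of_nonpos (by linarith)]; linarith
    linarith [mul_le_mul_of_nonneg_left a1 h1, mul_le_mul_of_nonneg_left a2 h2]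
  · have e1 := hT x ((hlt x hx).2 hxw) w hw.2
    have e2 := hS w hw.1 y ((hlt y hy).1 hyw)
    have a1 : |x - w| ≤ |x - y| := by
      rw [abs_of_nonneg (by linarith), abs_of_nonneg (by linarith)]; linarith
    have a2 : |w - y| ≤ |x - y| := by
      rw [abs_of_nonneg (by linarith), abs_of_nonneg (by linarith)]; linarith
    linarith [mul_le_mul_of_nonneg_left a1 h2, mul_le_mul_of_nonneg_left a2 h1]
  · linarith [hT x ((hlt x hx).2 hxw) y ((hlt y hy).2 hyw)]

theorem glue {u' v' C' : ℝ} (h : LogDerivLip g u v C) (h' : LogDerivLip g u' v' C') (huu : u ≤ u')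
    (huv : u' < v) (hvv : v ≤ v') : LogDerivLip g u v' (C + C') := by
  have hun : Ioo u v ∪ Ioo u' v' = Ioo u v' := by
    ext z
    simp only [mem_union, mem_Ioo]
    constructor
    · rintro (hz | hz) <;> constructor <;> linarith [hz.1, hz.2]
    · rintro ⟨h1, h2⟩
      rcases lt_or_ge z v with hz | hz
      · exact Or.inl ⟨h1, hz⟩
      · exact Or.inr ⟨huv.trans_le hz, h2⟩
  refine ⟨h.lt.trans_le hvv, add_nonneg h.nonneg h'.nonneg, ?_, ?_, ?_⟩
  · intro z hz
    rcases lt_or_ge z v with hzv | hzv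
    · exact (h.cont z ⟨hz.1, hzv.le⟩).mono_of_mem_nhdsWithin
        (mem_nhdsWithin.2 ⟨Iio v, isOpen_Iio, hzv, fun w hw => ⟨hw.2.1, (mem_Iio.1 hw.1).le⟩⟩)
    · exact (h'.cont z ⟨huv.le.trans hzv, hz.2⟩).mono_of_mem_nhdsWithin
        (mem_nhdsWithin.2 ⟨Ioi u', isOpen_Ioi, huv.trans_le hzv,
          fun w hw => ⟨(mem_Ioi.1 hw.1).le, hw.2.2⟩⟩)
  · intro z hz
    rw [← hun] at hz
    exact hz.elim (h.deriv_ne z) (h'.deriv_ne z)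
  · have := sub_le_of_glue (L := fun x => Real.log |deriv g x|) (S := Ioo u v) (T := Ioo u' v')
      (w := (u' + v) / 2) ⟨⟨by linarith, by linarith⟩, ⟨by linarith, by linarith⟩⟩
      h.lip h'.lip h.nonneg h'.nonneg (by
        rw [hun]
        exact fun x hx => ⟨fun h1 => ⟨hx.1, by linarith⟩, fun h1 => ⟨by linarith, hx.2⟩⟩)
    rwa [hun] at this

/-- By the chain rule the logarithms of the derivatives add up, and the inner map is Lipschitz. -/
theorem comp {k : ℝ → ℝ} {p q C' : ℝ} (hk : LogDerivLip k p q C') (h : LogDerivLip g u v C)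
    (hI : MapsTo g (Icc u v) (Icc p q)) (hO : MapsTo g (Ioo u v) (Ioo p q)) :
    ∃ C'', LogDerivLip (fun x => k (g x)) u v C'' := by
  obtain ⟨m, M, hm, hM, hb⟩ := h.bilipschitz
  have hd : ∀ x ∈ Ioo u v, deriv (fun x => k (g x)) x = deriv k (g x) * deriv g x := fun x hx =>
    deriv_comp x (differentiableAt_of_deriv_ne_zero (hk.deriv_ne _ (hO hx)))
      (differentiableAt_of_deriv_ne_zero (h.deriv_ne _ hx))
  refine ⟨C' * M + C, h.lt, add_nonneg (mul_nonneg hk.nonneg hM.le) h.nonneg,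
    hk.cont.comp h.cont hI, ?_, ?_⟩
  · intro x hx
    rw [hd x hx]
    exact mul_ne_zero (hk.deriv_ne _ (hO hx)) (h.deriv_ne _ hx)
  · intro x hx y hy
    rw [hd x hx, hd y hy, abs_mul, abs_mul, Real.log_mul (abs_pos.2 (hk.deriv_ne _ (hO hx))).ne'
      (abs_pos.2 (h.deriv_ne _ hx)).ne', Real.log_mul (abs_pos.2 (hk.deriv_ne _ (hO hy))).ne'
      (abs_pos.2 (h.deriv_ne _ hy)).ne']
    have e1 := hk.lip _ (hO hx) _ (hO hy)
    have e2 := h.lip x hx y hy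
    have e3 := mul_le_mul_of_nonneg_left (hb y (Ioo_subset_Icc_self hy) x (Ioo_subset_Icc_self hx)).2
      hk.nonneg
    linarith

/-- A criterion in terms of a function that extends the derivative to the closed interval. -/
theorem of_hasDerivAt {D : ℝ → ℝ} (huv : u < v) (hC : 0 ≤ C) (hc : ContinuousOn g (Icc u v))
    (hD : ∀ x ∈ Ioo u v, HasDerivAt g (D x) x) (h0 : ∀ x ∈ Ioo u v, D x ≠ 0)
    (hl : ∀ x ∈ Ioo u v, ∀ y ∈ Ioo u v, Real.log |D x| - Real.log |D y| ≤ C * |x - y|) :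
    LogDerivLip g u v C where
  lt := huv
  nonneg := hC
  cont := hc
  deriv_ne := fun x hx => by rw [(hD x hx).deriv]; exact h0 x hx
  lip := fun x hx y hy => by rw [(hD x hx).deriv, (hD y hy).deriv]; exact hl x hx y hy

theorem _root_.log_abs_lipschitz {D : ℝ → ℝ} (hD : ContDiffOn ℝ 1 D (Icc u v))
    (h0 : ∀ x ∈ Icc u v, D x ≠ 0) :
    ∃ C, 0 ≤ C ∧ ∀ x ∈ Icc u v, ∀ y ∈ Icc u v, Real.log |D x| - Real.log |D y| ≤ C * |x - y| := by
  have h1 : ContDiffOn ℝ 1 (fun x => Real.log (D x)) (Icc u v) := hD.log h0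
  obtain ⟨K, hK⟩ := h1.exists_lipschitzOnWith one_ne_zero (convex_Icc u v) isCompact_Icc
  refine ⟨K, K.2, fun x hx y hy => ?_⟩
  have := hK.dist_le_mul x hx y hy
  rw [Real.dist_eq, Real.dist_eq] at this
  rw [Real.log_abs, Real.log_abs]
  exact (le_abs_self _).trans this

theorem of_contDiffOn (huv : u < v) (hg : ContDiffOn ℝ 2 g (Icc u v))
    (h0 : ∀ x ∈ Icc u v, derivWithin g (Icc u v) x ≠ 0) : ∃ C, LogDerivLip g u v C := by
  have hU := uniqueDiffOn_Icc huv
  have hD : ContDiffOn ℝ 1 (derivWithin g (Icc u v)) (Icc u v) := hg.derivWithin hU (by norm_num)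
  obtain ⟨C, hC, hl⟩ := log_abs_lipschitz hD h0
  refine ⟨C, of_hasDerivAt huv hC hg.continuousOn (D := derivWithin g (Icc u v)) (fun x hx => ?_)
    (fun x hx => h0 x (Ioo_subset_Icc_self hx))
    fun x hx y hy => hl x (Ioo_subset_Icc_self hx) y (Ioo_subset_Icc_self hy)⟩
  exact ((hg.differentiableOn (by norm_num)) x (Ioo_subset_Icc_self hx)).hasDerivWithinAt.hasDerivAt
    (Icc_mem_nhds hx.1 hx.2)

theorem of_contDiff (huv : u < v) (hg : ContDiff ℝ 2 g) (h0 : ∀ x, deriv g x ≠ 0) :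
    ∃ C, LogDerivLip g u v C := by
  refine of_contDiffOn huv hg.contDiffOn fun x hx => ?_
  rw [(differentiableAt_of_deriv_ne_zero (h0 x)).derivWithin (uniqueDiffOn_Icc huv x hx)]
  exact h0 x

end LogDerivLip

/-! ### Power maps expand cross-ratios -/

/-- This is the numerator of the derivative of `sinh (ℓ * t) / sinh t`. It vanishes at 0 and has
derivative `(ℓ ^ 2 - 1) * sinh (ℓ * t) * sinh t ≥ 0`. -/
theorem mul_cosh_sub_nonneg {ℓ t : ℝ} (hℓ : 1 ≤ ℓ) (ht : 0 ≤ t) :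
    0 ≤ ℓ * Real.cosh (ℓ * t) * Real.sinh t - Real.sinh (ℓ * t) * Real.cosh t := by
  have hd : ∀ t, HasDerivAt
      (fun t => ℓ * Real.cosh (ℓ * t) * Real.sinh t - Real.sinh (ℓ * t) * Real.cosh t)
      ((ℓ ^ 2 - 1) * (Real.sinh (ℓ * t) * Real.sinh t)) t := by
    intro t
    have hl : HasDerivAt (fun t => ℓ * t) ℓ t := by simpa using (hasDerivAt_id t).const_mul ℓ
    have h1 := ((Real.hasDerivAt_cosh (ℓ * t)).comp t hl).const_mul ℓ
    have h2 := (Real.hasDerivAt_sinh (ℓ * t)).comp t hl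
    refine ((h1.mul (Real.hasDerivAt_sinh t)).sub (h2.mul (Real.hasDerivAt_cosh t))).congr_deriv ?_
    simp only [Function.comp_apply]
    ring
  have hmono : MonotoneOn
      (fun t => ℓ * Real.cosh (ℓ * t) * Real.sinh t - Real.sinh (ℓ * t) * Real.cosh t) (Ici 0) := by
    refine monotoneOn_of_deriv_nonneg (convex_Ici 0) (fun t _ => (hd t).continuousAt.continuousWithinAt)
      (fun t _ => (hd t).differentiableAt.differentiableWithinAt) fun t ht => ?_
    rw [interior_Ici, mem_Ioi] at ht
    rw [(hd t).deriv]
    refine mul_nonneg (by nlinarith) (mul_nonneg ?_ (Real.sinh_nonneg_iff.2 ht.le))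
    exact Real.sinh_nonneg_iff.2 (mul_nonneg (by linarith) ht.le)
  have := hmono (mem_Ici.2 le_rfl) (mem_Ici.2 ht) ht
  simpa using this

theorem sinh_mul_div_le {ℓ s t : ℝ} (hℓ : 1 ≤ ℓ) (hs : 0 < s) (hst : s ≤ t) :
    Real.sinh t / Real.sinh s ≤ Real.sinh (ℓ * t) / Real.sinh (ℓ * s) := by
  have hmono : MonotoneOn (fun t => Real.sinh (ℓ * t) / Real.sinh t) (Ioi 0) := by
    have hd : ∀ t ∈ Ioi (0 : ℝ), HasDerivAt (fun t => Real.sinh (ℓ * t) / Real.sinh t)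
        ((ℓ * Real.cosh (ℓ * t) * Real.sinh t - Real.sinh (ℓ * t) * Real.cosh t) / Real.sinh t ^ 2)
        t := by
      intro t ht
      have hl : HasDerivAt (fun t => ℓ * t) ℓ t := by simpa using (hasDerivAt_id t).const_mul ℓ
      have h2 := (Real.hasDerivAt_sinh (ℓ * t)).comp t hl
      refine (h2.div (Real.hasDerivAt_sinh t) (Real.sinh_pos_iff.2 ht).ne').congr_deriv ?_
      simp only [Function.comp_apply]
      ring
    refine monotoneOn_of_deriv_nonneg (convex_Ioi 0)
      (fun t ht => (hd t ht).continuousAt.continuousWithinAt) ?_ ?_ <;> rw [interior_Ioi]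
    · exact fun t ht => (hd t ht).differentiableAt.differentiableWithinAt
    · intro t ht
      rw [(hd t ht).deriv]
      exact div_nonneg (mul_cosh_sub_nonneg hℓ (le_of_lt ht)) (sq_nonneg _)
  have h1 := hmono hs (hs.trans_le hst) hst
  have hs1 := Real.sinh_pos_iff.2 hs
  have ht1 := Real.sinh_pos_iff.2 (hs.trans_le hst)
  have hs2 := Real.sinh_pos_iff.2 (mul_pos (by linarith : 0 < ℓ) hs)
  simp only at h1
  rw [div_le_div_iff₀ hs1 ht1] at h1
  rw [div_le_div_iff₀ hs1 hs2]
  linarith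

theorem crossRatio_add_one {x₁ x₂ x₃ x₄ : ℝ} (h12 : x₁ < x₂) (h23 : x₂ < x₃) (h34 : x₃ < x₄) :
    crossRatio x₁ x₂ x₃ x₄ + 1 = (x₃ - x₁) / (x₂ - x₁) * ((x₄ - x₂) / (x₄ - x₃)) := by
  have h1 : x₂ - x₁ ≠ 0 := by linarith
  have h2 : x₄ - x₃ ≠ 0 := by linarith
  rw [crossRatio, abs_of_pos (by linarith), abs_of_pos (by linarith), abs_of_pos (by linarith),
    abs_of_pos (by linarith)]
  field_simp
  ring

/-- The substitution `x = exp (2 * t)` turns `x ^ ℓ` into the linear map `t ↦ ℓ * t`. Differences of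
exponentials become hyperbolic sines, whose exponential prefactors cancel in the product. -/
theorem crossRatio_exp_add_one {t₁ t₂ t₃ t₄ : ℝ} (h12 : t₁ < t₂) (h23 : t₂ < t₃) (h34 : t₃ < t₄) :
    crossRatio (Real.exp (2 * t₁)) (Real.exp (2 * t₂)) (Real.exp (2 * t₃)) (Real.exp (2 * t₄)) + 1 =
      Real.sinh (t₃ - t₁) / Real.sinh (t₂ - t₁) * (Real.sinh (t₄ - t₂) / Real.sinh (t₄ - t₃)) := by
  have key : ∀ u v, Real.exp (2 * u) - Real.exp (2 * v) =
      2 * (Real.exp u * Real.exp v) * Real.sinh (u - v) := by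
    intro u v
    rw [Real.sinh_eq, ← Real.exp_add, show 2 * Real.exp (u + v) *
      ((Real.exp (u - v) - Real.exp (-(u - v))) / 2) = Real.exp (u + v) * Real.exp (u - v) -
      Real.exp (u + v) * Real.exp (-(u - v)) by ring, ← Real.exp_add, ← Real.exp_add]
    congr 2 <;> ring
  rw [crossRatio_add_one (Real.exp_lt_exp.2 (by linarith)) (Real.exp_lt_exp.2 (by linarith))
    (Real.exp_lt_exp.2 (by linarith)), key, key, key, key]
  have e1 := (Real.exp_pos t₁).ne'
  have e2 := (Real.exp_pos t₂).ne'
  have e3 := (Real.exp_pos t₃).ne'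
  have e4 := (Real.exp_pos t₄).ne'
  have s1 := (Real.sinh_pos_iff.2 (sub_pos.2 h12)).ne'
  have s2 := (Real.sinh_pos_iff.2 (sub_pos.2 h34)).ne'
  field_simp

theorem crossRatio_le_rpow_of_pos {ℓ x₁ x₂ x₃ x₄ : ℝ} (hℓ : 1 ≤ ℓ) (h1 : 0 < x₁) (h12 : x₁ < x₂)
    (h23 : x₂ < x₃) (h34 : x₃ < x₄) :
    crossRatio x₁ x₂ x₃ x₄ ≤ crossRatio (x₁ ^ ℓ) (x₂ ^ ℓ) (x₃ ^ ℓ) (x₄ ^ ℓ) := by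
  obtain ⟨t, ht⟩ : ∃ t : ℝ → ℝ, ∀ x, t x = Real.log x / 2 := ⟨_, fun _ => rfl⟩
  have e1 : ∀ x, 0 < x → x = Real.exp (2 * t x) := fun x hx => by
    rw [ht, mul_div_cancel₀ _ (two_ne_zero), Real.exp_log hx]
  have e2 : ∀ x, 0 < x → x ^ ℓ = Real.exp (2 * (ℓ * t x)) := fun x hx => by
    rw [ht, Real.rpow_def_of_pos hx]; congr 1; ring
  have hlt : ∀ x y, 0 < x → x < y → t x < t y := fun x y hx hxy => by
    rw [ht, ht]; linarith [Real.log_lt_log hx hxy]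
  have t12 := hlt _ _ h1 h12
  have t23 := hlt _ _ (h1.trans h12) h23
  have t34 := hlt _ _ (by linarith) h34
  have hℓ0 : 0 < ℓ := by linarith
  have a1 := crossRatio_exp_add_one t12 t23 t34
  rw [← e1 x₁ h1, ← e1 x₂ (by linarith), ← e1 x₃ (by linarith), ← e1 x₄ (by linarith)] at a1
  have a2 := crossRatio_exp_add_one (mul_lt_mul_of_pos_left t12 hℓ0)
    (mul_lt_mul_of_pos_left t23 hℓ0) (mul_lt_mul_of_pos_left t34 hℓ0)
  rw [← e2 x₁ h1, ← e2 x₂ (by linarith), ← e2 x₃ (by linarith), ← e2 x₄ (by linarith)] at a2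
  have b1 := sinh_mul_div_le hℓ (s := t x₂ - t x₁) (t := t x₃ - t x₁) (by linarith) (by linarith)
  have b2 := sinh_mul_div_le hℓ (s := t x₄ - t x₃) (t := t x₄ - t x₂) (by linarith) (by linarith)
  have c2 : 0 ≤ Real.sinh (t x₄ - t x₂) / Real.sinh (t x₄ - t x₃) :=
    div_nonneg (Real.sinh_nonneg_iff.2 (by linarith)) (Real.sinh_nonneg_iff.2 (by linarith))
  have c1 : 0 ≤ Real.sinh (t x₃ - t x₁) / Real.sinh (t x₂ - t x₁) :=
    div_nonneg (Real.sinh_nonneg_iff.2 (by linarith)) (Real.sinh_nonneg_iff.2 (by linarith))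
  have := mul_le_mul b1 b2 c2 (c1.trans b1)
  simp only [mul_sub] at this
  linarith

/-- Power maps of exponent at least one expand cross-ratios. -/
theorem crossRatio_le_rpow {ℓ x₁ x₂ x₃ x₄ : ℝ} (hℓ : 1 ≤ ℓ) (h1 : 0 ≤ x₁) (h12 : x₁ < x₂)
    (h23 : x₂ < x₃) (h34 : x₃ < x₄) :
    crossRatio x₁ x₂ x₃ x₄ ≤ crossRatio (x₁ ^ ℓ) (x₂ ^ ℓ) (x₃ ^ ℓ) (x₄ ^ ℓ) := by
  rcases h1.lt_or_eq with h1 | rfl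
  · exact crossRatio_le_rpow_of_pos hℓ h1 h12 h23 h34
  have hℓ0 : 0 < ℓ := by linarith
  -- When the first point is 0 the logarithmic substitution fails; the inequality survives as a
  -- limit in that point.
  have hc : ∀ y₂ y₃ y₄ : ℝ, 0 < y₂ → y₃ < y₄ → ContinuousAt (fun y => crossRatio y y₂ y₃ y₄) 0 := by
    intro y₂ y₃ y₄ h2 h34
    unfold crossRatio
    refine ContinuousAt.div (by fun_prop) (by fun_prop) ?_
    exact mul_ne_zero (abs_pos.2 (by linarith)).ne' (abs_pos.2 (by linarith)).ne'
  have hp : Tendsto (fun y : ℝ => y ^ ℓ) (𝓝[>] 0) (𝓝 0) := by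
    have := (Real.continuousAt_rpow_const 0 ℓ (Or.inr hℓ0.le)).tendsto
    rw [Real.zero_rpow hℓ0.ne'] at this
    exact this.mono_left nhdsWithin_le_nhds
  have t1 : Tendsto (fun y => crossRatio y x₂ x₃ x₄) (𝓝[>] 0) (𝓝 (crossRatio 0 x₂ x₃ x₄)) :=
    (hc x₂ x₃ x₄ h12 h34).tendsto.mono_left nhdsWithin_le_nhds
  have t2 : Tendsto (fun y : ℝ => crossRatio (y ^ ℓ) (x₂ ^ ℓ) (x₃ ^ ℓ) (x₄ ^ ℓ)) (𝓝[>] 0)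
      (𝓝 (crossRatio 0 (x₂ ^ ℓ) (x₃ ^ ℓ) (x₄ ^ ℓ))) :=
    (hc _ _ _ (Real.rpow_pos_of_pos h12 _)
      (Real.rpow_lt_rpow (by linarith) h34 hℓ0)).tendsto.comp hp
  rw [Real.zero_rpow hℓ0.ne']
  refine le_of_tendsto_of_tendsto t1 t2 ?_
  filter_upwards [Ioo_mem_nhdsGT h12] with y hy
  exact crossRatio_le_rpow_of_pos hℓ hy.1 hy.2 h23 h34

/-! ### Branches with a critical order at the turning point -/

/-- A decreasing branch on `[c, b]` that behaves near `c` like a power of order `ℓ` up to changes of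
coordinates. -/
structure RightBranch (F : ℝ → ℝ) (c b ℓ : ℝ) : Prop where
  lt : c < b
  one_le : 1 ≤ ℓ
  anti : StrictAntiOn F (Icc c b)
  lip : ∀ u ∈ Ioo c b, ∃ C, LogDerivLip F u b C
  crit : ∃ (φ ψ : ℝ → ℝ) (η : ℝ), ContDiff ℝ 2 φ ∧ ContDiff ℝ 2 ψ ∧ (∀ x, 0 < deriv φ x) ∧
    (∀ x, deriv ψ x < 0) ∧ φ c = 0 ∧ ψ (F c) = 0 ∧ 0 < η ∧ ∀ x ∈ Icc c (c + η), ψ (F x) = φ x ^ ℓ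

namespace RightBranch

variable {F : ℝ → ℝ} {c b ℓ : ℝ}

/-- Take `Φ = (ψ ∘ F) ^ ℓ⁻¹`. Near `c` it equals `φ`; away from `c` the values of `ψ ∘ F` are
positive and the root is smooth there. Glued over an overlap, these give a coordinate on all of `[c,
b]` in which the branch is a pure power. -/
theorem exists_coordinates (h : RightBranch F c b ℓ) :
    ∃ (ψ Φ : ℝ → ℝ) (C : ℝ), ContDiff ℝ 2 ψ ∧ StrictAnti ψ ∧ (∀ x, deriv ψ x ≠ 0) ∧ ψ (F c) = 0 ∧
      LogDerivLip Φ c b C ∧ (∀ x ∈ Icc c b, 0 ≤ Φ x) ∧ StrictMonoOn Φ (Icc c b) ∧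
      ∀ x ∈ Icc c b, ψ (F x) = Φ x ^ ℓ := by
  obtain ⟨φ, ψ, η, hφ, hψ, hφ', hψ', hφc, hψc, hη, heq⟩ := h.crit
  have hcb := h.lt
  have hℓ : 0 < ℓ := by linarith [h.one_le]
  have hφm : StrictMono φ := strictMono_of_deriv_pos hφ'
  have hψm : StrictAnti ψ := strictAnti_of_deriv_neg hψ'
  have hpos : ∀ x ∈ Icc c b, 0 ≤ ψ (F x) := fun x hx => by
    rw [← hψc]
    exact hψm.antitone (h.anti.antitoneOn (left_mem_Icc.2 hcb.le) hx hx.1)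
  have hpos' : ∀ x ∈ Ioc c b, 0 < ψ (F x) := fun x hx => by
    rw [← hψc]
    exact hψm (h.anti (left_mem_Icc.2 hcb.le) (Ioc_subset_Icc_self hx) hx.1)
  set v := c + min η ((b - c) / 2) with hv
  have hcv : c < v := by
    have : 0 < min η ((b - c) / 2) := lt_min hη (by linarith)
    linarith
  have hvb : v < b := by linarith [min_le_right η ((b - c) / 2)]
  have hvη : v ≤ c + η := by linarith [min_le_left η ((b - c) / 2)]
  set u := (c + v) / 2 with hu
  have hcu : c < u := by linarith
  have huv : u < v := by linarith
  have hub : u < b := by linarith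
  obtain ⟨C₁, h₁⟩ := LogDerivLip.of_contDiff hcv hφ fun x => (hφ' x).ne'
  have h₁' : LogDerivLip (fun x => ψ (F x) ^ ℓ⁻¹) c v C₁ := by
    refine h₁.congr fun x hx => ?_
    rw [heq x ⟨hx.1, hx.2.trans hvη⟩]
    refine Real.rpow_rpow_inv ?_ hℓ.ne'
    rw [← hφc]
    exact hφm.monotone hx.1
  have hIcc : Icc u b ⊆ Icc c b := Icc_subset_Icc_left hcu.le
  have hFlt : F b < F u := h.anti ⟨hcu.le, hub.le⟩ (right_mem_Icc.2 hcb.le) hub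
  obtain ⟨C₂, h₂⟩ := h.lip u ⟨hcu, hub⟩
  obtain ⟨C₃, h₃⟩ := LogDerivLip.of_contDiff hFlt hψ fun x => (hψ' x).ne
  have hψu := hpos' u ⟨hcu, hub.le⟩
  have hψlt : ψ (F u) < ψ (F b) := hψm hFlt
  obtain ⟨C₄, h₄⟩ : ∃ C, LogDerivLip (fun y => y ^ ℓ⁻¹) (ψ (F u)) (ψ (F b)) C := by
    refine LogDerivLip.of_contDiffOn hψlt
      (fun y hy => (Real.contDiffAt_rpow_const_of_ne (hψu.trans_le hy.1).ne').contDiffWithinAt)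
      fun y hy => ?_
    have hy0 := hψu.trans_le hy.1
    rw [((Real.hasDerivAt_rpow_const (Or.inl hy0.ne')).hasDerivWithinAt).derivWithin
      (uniqueDiffOn_Icc hψlt y hy)]
    exact mul_ne_zero (inv_ne_zero hℓ.ne') (Real.rpow_pos_of_pos hy0 _).ne'
  have hFI : ∀ x ∈ Icc u b, F x ∈ Icc (F b) (F u) := fun x hx =>
    ⟨h.anti.antitoneOn (hIcc hx) (right_mem_Icc.2 hcb.le) hx.2,
      h.anti.antitoneOn ⟨hcu.le, hub.le⟩ (hIcc hx) hx.1⟩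
  have hFO : ∀ x ∈ Ioo u b, F x ∈ Ioo (F b) (F u) := fun x hx =>
    ⟨h.anti (hIcc (Ioo_subset_Icc_self hx)) (right_mem_Icc.2 hcb.le) hx.2,
      h.anti ⟨hcu.le, hub.le⟩ (hIcc (Ioo_subset_Icc_self hx)) hx.1⟩
  obtain ⟨C₅, h₅⟩ := h₃.comp h₂ hFI hFO
  obtain ⟨C₆, h₆⟩ := h₄.comp h₅
    (fun x hx => ⟨hψm.antitone (hFI x hx).2, hψm.antitone (hFI x hx).1⟩)
    (fun x hx => ⟨hψm (hFO x hx).2, hψm (hFO x hx).1⟩)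
  refine ⟨ψ, fun x => ψ (F x) ^ ℓ⁻¹, _, hψ, hψm, fun x => (hψ' x).ne, hψc,
    h₁'.glue h₆ hcu.le huv hvb.le, fun x hx => Real.rpow_nonneg (hpos x hx) _, ?_, fun x hx => ?_⟩
  · intro x hx y hy hxy
    exact Real.rpow_lt_rpow (hpos x hx) (hψm (h.anti hx hy hxy)) (inv_pos.2 hℓ)
  · exact (Real.rpow_inv_rpow (hpos x hx) hℓ.ne').symm

/-- The cross-ratio inequality and the power-law behaviour of a branch. -/
theorem exists_bounds (h : RightBranch F c b ℓ) :
    ∃ C K, 0 ≤ C ∧ 1 ≤ K ∧ (∀ x₁ x₂ x₃ x₄, c ≤ x₁ → x₁ < x₂ → x₂ < x₃ → x₃ < x₄ → x₄ ≤ b →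
      crossRatio x₁ x₂ x₃ x₄ ≤
        Real.exp (C * (x₄ - x₁)) * crossRatio (F x₁) (F x₂) (F x₃) (F x₄)) ∧
      ∀ t ∈ Icc 0 (b - c), t ^ ℓ ≤ K * (F c - F (c + t)) ∧ F c - F (c + t) ≤ K * t ^ ℓ := by
  obtain ⟨ψ, Φ, C₁, hψ, hψm, hψ', hψc, hΦ, hΦ0, hΦm, heq⟩ := h.exists_coordinates
  have hcb := h.lt
  have hℓ1 := h.one_le
  have hℓ : 0 < ℓ := by linarith
  have hlm : c ∈ Icc c b := left_mem_Icc.2 hcb.le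
  have hrm : b ∈ Icc c b := right_mem_Icc.2 hcb.le
  have hFI : ∀ x ∈ Icc c b, F x ∈ Icc (F b) (F c) := fun x hx =>
    ⟨h.anti.antitoneOn hx hrm hx.2, h.anti.antitoneOn hlm hx hx.1⟩
  obtain ⟨C₂, h₂⟩ := LogDerivLip.of_contDiff (h.anti hlm hrm hcb) hψ hψ'
  obtain ⟨m, M, hm, hM, hb⟩ := hΦ.bilipschitz
  obtain ⟨m', M', hm', hM', hb'⟩ := h₂.bilipschitz
  have hΦc : Φ c = 0 := by
    have := heq c hlm
    rw [hψc] at this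
    exact ((Real.rpow_eq_zero (hΦ0 c hlm) hℓ.ne').1 this.symm)
  -- `F` is Lipschitz
  obtain ⟨Λ, hΛ0, hΛ⟩ : ∃ Λ, 0 ≤ Λ ∧ ∀ x ∈ Icc c b, ∀ y ∈ Icc c b, |F y - F x| ≤ Λ * |y - x| := by
    have hp : ContDiff ℝ 1 fun x : ℝ => x ^ ℓ := Real.contDiff_rpow_const_of_le (n := 1) (by simpa)
    obtain ⟨L, hL⟩ := hp.contDiffOn.exists_lipschitzOnWith one_ne_zero (convex_Icc 0 (Φ b))
      isCompact_Icc
    refine ⟨L * M / m', by positivity, fun x hx y hy => ?_⟩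
    have e1 := (hb' (F x) (hFI x hx) (F y) (hFI y hy)).1
    have e2 := hL.dist_le_mul (Φ y) ⟨hΦ0 y hy, hΦm.monotoneOn hy hrm hy.2⟩ (Φ x)
      ⟨hΦ0 x hx, hΦm.monotoneOn hx hrm hx.2⟩
    rw [Real.dist_eq, Real.dist_eq] at e2
    rw [heq x hx, heq y hy] at e1
    have e3 := mul_le_mul_of_nonneg_left (hb x hx y hy).2 L.2
    rw [div_mul_eq_mul_div, le_div_iff₀ hm']
    change (L : ℝ) * _ ≤ (L : ℝ) * _ at e3
    linarith
  -- `C₁` comes from `Φ` and `C₂` from `ψ`; the latter is measured by lengths of images, hence the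
  -- Lipschitz constant `Λ` of `F`.
  refine ⟨2 * C₁ + 2 * C₂ * Λ, max ((m ^ ℓ)⁻¹ * M') (max ((M ^ ℓ) / m') 1), ?_, ?_, ?_, ?_⟩
  · have := hΦ.nonneg
    have := h₂.nonneg
    positivity
  · exact (le_max_right _ _).trans (le_max_right _ _)
  · intro x₁ x₂ x₃ x₄ h1 h12 h23 h34 h4
    have i1 : x₁ ∈ Icc c b := ⟨h1, by linarith⟩
    have i2 : x₂ ∈ Icc c b := ⟨by linarith, by linarith⟩
    have i3 : x₃ ∈ Icc c b := ⟨by linarith, by linarith⟩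
    have i4 : x₄ ∈ Icc c b := ⟨by linarith, h4⟩
    have s1 := hΦ.crossRatio_le h1 h12 h23 h34 h4
    have s2 := crossRatio_le_rpow hℓ1 (hΦ0 x₁ i1) (hΦm i1 i2 h12) (hΦm i2 i3 h23) (hΦm i3 i4 h34)
    rw [← heq x₁ i1, ← heq x₂ i2, ← heq x₃ i3, ← heq x₄ i4] at s2
    have s3 := h₂.crossRatio_ge (hFI x₄ i4).1 (h.anti i3 i4 h34) (h.anti i2 i3 h23) (h.anti i1 i2 h12)
      (hFI x₁ i1).2
    rw [crossRatio_reverse, crossRatio_reverse (F x₁)] at s3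
    have s4 : Real.exp (2 * C₂ * (F x₁ - F x₄)) ≤ Real.exp (2 * C₂ * Λ * (x₄ - x₁)) := by
      rw [Real.exp_le_exp]
      have := hΛ x₄ i4 x₁ i1
      rw [abs_sub_comm x₁, abs_of_pos (by linarith : 0 < x₄ - x₁)] at this
      have := mul_le_mul_of_nonneg_left ((le_abs_self _).trans this)
        (by linarith [h₂.nonneg] : 0 ≤ 2 * C₂)
      linarith
    calc crossRatio x₁ x₂ x₃ x₄
        ≤ Real.exp (2 * C₁ * (x₄ - x₁)) * (Real.exp (2 * C₂ * Λ * (x₄ - x₁)) *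
          crossRatio (F x₁) (F x₂) (F x₃) (F x₄)) := by
          refine s1.trans (mul_le_mul_of_nonneg_left ?_ (Real.exp_pos _).le)
          exact s2.trans (s3.trans (mul_le_mul_of_nonneg_right s4 (crossRatio_nonneg _ _ _ _)))
      _ = _ := by
          rw [← mul_assoc, ← Real.exp_add]
          congr 2
          ring
  · intro t ht
    have hx : c + t ∈ Icc c b := ⟨by linarith [ht.1], by linarith [ht.2]⟩
    have e1 := hb c hlm (c + t) hx
    have e2 := hb' (F c) (hFI c hlm) (F (c + t)) (hFI _ hx)
    have hF0 : 0 ≤ F c - F (c + t) := by linarith [(hFI _ hx).2]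
    rw [hΦc, sub_zero, abs_of_nonneg (hΦ0 _ hx), add_sub_cancel_left, abs_of_nonneg ht.1] at e1
    rw [hψc, sub_zero, heq _ hx, abs_of_nonneg (Real.rpow_nonneg (hΦ0 _ hx) _), abs_sub_comm,
      abs_of_nonneg hF0] at e2
    have p1 : (m * t) ^ ℓ ≤ Φ (c + t) ^ ℓ := Real.rpow_le_rpow (mul_nonneg hm.le ht.1) e1.1 hℓ.le
    have p2 : Φ (c + t) ^ ℓ ≤ (M * t) ^ ℓ := Real.rpow_le_rpow (hΦ0 _ hx) e1.2 hℓ.le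
    rw [Real.mul_rpow hm.le ht.1] at p1
    rw [Real.mul_rpow hM.le ht.1] at p2
    have hmp := Real.rpow_pos_of_pos hm ℓ
    have htp := Real.rpow_nonneg ht.1 ℓ
    constructor
    · refine le_trans ?_ (mul_le_mul_of_nonneg_right (le_max_left _ _) hF0)
      rw [mul_assoc, ← div_eq_inv_mul, le_div_iff₀ hmp]
      linarith [e2.2]
    · refine le_trans ?_ (mul_le_mul_of_nonneg_right
        ((le_max_left _ _).trans (le_max_right _ _)) htp)
      rw [div_mul_eq_mul_div, le_div_iff₀ hm']
      linarith [e2.1]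

end RightBranch

theorem LogDerivLip.distortion {g : ℝ → ℝ} {u v C : ℝ} (h : LogDerivLip g u v C) {x y z : ℝ}
    (hy : y ∈ uIcc x z) (hsub : uIcc x z ⊆ Icc u v) :
    |g z - g y| * |y - x| ≤ Real.exp (C * |z - x|) * (|g y - g x| * |z - y|) := by
  have hx := hsub left_mem_uIcc
  have hz := hsub right_mem_uIcc
  rcases eq_or_ne y x with rfl | hyx
  · simp
  rcases eq_or_ne y z with rfl | hyz
  · simp
  rcases mem_uIcc.1 hy with ⟨h1, h2⟩ | ⟨h1, h2⟩
  · have h1' := lt_of_le_of_ne h1 hyx.symm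
    have h2' := lt_of_le_of_ne h2 hyz
    rw [abs_of_pos (by linarith : 0 < y - x), abs_of_pos (by linarith : 0 < z - x),
      abs_of_pos (by linarith : 0 < z - y)]
    exact h.slope_le hx.1 hz.2 h1 h2' le_rfl le_rfl h1' h2
  · have h1' := lt_of_le_of_ne h1 hyz.symm
    have h2' := lt_of_le_of_ne h2 hyx
    have := h.slope_le hz.1 hx.2 le_rfl h1' h2 h1 h2' le_rfl
    rw [abs_sub_comm y x, abs_sub_comm z x, abs_sub_comm z y, abs_of_pos (by linarith : 0 < x - y),
      abs_of_pos (by linarith : 0 < x - z), abs_of_pos (by linarith : 0 < y - z),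
      abs_sub_comm (g z), abs_sub_comm (g y) (g x)]
    exact this

theorem RightBranch.distortion {F : ℝ → ℝ} {c b ℓ η : ℝ} (h : RightBranch F c b ℓ) (hη : 0 < η) :
    ∃ C, 0 ≤ C ∧ ∀ x y z, y ∈ uIcc x z → uIcc x z ⊆ Icc (c + η) b →
      |F z - F y| * |y - x| ≤ Real.exp (C * |z - x|) * (|F y - F x| * |z - y|) := by
  by_cases hb : c + η < b
  · obtain ⟨C, hC⟩ := h.lip (c + η) ⟨by linarith, hb⟩
    exact ⟨C, hC.nonneg, fun x y z hy hsub => hC.distortion hy hsub⟩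
  · refine ⟨0, le_rfl, fun x y z hy hsub => ?_⟩
    have h1 := hsub left_mem_uIcc
    have h2 := hsub hy
    have : y = x := by linarith [h1.1, h1.2, h2.1, h2.2]
    rw [this]
    simp

/-- Reflection in `c` makes the left branch a right one, and cross-ratios and distances are
invariant under it. -/
theorem UnimodalSystem.exists_bounds {F : ℝ → ℝ} {a c b ℓm ℓp : ℝ} (h : UnimodalSystem F a c b)
    (hR : RightBranch F c b ℓp) (hL : RightBranch (fun x => F (2 * c - x)) c (2 * c - a) ℓm) :
    (∃ C, 0 ≤ C ∧ CrossRatioBound F a c b C) ∧ DistortionBound F a c b ∧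
      ∃ ℓ K η, PowerLaw F c ℓ K η := by
  obtain ⟨C₁, K₁, hC₁, hK₁, hcr₁, hpow₁⟩ := hR.exists_bounds
  obtain ⟨C₂, K₂, hC₂, hK₂, hcr₂, hpow₂⟩ := hL.exists_bounds
  have hac := h.lt_left
  have hcb := h.lt_right
  refine ⟨⟨max C₁ C₂, hC₁.trans (le_max_left _ _), ?_⟩, ?_, ?_⟩
  · intro x₁ x₂ x₃ x₄ h12 h23 h34 h1 h4 hc
    have hmono : ∀ C, C ≤ max C₁ C₂ → Real.exp (C * (x₄ - x₁)) ≤ Real.exp (max C₁ C₂ * (x₄ - x₁)) :=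
      fun C hC => Real.exp_le_exp.2 (mul_le_mul_of_nonneg_right hC (by linarith))
    rcases hc with hc | hc
    · have h5 := hcr₂ (2 * c - x₄) (2 * c - x₃) (2 * c - x₂) (2 * c - x₁) (by linarith) (by linarith)
        (by linarith) (by linarith) (by linarith)
      simp only [sub_sub_cancel] at h5
      have e : ∀ x : ℝ, 2 * c - x = 2 * c + -1 * x := fun x => by ring
      rw [e, e, e, e, crossRatio_side (Or.inr rfl), crossRatio_reverse, crossRatio_reverse (F x₁)] at h5
      refine h5.trans (mul_le_mul_of_nonneg_right ?_ (crossRatio_nonneg _ _ _ _))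
      rw [show 2 * c + -1 * x₁ - (2 * c + -1 * x₄) = x₄ - x₁ by ring]
      exact hmono _ (le_max_right _ _)
    · exact (hcr₁ x₁ x₂ x₃ x₄ hc h12 h23 h34 h4).trans
        (mul_le_mul_of_nonneg_right (hmono _ (le_max_left _ _)) (crossRatio_nonneg _ _ _ _))
  · intro η hη
    obtain ⟨D₁, hD₁, hd₁⟩ := hR.distortion hη
    obtain ⟨D₂, hD₂, hd₂⟩ := hL.distortion hη
    refine ⟨max D₁ D₂, hD₁.trans (le_max_left _ _), fun x y z hy hsub hside => ?_⟩
    have hmono : ∀ D, D ≤ max D₁ D₂ → Real.exp (D * |z - x|) * (|F y - F x| * |z - y|) ≤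
        Real.exp (max D₁ D₂ * |z - x|) * (|F y - F x| * |z - y|) := fun D hD => by
      refine mul_le_mul_of_nonneg_right (Real.exp_le_exp.2 ?_) (by positivity)
      exact mul_le_mul_of_nonneg_right hD (abs_nonneg _)
    rcases hside with hside | hside
    · have hrefl : ∀ w, w ∈ uIcc (2 * c - x) (2 * c - z) → 2 * c - w ∈ uIcc x z := by
        intro w hw
        rcases mem_uIcc.1 hw with hw | hw
        · exact mem_uIcc.2 (Or.inr ⟨by linarith, by linarith⟩)
        · exact mem_uIcc.2 (Or.inl ⟨by linarith, by linarith⟩)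
      have h5 := hd₂ (2 * c - x) (2 * c - y) (2 * c - z) ?_ ?_
      · simp only [sub_sub_cancel] at h5
        rw [show 2 * c - y - (2 * c - x) = -(y - x) by ring, show 2 * c - z - (2 * c - x) = -(z - x) by ring,
          show 2 * c - z - (2 * c - y) = -(z - y) by ring, abs_neg, abs_neg, abs_neg] at h5
        exact h5.trans (hmono _ (le_max_right _ _))
      · rcases mem_uIcc.1 hy with hy | hy
        · exact mem_uIcc.2 (Or.inr ⟨by linarith, by linarith⟩)
        · exact mem_uIcc.2 (Or.inl ⟨by linarith, by linarith⟩)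
      · intro w hw
        have h6 := hsub (hrefl w hw)
        have h7 := mem_Iic.1 (hside (hrefl w hw))
        exact ⟨by linarith, by linarith [h6.1]⟩
    · exact (hd₁ x y z hy fun w hw => ⟨hside hw, (hsub hw).2⟩).trans (hmono _ (le_max_left _ _))
  · have hη1 := min_le_left (1 : ℝ) (min (b - c) (c - a))
    have hη2 := (min_le_right (1 : ℝ) (min (b - c) (c - a))).trans (min_le_left _ _)
    have hη3 := (min_le_right (1 : ℝ) (min (b - c) (c - a))).trans (min_le_right _ _)
    have hgap : ∀ x, 0 ≤ F c - F x := fun x => sub_nonneg.2 (h.le_peak x)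
    refine ⟨fun s => if s = 1 then ℓp else ℓm, max K₁ K₂, min 1 (min (b - c) (c - a)),
      hK₁.trans (le_max_left _ _), lt_min one_pos (lt_min (by linarith) (by linarith)), hη1, ?_, ?_, ?_⟩
    · intro s
      split_ifs
      exacts [hR.one_le, hL.one_le]
    · rintro s (rfl | rfl) t ht
      · rw [if_pos rfl, one_mul]
        exact (hpow₁ t ⟨ht.1, ht.2.trans hη2⟩).1.trans
          (mul_le_mul_of_nonneg_right (le_max_left _ _) (hgap _))
      · rw [if_neg (by norm_num)]
        have h5 := (hpow₂ t ⟨ht.1, by linarith [ht.2]⟩).1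
        rw [show 2 * c - c = c by ring, show 2 * c - (c + t) = c + -1 * t by ring] at h5
        exact h5.trans (mul_le_mul_of_nonneg_right (le_max_right _ _) (hgap _))
    · rintro s (rfl | rfl) t ht
      · rw [if_pos rfl, one_mul]
        exact (hpow₁ t ⟨ht.1, ht.2.trans hη2⟩).2.trans
          (mul_le_mul_of_nonneg_right (le_max_left _ _) (Real.rpow_nonneg ht.1 _))
      · rw [if_neg (by norm_num)]
        have h5 := (hpow₂ t ⟨ht.1, by linarith [ht.2]⟩).2
        rw [show 2 * c - c = c by ring, show 2 * c - (c + t) = c + -1 * t by ring] at h5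
        exact h5.trans (mul_le_mul_of_nonneg_right (le_max_right _ _) (Real.rpow_nonneg ht.1 _))

/-! ### From a wandering interval to a wandering system -/

namespace UnimodalSystem

variable {F : ℝ → ℝ} {a c b : ℝ}

theorem nontrivial_image (h : UnimodalSystem F a c b) {S : Set ℝ} (hS : S.OrdConnected)
    (hn : S.Nontrivial) : (F '' S).Nontrivial := by
  obtain ⟨x, hx, y, hy, hxy⟩ := hn.exists_lt
  rcases le_or_gt y c with hyc | hyc
  · exact ⟨F x, mem_image_of_mem _ hx, F y, mem_image_of_mem _ hy,
      (h.mono (mem_Iic.2 (hxy.le.trans hyc)) (mem_Iic.2 hyc) hxy).ne⟩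
  rcases lt_or_ge x c with hxc | hxc
  · exact ⟨F x, mem_image_of_mem _ hx, F c, mem_image_of_mem _ (hS.out hx hy ⟨hxc.le, hyc.le⟩),
      (h.lt_peak hxc.ne).ne⟩
  · exact ⟨F x, mem_image_of_mem _ hx, F y, mem_image_of_mem _ hy,
      (h.anti (mem_Ici.2 hxc) (mem_Ici.2 hyc.le) hxy).ne'⟩

theorem nontrivial_image_iterate (h : UnimodalSystem F a c b) {S : Set ℝ} (hS : S.OrdConnected)
    (hn : S.Nontrivial) (k : ℕ) : (F^[k] '' S).Nontrivial := by
  induction k with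
  | zero => simpa using hn
  | succ k ih =>
    rw [Function.iterate_succ', image_comp]
    exact h.nontrivial_image (ordConnected_image (h.cont_iterate k) hS) ih

/-- The maximal interval in `[a, b]` around `y` that contains no preimage of `c`. -/
def freeInterval (F : ℝ → ℝ) (a c b y : ℝ) : Set ℝ :=
  {z | z ∈ Icc a b ∧ ∀ w ∈ uIcc z y, ∀ i, F^[i] w ≠ c}

theorem ordConnected_freeInterval (F : ℝ → ℝ) (a c b y : ℝ) :
    (freeInterval F a c b y).OrdConnected := by
  refine ⟨fun z₁ h₁ z₂ h₂ z hz => ⟨ordConnected_Icc.out h₁.1 h₂.1 hz, fun w hw => ?_⟩⟩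
  rcases le_total z y with hzy | hzy
  · rw [uIcc_of_le hzy] at hw
    exact h₁.2 w (mem_uIcc.2 (Or.inl ⟨hz.1.trans hw.1, hw.2⟩))
  · rw [uIcc_of_ge hzy] at hw
    exact h₂.2 w (mem_uIcc.2 (Or.inr ⟨hw.1, hw.2.trans hz.2⟩))

theorem freeOn_freeInterval (F : ℝ → ℝ) (a c b y : ℝ) (k : ℕ) :
    FreeOn F c k (freeInterval F a c b y) := fun i _ z hz => hz.2 z left_mem_uIcc i

theorem mapsTo_freeInterval (h : UnimodalSystem F a c b) (y : ℝ) (k : ℕ) :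
    MapsTo F^[k] (freeInterval F a c b y) (freeInterval F a c b (F^[k] y)) := by
  intro z hz
  refine ⟨h.iterate_mem hz.1 k, fun w hw i => ?_⟩
  have hf : FreeOn F c k (uIcc z y) := fun i _ w hw => hz.2 w hw i
  rw [← h.image_uIcc hf] at hw
  obtain ⟨v, hv, rfl⟩ := hw
  rw [← Function.iterate_add_apply]
  exact hz.2 v hv _

/-- A path from `w` through `y` and `z` to `y'` avoids preimages of `c`. By symmetry, free intervals
that meet coincide. -/
theorem freeInterval_subset {y y' z : ℝ} (hz : z ∈ freeInterval F a c b y)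
    (hz' : z ∈ freeInterval F a c b y') : freeInterval F a c b y ⊆ freeInterval F a c b y' := by
  intro w hw
  refine ⟨hw.1, fun v hv i => ?_⟩
  have h1 : v ∈ uIcc w y ∪ uIcc y z ∪ uIcc z y' := by
    have := uIcc_subset_uIcc_union_uIcc (a := w) (b := y) (c := y') hv
    rcases this with h | h
    · exact Or.inl (Or.inl h)
    · rcases uIcc_subset_uIcc_union_uIcc (b := z) h with h | h
      · exact Or.inl (Or.inr h)
      · exact Or.inr h
  rcases h1 with (h1 | h1) | h1
  · exact hw.2 v h1 i
  · exact hz.2 v (by rwa [uIcc_comm]) i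
  · exact hz'.2 v h1 i

/-- The maximal preimage-free intervals along an orbit without injective returns are disjoint. -/
theorem disjoint_freeInterval (h : UnimodalSystem F a c b) {x : ℝ} (hx : x ∈ Icc a b)
    (hfree : ∀ i, F^[i] x ≠ c) (hnp : NoInjectiveReturn F x) {m n : ℕ} (hmn : m ≠ n) :
    Disjoint (freeInterval F a c b (F^[m] x)) (freeInterval F a c b (F^[n] x)) := by
  have key : ∀ m n, m < n →
      Disjoint (freeInterval F a c b (F^[m] x)) (freeInterval F a c b (F^[n] x)) := by
    intro m n hmn
    rw [Set.disjoint_left]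
    intro z hz hz'
    refine hnp m (n - m) (freeInterval F a c b (F^[m] x)) (by omega)
      (ordConnected_freeInterval _ _ _ _ _) ⟨h.iterate_mem hx m, fun w hw i => ?_⟩ ?_
      (h.injOn_iterate (ordConnected_freeInterval _ _ _ _ _) (freeOn_freeInterval _ _ _ _ _ _))
    · rw [uIcc_self, mem_singleton_iff] at hw
      rw [hw, ← Function.iterate_add_apply]
      exact hfree _
    · intro w hw
      have := h.mapsTo_freeInterval (F^[m] x) (n - m) hw
      rw [← Function.iterate_add_apply, show n - m + m = n by omega] at this
      exact freeInterval_subset hz' hz this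
  rcases lt_or_gt_of_ne hmn with hlt | hlt
  · exact key m n hlt
  · exact (key n m hlt).symm

theorem NoInjectiveReturn.iterate {x : ℝ} (h : NoInjectiveReturn F x) (k : ℕ) :
    NoInjectiveReturn F (F^[k] x) := fun n p L hp hL hn => by
  rw [← Function.iterate_add_apply] at hn
  exact h (n + k) p L hp hL hn

theorem le_or_le_of_disjoint_Ioo {u v u' v' : ℝ} (h : u < v) (h' : u' < v')
    (hd : Disjoint (Ioo u v) (Ioo u' v')) : v ≤ u' ∨ v' ≤ u := by
  by_contra! hcon
  have h1 : max u u' < min v v' := by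
    rw [max_lt_iff, lt_min_iff, lt_min_iff]
    exact ⟨⟨h, hcon.2⟩, ⟨hcon.1, h'⟩⟩
  obtain ⟨z, hz⟩ := exists_between h1
  exact Set.disjoint_left.1 hd ⟨(le_max_left _ _).trans_lt hz.1, hz.2.trans_le (min_le_left _ _)⟩
    ⟨(le_max_right _ _).trans_lt hz.1, hz.2.trans_le (min_le_right _ _)⟩

/-- An interval with disjoint images and without injective returns yields a wandering system. -/
theorem exists_wanderingSystem (h : UnimodalSystem F a c b) {J : Set ℝ} (hJ : J ⊆ Icc a b)
    (hord : J.OrdConnected) (hnt : J.Nontrivial)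
    (hdisj : ∀ m n : ℕ, m ≠ n → Disjoint (F^[m] '' J) (F^[n] '' J))
    (hnp : ∀ x ∈ J, NoInjectiveReturn F x) : ∃ α β x, WanderingSystem F a c b α β x := by
  -- images of high order avoid `c`
  obtain ⟨N₀, hN₀⟩ : ∃ N, ∀ i ≥ N, c ∉ F^[i] '' J := by
    by_cases hex : ∃ i, c ∈ F^[i] '' J
    · obtain ⟨i, hi⟩ := hex
      exact ⟨i + 1, fun j hj hcj => Set.disjoint_left.1 (hdisj i j (by omega)) hi hcj⟩
    · push Not at hex
      exact ⟨0, fun i _ => hex i⟩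
  obtain ⟨p, hp, q, hq, hpq⟩ := (h.nontrivial_image_iterate hord hnt N₀).exists_lt
  have hord' := ordConnected_image (h.cont_iterate N₀) hord
  have hsub' : ∀ z ∈ Icc p q, z ∈ F^[N₀] '' J := fun z hz => hord'.out hp hq hz
  have hI : ∀ z ∈ Icc p q, z ∈ Icc a b := by
    intro z hz
    obtain ⟨w, hw, rfl⟩ := hsub' z hz
    exact h.iterate_mem (hJ hw) N₀
  have hfreeI : ∀ i, ∀ z ∈ Icc p q, F^[i] z ≠ c := by
    intro i z hz he
    obtain ⟨w, hw, rfl⟩ := hsub' z hz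
    rw [← Function.iterate_add_apply] at he
    exact hN₀ (i + N₀) (by omega) ⟨w, hw, he⟩
  obtain ⟨x, hx⟩ := exists_between hpq
  have hxI : x ∈ Icc p q := ⟨hx.1.le, hx.2.le⟩
  have hxnp : NoInjectiveReturn F x := by
    obtain ⟨w, hw, rfl⟩ := hsub' x hxI
    exact NoInjectiveReturn.iterate (hnp w hw) N₀
  set E : ℕ → Set ℝ := fun n => freeInterval F a c b (F^[n] x) with hE
  have hEdisj : ∀ m n, m ≠ n → Disjoint (E m) (E n) := fun m n hmn =>
    h.disjoint_freeInterval (hI x hxI) (fun i => hfreeI i x hxI) hxnp hmn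
  have hEord : ∀ n, (E n).OrdConnected := fun n => ordConnected_freeInterval _ _ _ _ _
  have hmemE : ∀ n, ∀ z ∈ Icc p q, F^[n] z ∈ E n := by
    intro n z hz
    refine h.mapsTo_freeInterval x n ⟨hI z hz, fun w hw i => hfreeI i w ?_⟩
    exact ordConnected_Icc.uIcc_subset hz hxI hw
  have hbelow : ∀ n, BddBelow (E n) := fun n => ⟨a, fun z hz => hz.1.1⟩
  have habove : ∀ n, BddAbove (E n) := fun n => ⟨b, fun z hz => hz.1.2⟩
  set A : ℕ → ℝ := fun n => sInf (E n) with hA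
  set B : ℕ → ℝ := fun n => sSup (E n) with hB
  have hEne : ∀ n, (E n).Nonempty := fun n => ⟨_, hmemE n x hxI⟩
  have hEsub : ∀ n, E n ⊆ Icc (A n) (B n) := fun n z hz =>
    ⟨csInf_le (hbelow n) hz, le_csSup (habove n) hz⟩
  have hsubE : ∀ n, Ioo (A n) (B n) ⊆ E n := by
    intro n z hz
    obtain ⟨z₁, hz₁, h1⟩ := exists_lt_of_csInf_lt (hEne n) hz.1
    obtain ⟨z₂, hz₂, h2⟩ := exists_lt_of_lt_csSup (hEne n) hz.2
    exact (hEord n).out hz₁ hz₂ ⟨h1.le, h2.le⟩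
  have hxmem : ∀ n, F^[n] x ∈ Ioo (A n) (B n) := by
    intro n
    have hinj : InjOn F^[n] (Icc p q) :=
      h.injOn_iterate ordConnected_Icc fun i _ z hz => hfreeI i z hz
    have hpm : p ∈ Icc p q := left_mem_Icc.2 hpq.le
    have hqm : q ∈ Icc p q := right_mem_Icc.2 hpq.le
    have h1 := hEsub n (hmemE n p hpm)
    have h2 := hEsub n (hmemE n q hqm)
    have h3 := mem_uIcc_of_injOn (h.cont_iterate n) (x := p) (y := q)
      (by rwa [uIcc_of_le hpq.le]) (Icc_subset_uIcc hxI)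
    have n1 : F^[n] x ≠ F^[n] p := fun he => hx.1.ne' (hinj hxI hpm he)
    have n2 : F^[n] x ≠ F^[n] q := fun he => hx.2.ne (hinj hxI hqm he)
    rcases mem_uIcc.1 h3 with h3 | h3
    · exact ⟨h1.1.trans_lt (lt_of_le_of_ne h3.1 n1.symm), (lt_of_le_of_ne h3.2 n2).trans_le h2.2⟩
    · exact ⟨h2.1.trans_lt (lt_of_le_of_ne h3.1 n2.symm), (lt_of_le_of_ne h3.2 n1).trans_le h1.2⟩
  have hAB : ∀ n, A n < B n := fun n => (hxmem n).1.trans (hxmem n).2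
  have hsep : ∀ m n, m ≠ n → B m ≤ A n ∨ B n ≤ A m := fun m n hmn =>
    le_or_le_of_disjoint_Ioo (hAB m) (hAB n) ((hEdisj m n hmn).mono (hsubE m) (hsubE n))
  have hAinj : Function.Injective A := by
    intro m n he
    by_contra hne
    rcases hsep m n hne with h1 | h1 <;> linarith [hAB m, hAB n]
  have hBinj : Function.Injective B := by
    intro m n he
    by_contra hne
    rcases hsep m n hne with h1 | h1 <;> linarith [hAB m, hAB n]
  have havoid : ∀ G : ℕ → ℝ, Function.Injective G → ∀ w, ∀ᶠ n in atTop, G n ≠ w := by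
    intro G hG w
    have := hG.tendsto_cofinite.eventually (eventually_cofinite_ne w)
    rwa [Nat.cofinite_eq_atTop] at this
  -- The intervals `E n` do not overlap, so their left ends are distinct, and so are their right
  -- ends. From some time on none of them is `c` and the intervals stay off the ends of `[a, b]`,
  -- which makes even the closed intervals free of preimages of `c`.
  obtain ⟨N, hN⟩ := ((havoid A hAinj c).and ((havoid B hBinj c).and
    ((havoid A hAinj a).and (havoid B hBinj b)))).exists_forall_of_atTop
  have haA : ∀ n, a ≤ A n := fun n => le_csInf (hEne n) fun z hz => hz.1.1
  have hBb : ∀ n, B n ≤ b := fun n => csSup_le (hEne n) fun z hz => hz.1.2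
  have hcl : ∀ k, ∀ z ∈ Icc (A N) (B N), F^[k] z ∈ Icc (A (N + k)) (B (N + k)) := by
    intro k z hz
    rw [← closure_Ioo (hAB N).ne] at hz
    have h1 : MapsTo F^[k] (Ioo (A N) (B N)) (Icc (A (N + k)) (B (N + k))) := by
      intro w hw
      have := h.mapsTo_freeInterval _ k (hsubE N hw)
      rw [← Function.iterate_add_apply, add_comm k] at this
      exact hEsub _ this
    have h2 := h1.closure (h.cont_iterate k)
    rw [isClosed_Icc.closure_eq] at h2
    exact h2 hz
  have hfree : ∀ i, ∀ z ∈ Icc (A N) (B N), F^[i] z ≠ c := by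
    intro i z hz he
    have h1 := hcl i z hz
    rw [he] at h1
    obtain ⟨n1, n2, -, -⟩ := hN (N + i) (by omega)
    have h2 := hsubE (N + i) ⟨lt_of_le_of_ne h1.1 n1, lt_of_le_of_ne h1.2 n2.symm⟩
    exact h2.2 c left_mem_uIcc 0 rfl
  obtain ⟨-, -, n3, n4⟩ := hN N le_rfl
  have haA' : a < A N := lt_of_le_of_ne (haA N) n3.symm
  have hBb' : B N < b := lt_of_le_of_ne (hBb N) n4
  refine ⟨A N, B N, F^[N] x, ⟨h, haA', (hxmem N).1, (hxmem N).2, hBb', hfree, ?_, ?_, ?_,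
    NoInjectiveReturn.iterate hxnp N⟩⟩
  · intro i j hij
    have hinj : ∀ k, InjOn F^[k] (Icc (A N) (B N)) := fun k =>
      h.injOn_iterate ordConnected_Icc fun i _ z hz => hfree i z hz
    have hlm : A N ∈ Icc (A N) (B N) := left_mem_Icc.2 (hAB N).le
    have hrm : B N ∈ Icc (A N) (B N) := right_mem_Icc.2 (hAB N).le
    have hends : ∀ k, loEnd F (A N) (B N) k < hiEnd F (A N) (B N) k ∧
        A (N + k) ≤ loEnd F (A N) (B N) k ∧ hiEnd F (A N) (B N) k ≤ B (N + k) := by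
      intro k
      have h1 := hcl k _ hlm
      have h2 := hcl k _ hrm
      refine ⟨?_, le_min h1.1 h2.1, max_le h1.2 h2.2⟩
      exact min_lt_max.2 fun he => (hAB N).ne (hinj k hlm hrm he)
    have hi := hends i
    have hj := hends j
    rcases hsep (N + i) (N + j) (by omega) with h1 | h1
    · left; linarith
    · right; linarith
  · intro ε hε
    by_contra! hcon
    -- Without preimages of `c` just to the left of `A N`, the free interval would contain `z`,
    -- which is below its infimum.
    set z := max a (A N - ε / 2) with hz
    have hzA : z < A N := max_lt haA' (by linarith)
    have hzE : z ∈ E N := by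
      obtain ⟨hxN1, hxN2⟩ := hxmem N
      have haN := haA N
      have hbN := hBb N
      refine ⟨⟨le_max_left _ _, by linarith⟩, fun w hw i => ?_⟩
      rw [uIcc_of_le (by linarith)] at hw
      rcases lt_or_ge w (A N) with hwA | hwA
      · exact hcon w ⟨by linarith [hw.1, le_max_right a (A N - ε / 2)], hwA⟩ i
      · exact hfree i w ⟨hwA, hw.2.trans hxN2.le⟩
    linarith [(hEsub N hzE).1]
  · intro ε hε
    by_contra! hcon
    set z := min b (B N + ε / 2) with hz
    have hzB : B N < z := lt_min hBb' (by linarith)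
    have hzE : z ∈ E N := by
      obtain ⟨hxN1, hxN2⟩ := hxmem N
      have haN := haA N
      have hbN := hBb N
      refine ⟨⟨by linarith, min_le_left _ _⟩, fun w hw i => ?_⟩
      rw [uIcc_of_ge (by linarith)] at hw
      rcases lt_or_ge (B N) w with hwB | hwB
      · exact hcon w ⟨hwB, by linarith [hw.2, min_le_right b (B N + ε / 2)]⟩ i
      · exact hfree i w ⟨hxN1.le.trans hw.1, hwB⟩
    linarith [(hEsub N hzE).2]

end UnimodalSystem

/-! ### Injective returns and periodic attraction -/

theorem monotoneOn_or_antitoneOn_of_injOn {g : ℝ → ℝ} (hg : Continuous g) {L : Set ℝ}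
    (hL : L.OrdConnected) (hi : InjOn g L) : MonotoneOn g L ∨ AntitoneOn g L := by
  by_contra! hcon
  obtain ⟨h1, h2⟩ := hcon
  simp only [MonotoneOn, AntitoneOn, not_forall] at h1 h2
  obtain ⟨x, hx, y, hy, hxy, h1⟩ := h1
  obtain ⟨x', hx', y', hy', hxy', h2⟩ := h2
  have hmin : min x x' ∈ L := by rcases min_choice x x' with e | e <;> rw [e] <;> assumption
  have hmax : max y y' ∈ L := by rcases max_choice y y' with e | e <;> rw [e] <;> assumption
  have hle : min x x' ≤ max y y' := (min_le_left _ _).trans (hxy.trans (le_max_left _ _))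
  have mx : x ∈ Icc (min x x') (max y y') := ⟨min_le_left _ _, hxy.trans (le_max_left _ _)⟩
  have my : y ∈ Icc (min x x') (max y y') := ⟨(min_le_left _ _).trans hxy, le_max_left _ _⟩
  have mx' : x' ∈ Icc (min x x') (max y y') := ⟨min_le_right _ _, hxy'.trans (le_max_right _ _)⟩
  have my' : y' ∈ Icc (min x x') (max y y') := ⟨(min_le_right _ _).trans hxy', le_max_right _ _⟩
  rcases hg.continuousOn.strictMonoOn_of_injOn_Icc' hle (hi.mono (hL.out hmin hmax)) with h | h
  · exact h1 (h.monotoneOn mx my hxy)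
  · exact h2 (h.antitoneOn mx' my' hxy')

/-- If an orbit enters an interval on which some iterate is injective and which it maps into itself,
the orbit is attracted by a periodic orbit. -/
theorem exists_periodic_of_return {F : ℝ → ℝ} (hF : Continuous F) {x u v : ℝ}
    (hx : ∀ n, F^[n] x ∈ Icc u v) {n p : ℕ} {L : Set ℝ} (hL : L.OrdConnected)
    (hn : F^[n] x ∈ L) (hm : MapsTo F^[p] L L) (hi : InjOn F^[p] L) :
    ∃ y ∈ Icc u v, F^[2 * p] y = y ∧
      Tendsto (fun j => F^[2 * p * j + n] x) atTop (𝓝 y) := by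
  -- `F^[p]` may reverse order on `L`; its square is increasing, so the orbit observed at multiples
  -- of `2 * p` is monotone and bounded.
  have hmono : MonotoneOn F^[2 * p] L := by
    rw [show 2 * p = p + p by ring, Function.iterate_add]
    rcases monotoneOn_or_antitoneOn_of_injOn (hF.iterate p) hL hi with h | h
    · exact h.comp h hm
    · exact h.comp h hm
  have hm2 : MapsTo F^[2 * p] L L := by
    rw [show 2 * p = p + p by ring, Function.iterate_add]
    exact hm.comp hm
  set y : ℕ → ℝ := fun j => F^[2 * p * j + n] x with hy
  have hysucc : ∀ j, y (j + 1) = F^[2 * p] (y j) := fun j => by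
    simp only [hy]
    rw [← Function.iterate_add_apply, show 2 * p * (j + 1) + n = 2 * p + (2 * p * j + n) by ring]
  have hyL : ∀ j, y j ∈ L := by
    intro j
    induction j with
    | zero => simpa [hy] using hn
    | succ j ih => rw [hysucc]; exact hm2 ih
  obtain ⟨z, hz⟩ : ∃ z, Tendsto y atTop (𝓝 z) := by
    rcases le_total (y 0) (y 1) with h01 | h01
    · have hmon : Monotone y := monotone_nat_of_le_succ fun j => by
        induction j with
        | zero => exact h01
        | succ j ih =>
          rw [hysucc j, hysucc (j + 1)]
          exact hmono (hyL _) (hyL _) ih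
      exact ⟨_, tendsto_atTop_ciSup hmon ⟨v, by rintro _ ⟨j, rfl⟩; exact (hx _).2⟩⟩
    · have hanti : Antitone y := antitone_nat_of_succ_le fun j => by
        induction j with
        | zero => exact h01
        | succ j ih =>
          rw [hysucc j, hysucc (j + 1)]
          exact hmono (hyL _) (hyL _) ih
      exact ⟨_, tendsto_atTop_ciInf hanti ⟨u, by rintro _ ⟨j, rfl⟩; exact (hx _).1⟩⟩
  refine ⟨z, isClosed_Icc.mem_of_tendsto hz (Eventually.of_forall fun j => hx _), ?_, hz⟩
  have h1 : Tendsto (fun j => F^[2 * p] (y j)) atTop (𝓝 (F^[2 * p] z)) :=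
    ((hF.iterate (2 * p)).tendsto z).comp hz
  have h2 : Tendsto (fun j => y (j + 1)) atTop (𝓝 z) := (tendsto_add_atTop_iff_nat 1).2 hz
  simp only [hysucc] at h2
  exact tendsto_nhds_unique h1 h2

/-- A point whose orbit is attracted by a periodic orbit has that orbit as its ω-limit set. -/
theorem omegaSet_eq_of_tendsto {F : ℝ → ℝ} (hF : Continuous F) {x y : ℝ} {n r : ℕ} (hr : 0 < r)
    (hy : F^[r] y = y) (ht : Tendsto (fun j => F^[r * j + n] x) atTop (𝓝 y)) :
    omegaSet F x = range fun i : ℕ => F^[i] y := by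
  have hti : ∀ i, Tendsto (fun j => F^[r * j + n + i] x) atTop (𝓝 (F^[i] y)) := by
    intro i
    have := ((hF.iterate i).tendsto y).comp ht
    refine this.congr fun j => ?_
    simp only [Function.comp_apply]
    rw [← Function.iterate_add_apply, add_comm i]
  have hrange : range (fun i : ℕ => F^[i] y) = (fun i : ℕ => F^[i] y) '' (Finset.range r) := by
    apply Subset.antisymm
    · rintro _ ⟨i, rfl⟩
      refine ⟨i % r, by simpa using Nat.mod_lt i hr, ?_⟩
      exact (show Function.IsPeriodicPt F r y from hy).iterate_mod_apply i
    · exact image_subset_range _ _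
  ext z
  rw [omegaSet, mem_omegaLimit_singleton_iff_mapClusterPt]
  constructor
  · intro hz
    by_contra hcon
    have hclosed : IsClosed (range fun i : ℕ => F^[i] y) := by
      rw [hrange]
      exact ((Finset.finite_toSet _).image _).isClosed
    obtain ⟨U, hU, V, hV, hUV⟩ : ∃ U, U ∈ 𝓝ˢ (range fun i : ℕ => F^[i] y) ∧ ∃ V ∈ 𝓝 z, Disjoint U V := by
      have := (RegularSpace.regular hclosed hcon)
      rw [Filter.disjoint_iff] at this
      obtain ⟨U, hU, V, hV, hd⟩ := this
      exact ⟨U, hU, V, hV, hd⟩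
    -- Each of the finitely many residue classes of times converges to a point of the cycle, so the
    -- whole orbit is eventually in `U`.
    have h1 : ∀ᶠ j in atTop, ∀ i ∈ Finset.range r, F^[r * j + n + i] x ∈ U := by
      rw [Filter.eventually_all_finset]
      intro i _
      exact (hti i).eventually (mem_nhdsSet_iff_forall.1 hU _ ⟨i, rfl⟩)
    obtain ⟨J, hJ⟩ := h1.exists_forall_of_atTop
    have h2 := hz.frequently hV
    rw [frequently_atTop] at h2
    obtain ⟨m, hm, hmV⟩ := h2 (r * J + n)
    have h3 := hJ ((m - n) / r) (by
      rw [Nat.le_div_iff_mul_le hr]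
      have : J * r = r * J := mul_comm _ _
      omega) ((m - n) % r) (by simpa using Nat.mod_lt _ hr)
    rw [show r * ((m - n) / r) + n + (m - n) % r = m by
      have := Nat.div_add_mod (m - n) r
      omega] at h3
    exact Set.disjoint_left.1 hUV h3 hmV
  · rintro ⟨i, rfl⟩
    refine MapClusterPt.of_comp (φ := fun j => r * j + n + i) (p := atTop) ?_ (hti i).mapClusterPt
    refine tendsto_atTop_mono (fun j => ?_) tendsto_id
    have : 1 * j ≤ r * j := Nat.mul_le_mul_right j hr
    simp only [id]
    omega

/-- No interval in `[0,1]` that meets the orbit of `x` is mapped injectively into itself by an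
iterate of `f`. -/
def NoInjectiveReturnUnit (f : ℝ → ℝ) (x : ℝ) : Prop :=
  ∀ n p (L : Set ℝ), 1 ≤ p → L ⊆ Icc 0 1 → L.OrdConnected → f^[n] x ∈ L → MapsTo f^[p] L L →
    InjOn f^[p] L → False

theorem iterate_eqOn_of_eqOn {f F : ℝ → ℝ} {S : Set ℝ} (hf : MapsTo f S S) (h : EqOn F f S) (n : ℕ) :
    EqOn F^[n] f^[n] S := by
  induction n with
  | zero => exact fun _ _ => rfl
  | succ n ih =>
    intro x hx
    rw [Function.iterate_succ_apply, Function.iterate_succ_apply, h hx, ih (hf hx)]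

theorem omegaSet_congr {f F : ℝ → ℝ} {x : ℝ} (h : ∀ n, F^[n] x = f^[n] x) :
    omegaSet F x = omegaSet f x := by
  ext y
  rw [omegaSet, omegaSet, mem_omegaLimit_singleton_iff_mapClusterPt,
    mem_omegaLimit_singleton_iff_mapClusterPt]
  simp only [h]

theorem noInjectiveReturnUnit_of_not_isPeriodicOrbit {f : ℝ → ℝ} (hf : MapsTo f (Icc 0 1) (Icc 0 1))
    (hc : ContinuousOn f (Icc 0 1)) {x : ℝ} (hx : x ∈ Icc (0 : ℝ) 1)
    (hp : ¬ IsPeriodicOrbit f (omegaSet f x)) : NoInjectiveReturnUnit f x := by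
  intro n p L hp1 hLs hL hn hm hi
  set F : ℝ → ℝ := IccExtend zero_le_one ((Icc (0 : ℝ) 1).domRestrict f) with hFdef
  have hF : Continuous F := (continuousOn_iff_continuous_domRestrict.1 hc).Icc_extend'
  have heq : EqOn F f (Icc 0 1) := fun y hy => by
    rw [hFdef, IccExtend_of_mem _ _ hy, domRestrict_apply]
  have hit := iterate_eqOn_of_eqOn hf heq
  have hmem : ∀ n, F^[n] x ∈ Icc (0 : ℝ) 1 := fun n => hit n hx ▸ hf.iterate n hx
  obtain ⟨y, hy, hper, ht⟩ := exists_periodic_of_return hF hmem (n := n) (p := p) hL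
    (by rwa [hit n hx]) (fun z hz => by rw [hit p (hLs hz)]; exact hm hz)
    (fun z hz w hw e => hi hz hw (by rwa [hit p (hLs hz), hit p (hLs hw)] at e))
  refine hp ⟨y, ⟨2 * p, by omega, ?_⟩, ?_⟩
  · rw [Function.IsPeriodicPt, Function.IsFixedPt, ← hit _ hy, hper]
  · rw [← omegaSet_congr fun n => hit n hx, omegaSet_eq_of_tendsto hF (by omega) hper ht]
    simp only [hit _ hy]

theorem NoInjectiveReturnUnit.extend {f F : ℝ → ℝ} (hf : MapsTo f (Icc 0 1) (Icc 0 1))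
    (heq : EqOn F f (Icc 0 1)) {x : ℝ} (hx : x ∈ Icc (0 : ℝ) 1) (h : NoInjectiveReturnUnit f x) :
    NoInjectiveReturn F x := by
  intro n p L hp hL hn hm hi
  have hit := iterate_eqOn_of_eqOn hf heq
  refine h n p (L ∩ Icc 0 1) hp inter_subset_right (hL.inter ordConnected_Icc)
    ⟨hit n hx ▸ hn, hf.iterate n hx⟩ (fun z hz => ⟨hit p hz.2 ▸ hm hz.1, hf.iterate p hz.2⟩) ?_
  intro z hz w hw e
  exact hi hz.1 hw.1 (by rwa [hit p hz.2, hit p hw.2])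

/-- For an injective `f` the whole of `[0, 1]` is an injective return with `p = 1`; this disposes of
monotone maps. -/
theorem NoInjectiveReturnUnit.not_injOn {f : ℝ → ℝ} (hf : MapsTo f (Icc 0 1) (Icc 0 1)) {x : ℝ}
    (hx : x ∈ Icc (0 : ℝ) 1) (h : NoInjectiveReturnUnit f x) : ¬ InjOn f (Icc 0 1) := fun hi =>
  h 0 1 (Icc 0 1) le_rfl Subset.rfl ordConnected_Icc hx hf hi

theorem iterate_reflect (f : ℝ → ℝ) (n : ℕ) (x : ℝ) :
    (fun x => 1 - f (1 - x))^[n] x = 1 - f^[n] (1 - x) := by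
  induction n generalizing x with
  | zero => simp
  | succ n ih => rw [Function.iterate_succ_apply, ih, Function.iterate_succ_apply]; simp

theorem NoInjectiveReturnUnit.reflect {f : ℝ → ℝ} {x : ℝ} (h : NoInjectiveReturnUnit f x) :
    NoInjectiveReturnUnit (fun x => 1 - f (1 - x)) (1 - x) := by
  intro n p L hp hLs hL hn hm hi
  refine h n p ((fun y => 1 - y) ⁻¹' L) hp (fun y hy => ?_) ⟨fun y hy z hz w hw => ?_⟩ ?_ ?_ ?_
  · have := hLs hy
    exact ⟨by linarith [this.2], by linarith [this.1]⟩
  · exact hL.out hz hy ⟨by linarith [hw.2], by linarith [hw.1]⟩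
  · simpa [iterate_reflect] using hn
  · intro y hy
    simpa [iterate_reflect] using hm hy
  · intro y hy z hz e
    have := hi hy hz (by simpa [iterate_reflect] using e)
    linarith

/-! ### One-sided critical orders and the extension beyond the unit interval -/

/-- On one side of the critical point: `f` is a `C²` local diffeomorphism on `(c, e]` and has
critical order `ℓ` at `c` from the right. -/
structure HalfOrder (f : ℝ → ℝ) (c e ℓ : ℝ) : Prop where
  lt : c < e
  one_le : 1 ≤ ℓ
  contDiffOn : ContDiffOn ℝ 2 f (Ioc c e)
  deriv_ne : ∀ x ∈ Ioc c e, derivWithin f (Ioc c e) x ≠ 0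
  crit : ∃ φ ψ : ℝ → ℝ, ContDiff ℝ 2 φ ∧ ContDiff ℝ 2 ψ ∧ (∀ x, deriv φ x ≠ 0) ∧
    (∀ x, deriv ψ x ≠ 0) ∧ φ c = 0 ∧ ψ (f c) = 0 ∧ ∀ᶠ x in 𝓝[≥] c, |ψ (f x)| = |φ x| ^ ℓ

theorem deriv_pos_or_neg {φ : ℝ → ℝ} (h : ContDiff ℝ 2 φ) (h0 : ∀ x, deriv φ x ≠ 0) :
    (∀ x, 0 < deriv φ x) ∨ ∀ x, deriv φ x < 0 := by
  have hc : Continuous (deriv φ) := h.continuous_deriv (by norm_num)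
  by_contra! hcon
  obtain ⟨⟨x, hx⟩, y, hy⟩ := hcon
  obtain ⟨z, hz⟩ := mem_range_of_exists_le_of_exists_ge hc ⟨x, hx⟩ ⟨y, hy⟩
  exact h0 z hz

namespace HalfOrder

variable {f : ℝ → ℝ} {c e ℓ : ℝ}

/-- Only absolute values enter the condition, and a continuous derivative without zeros has constant
sign, so `φ` and `ψ` may be negated where necessary. -/
theorem crit_signed (h : HalfOrder f c e ℓ) : ∃ φ ψ : ℝ → ℝ, ContDiff ℝ 2 φ ∧ ContDiff ℝ 2 ψ ∧
    (∀ x, 0 < deriv φ x) ∧ (∀ x, deriv ψ x < 0) ∧ φ c = 0 ∧ ψ (f c) = 0 ∧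
      ∀ᶠ x in 𝓝[≥] c, |ψ (f x)| = |φ x| ^ ℓ := by
  obtain ⟨φ, ψ, h1, h2, h3, h4, h5, h6, h7⟩ := h.crit
  have hφ : ∃ φ' : ℝ → ℝ, ContDiff ℝ 2 φ' ∧ (∀ x, 0 < deriv φ' x) ∧ φ' c = 0 ∧
      ∀ x, |φ' x| = |φ x| := by
    rcases deriv_pos_or_neg h1 h3 with hs | hs
    · exact ⟨φ, h1, hs, h5, fun _ => rfl⟩
    · exact ⟨fun x => -φ x, h1.neg, fun x => by rw [deriv.fun_neg]; linarith [hs x], by simp [h5],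
        fun x => abs_neg _⟩
  have hψ : ∃ ψ' : ℝ → ℝ, ContDiff ℝ 2 ψ' ∧ (∀ x, deriv ψ' x < 0) ∧ ψ' (f c) = 0 ∧
      ∀ x, |ψ' x| = |ψ x| := by
    rcases deriv_pos_or_neg h2 h4 with hs | hs
    · exact ⟨fun x => -ψ x, h2.neg, fun x => by rw [deriv.fun_neg]; linarith [hs x], by simp [h6],
        fun x => abs_neg _⟩
    · exact ⟨ψ, h2, hs, h6, fun _ => rfl⟩
  obtain ⟨φ', a1, a2, a3, a4⟩ := hφ
  obtain ⟨ψ', b1, b2, b3, b4⟩ := hψ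
  exact ⟨φ', ψ', a1, b1, a2, b2, a3, b3, by simpa only [a4, b4] using h7⟩

/-- Smoothness says nothing at `c`. There `|ψ (f x)| = |φ x| ^ ℓ` tends to 0, and strict
monotonicity of `ψ` forces `f x` to tend to `f c`. -/
theorem continuousOn (h : HalfOrder f c e ℓ) : ContinuousOn f (Icc c e) := by
  intro x hx
  rcases hx.1.eq_or_lt with rfl | hcx
  · obtain ⟨φ, ψ, h1, h2, h3, h4, h5, h6, h7⟩ := h.crit_signed
    have hanti : StrictAnti ψ := strictAnti_of_deriv_neg h4
    have hlim : Tendsto (fun x => |φ x| ^ ℓ) (𝓝[≥] c) (𝓝 0) := by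
      have hc : Continuous fun x => |φ x| ^ ℓ :=
        h1.continuous.abs.rpow_const fun x => Or.inr (by linarith [h.one_le])
      have := hc.tendsto c
      rw [h5, abs_zero, Real.zero_rpow (by linarith [h.one_le])] at this
      exact this.mono_left nhdsWithin_le_nhds
    have hψ : Tendsto (fun x => ψ (f x)) (𝓝[≥] c) (𝓝 0) :=
      tendsto_zero_iff_abs_tendsto_zero _ |>.2 (hlim.congr' (h7.mono fun x hx => hx.symm))
    have hf : Tendsto f (𝓝[≥] c) (𝓝 (f c)) := by
      refine tendsto_order.2 ⟨fun y hy => ?_, fun y hy => ?_⟩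
      · have : 0 < ψ y := h6 ▸ hanti hy
        exact (hψ.eventually_lt_const this).mono fun x hx => hanti.lt_iff_gt.1 hx
      · have : ψ y < 0 := h6 ▸ hanti hy
        exact (hψ.eventually_const_lt this).mono fun x hx => hanti.lt_iff_gt.1 hx
    exact hf.mono_left (nhdsWithin_mono _ Icc_subset_Ici_self)
  · refine (h.contDiffOn.continuousOn x ⟨hcx, hx.2⟩).mono_of_mem_nhdsWithin ?_
    exact mem_nhdsWithin.2 ⟨Ioi c, isOpen_Ioi, hcx, fun y hy => ⟨hy.1, hy.2.2⟩⟩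

theorem hasDerivWithinAt (h : HalfOrder f c e ℓ) {x : ℝ} (hx : x ∈ Ioc c e) :
    HasDerivWithinAt f (derivWithin f (Ioc c e) x) (Ioc c e) x :=
  (h.contDiffOn.differentiableOn (by norm_num) x hx).hasDerivWithinAt

theorem hasDerivAt (h : HalfOrder f c e ℓ) {x : ℝ} (hx : x ∈ Ioo c e) :
    HasDerivAt f (derivWithin f (Ioc c e) x) x :=
  (h.hasDerivWithinAt (Ioo_subset_Ioc_self hx)).hasDerivAt (Ioc_mem_nhds hx.1 hx.2)

theorem contDiffOn_deriv (h : HalfOrder f c e ℓ) :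
    ContDiffOn ℝ 1 (derivWithin f (Ioc c e)) (Ioc c e) :=
  h.contDiffOn.derivWithin (uniqueDiffOn_Ioc c e) (by norm_num)

theorem deriv_sign (h : HalfOrder f c e ℓ) : (∀ x ∈ Ioc c e, derivWithin f (Ioc c e) x < 0) ∨
    ∀ x ∈ Ioc c e, 0 < derivWithin f (Ioc c e) x := by
  by_contra! hcon
  obtain ⟨⟨x, hx, hx0⟩, y, hy, hy0⟩ := hcon
  obtain ⟨z, hz, hz0⟩ := isPreconnected_Ioc.intermediate_value hy hx h.contDiffOn_deriv.continuousOn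
    ⟨hy0, hx0⟩
  exact h.deriv_ne z hz hz0

theorem strictAntiOn_or_strictMonoOn (h : HalfOrder f c e ℓ) :
    (StrictAntiOn f (Icc c e) ∧ ∀ x ∈ Ioc c e, derivWithin f (Ioc c e) x < 0) ∨
      StrictMonoOn f (Icc c e) := by
  refine h.deriv_sign.imp (fun hs => ⟨?_, hs⟩) fun hs => ?_
  · refine strictAntiOn_of_deriv_neg (convex_Icc c e) h.continuousOn fun x hx => ?_
    rw [interior_Icc] at hx
    rw [(h.hasDerivAt hx).deriv]
    exact hs x (Ioo_subset_Ioc_self hx)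
  · refine strictMonoOn_of_deriv_pos (convex_Icc c e) h.continuousOn fun x hx => ?_
    rw [interior_Icc] at hx
    rw [(h.hasDerivAt hx).deriv]
    exact hs x (Ioo_subset_Ioc_self hx)

end HalfOrder

/-- The continuation of `f` beyond `e` by a concave quadratic polynomial with matching derivative
at `e`. -/
noncomputable def rightExt (f : ℝ → ℝ) (c e x : ℝ) : ℝ :=
  if x ≤ e then f x else f e + derivWithin f (Ioc c e) e * (x - e) - (x - e) ^ 2

/-- The derivative of `rightExt f c e` on `(c, ∞)`. -/
noncomputable def rightExtDeriv (f : ℝ → ℝ) (c e x : ℝ) : ℝ :=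
  if x ≤ e then derivWithin f (Ioc c e) x else derivWithin f (Ioc c e) e - 2 * (x - e)

namespace HalfOrder

variable {f : ℝ → ℝ} {c e ℓ : ℝ}

/-- Serves the conjugation by `x ↦ 1 - x`, which exchanges the two sides of the turning point. -/
theorem congr_shift (h : HalfOrder f c e ℓ) {g : ℝ → ℝ} {t : ℝ} (hg : ∀ x, g x = 1 - f (x - t)) :
    HalfOrder g (c + t) (e + t) ℓ := by
  obtain rfl : g = fun x => 1 - f (x - t) := funext hg
  have hmaps : MapsTo (fun x => x - t) (Ioc (c + t) (e + t)) (Ioc c e) := fun x hx =>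
    ⟨by linarith [hx.1], by linarith [hx.2]⟩
  refine ⟨by linarith [h.lt], h.one_le, ?_, fun x hx => ?_, ?_⟩
  · exact contDiffOn_const.sub (h.contDiffOn.comp (contDiff_id.sub contDiff_const).contDiffOn hmaps)
  · have h1 := ((h.hasDerivWithinAt (hmaps hx)).comp x
      ((hasDerivWithinAt_id x _).sub_const t) hmaps).const_sub 1
    have h2 := h1.derivWithin (uniqueDiffOn_Ioc _ _ x hx)
    simp only [Function.comp_apply, id] at h2
    rw [h2]
    simpa using h.deriv_ne _ (hmaps hx)
  · obtain ⟨φ, ψ, h1, h2, h3, h4, h5, h6, h7⟩ := h.crit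
    refine ⟨fun x => φ (x - t), fun y => ψ (1 - y), h1.comp (contDiff_id.sub contDiff_const),
      h2.comp (contDiff_const.sub contDiff_id), fun x => ?_, fun x => ?_, by simpa using h5,
      by simpa using h6, ?_⟩
    · rw [deriv_comp_sub_const]
      exact h3 _
    · rw [deriv_comp_const_sub]
      exact neg_ne_zero.2 (h4 _)
    · have ht : Tendsto (fun x => x - t) (𝓝[≥] (c + t)) (𝓝[≥] c) := by
        refine tendsto_nhdsWithin_iff.2 ⟨?_, ?_⟩
        · have : Tendsto (fun x => x - t) (𝓝 (c + t)) (𝓝 (c + t - t)) :=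
            (continuous_id.sub continuous_const).tendsto _
          rw [add_sub_cancel_right] at this
          exact this.mono_left nhdsWithin_le_nhds
        · filter_upwards [self_mem_nhdsWithin] with x hx
          have : c + t ≤ x := hx
          exact mem_Ici.2 (by linarith)
      simpa using ht.eventually h7

theorem rightExt_eqOn (f : ℝ → ℝ) (c e : ℝ) : EqOn (rightExt f c e) f (Iic e) := fun _ hx => if_pos hx

theorem rightExt_of_le (f : ℝ → ℝ) (c : ℝ) {e x : ℝ} (hx : e ≤ x) :
    rightExt f c e x = f e + derivWithin f (Ioc c e) e * (x - e) - (x - e) ^ 2 := by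
  rcases hx.eq_or_lt with rfl | hx
  · simp [rightExt]
  · exact if_neg hx.not_ge

theorem rightExtDeriv_of_le (f : ℝ → ℝ) (c : ℝ) {e x : ℝ} (hx : e ≤ x) :
    rightExtDeriv f c e x = derivWithin f (Ioc c e) e - 2 * (x - e) := by
  rcases hx.eq_or_lt with rfl | hx
  · simp [rightExtDeriv]
  · exact if_neg hx.not_ge

theorem hasDerivAt_quadratic (A d e x : ℝ) :
    HasDerivAt (fun x => A + d * (x - e) - (x - e) ^ 2) (d - 2 * (x - e)) x := by
  have h1 : HasDerivAt (fun x => x - e) 1 x := (hasDerivAt_id x).sub_const e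
  refine (((h1.const_mul d).const_add A).sub (h1.pow 2)).congr_deriv ?_
  simp

theorem hasDerivAt_rightExt (h : HalfOrder f c e ℓ) {x : ℝ} (hx : c < x) :
    HasDerivAt (rightExt f c e) (rightExtDeriv f c e x) x := by
  have hq : ∀ x, e ≤ x → HasDerivWithinAt (rightExt f c e) (rightExtDeriv f c e x) (Ici e) x := by
    intro x hx
    rw [rightExtDeriv_of_le f c hx]
    exact (hasDerivAt_quadratic (f e) _ e x).hasDerivWithinAt.congr
      (fun y hy => rightExt_of_le f c hy) (rightExt_of_le f c hx)
  rcases lt_trichotomy x e with hxe | rfl | hxe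
  · rw [rightExtDeriv, if_pos hxe.le]
    refine (h.hasDerivAt ⟨hx, hxe⟩).congr_of_eventuallyEq ?_
    filter_upwards [Iic_mem_nhds hxe] with y hy using rightExt_eqOn f c e hy
  · have h1 : HasDerivWithinAt (rightExt f c x) (rightExtDeriv f c x x) (Ioc c x) x := by
      rw [rightExtDeriv, if_pos le_rfl]
      exact (h.hasDerivWithinAt ⟨hx, le_rfl⟩).congr (fun y hy => rightExt_eqOn f c x hy.2)
        (rightExt_eqOn f c x self_mem_Iic)
    refine (h1.union (hq x le_rfl)).hasDerivAt ?_
    rw [Ioc_union_Ici_eq_Ioi hx]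
    exact Ioi_mem_nhds hx
  · exact (hq x hxe.le).hasDerivAt (Ici_mem_nhds hxe)

theorem continuousOn_rightExt (h : HalfOrder f c e ℓ) : ContinuousOn (rightExt f c e) (Ici c) := by
  intro x hx
  rcases (mem_Ici.1 hx).eq_or_lt with rfl | hcx
  · have h1 := h.continuousOn c (left_mem_Icc.2 h.lt.le)
    have h2 : ContinuousWithinAt f (Ici c) c :=
      h1.mono_of_mem_nhdsWithin (Icc_mem_nhdsGE h.lt)
    refine h2.congr_of_eventuallyEq ?_ (rightExt_eqOn f c e h.lt.le)
    filter_upwards [mem_nhdsWithin_of_mem_nhds (Iic_mem_nhds h.lt)] with y hy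
      using rightExt_eqOn f c e hy
  · exact (h.hasDerivAt_rightExt hcx).continuousAt.continuousWithinAt

theorem rightExtDeriv_neg (h : HalfOrder f c e ℓ) (hs : ∀ x ∈ Ioc c e, derivWithin f (Ioc c e) x < 0)
    {x : ℝ} (hx : c < x) : rightExtDeriv f c e x < 0 := by
  rcases le_total x e with hxe | hxe
  · rw [rightExtDeriv, if_pos hxe]
    exact hs x ⟨hx, hxe⟩
  · rw [rightExtDeriv_of_le f c hxe]
    linarith [hs e ⟨h.lt, le_rfl⟩]

theorem strictAntiOn_rightExt (h : HalfOrder f c e ℓ)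
    (hs : ∀ x ∈ Ioc c e, derivWithin f (Ioc c e) x < 0) :
    StrictAntiOn (rightExt f c e) (Ici c) := by
  refine strictAntiOn_of_deriv_neg (convex_Ici c) h.continuousOn_rightExt fun x hx => ?_
  rw [interior_Ici] at hx
  rw [(h.hasDerivAt_rightExt hx).deriv]
  exact h.rightExtDeriv_neg hs hx

/-- The second derivative may jump at `e`, but the logarithm of the derivative is Lipschitz on both
sides and continuous at `e`, which is all the distortion estimates need. -/
theorem logDerivLip_rightExt (h : HalfOrder f c e ℓ)
    (hs : ∀ x ∈ Ioc c e, derivWithin f (Ioc c e) x < 0) {u v : ℝ} (hcu : c < u) (huv : u < v) :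
    ∃ C, LogDerivLip (rightExt f c e) u v C := by
  set u' := min u e
  set v' := max v e
  have hcu' : c < u' := lt_min hcu h.lt
  have hsub : Icc u' e ⊆ Ioc c e := fun x hx => ⟨hcu'.trans_le hx.1, hx.2⟩
  obtain ⟨C₁, n₁, l₁⟩ := log_abs_lipschitz (h.contDiffOn_deriv.mono hsub)
    fun x hx => h.deriv_ne x (hsub hx)
  obtain ⟨C₂, n₂, l₂⟩ := log_abs_lipschitz (u := e) (v := v')
    (D := fun x => derivWithin f (Ioc c e) e - 2 * (x - e)) (by fun_prop) fun x hx => by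
      have := hs e ⟨h.lt, le_rfl⟩
      have := hx.1
      linarith
  have hue : u' ≤ e := min_le_right _ _
  have hev : e ≤ v' := le_max_right _ _
  have hu : u' ≤ u := min_le_left _ _
  have hv : v ≤ v' := le_max_left _ _
  have key := sub_le_of_glue (L := fun x => Real.log |rightExtDeriv f c e x|) (S := Icc u' e)
    (T := Icc e v') (w := e) (C₁ := C₁) (C₂ := C₂) ⟨right_mem_Icc.2 hue, left_mem_Icc.2 hev⟩
    (fun x hx y hy => by
      simp only [rightExtDeriv, if_pos hx.2, if_pos hy.2]
      exact l₁ x hx y hy)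
    (fun x hx y hy => by
      simp only [rightExtDeriv_of_le f c hx.1, rightExtDeriv_of_le f c hy.1]
      exact l₂ x hx y hy)
    n₁ n₂ (fun x hx => by
      rw [Icc_union_Icc_eq_Icc hue hev] at hx
      exact ⟨fun hw => ⟨hx.1, hw⟩, fun hw => ⟨hw, hx.2⟩⟩)
  rw [Icc_union_Icc_eq_Icc hue hev] at key
  refine ⟨C₁ + C₂, LogDerivLip.of_hasDerivAt (D := rightExtDeriv f c e) huv (by linarith)
    (h.continuousOn_rightExt.mono fun x hx => hcu.le.trans hx.1)
    (fun x hx => h.hasDerivAt_rightExt (hcu.trans hx.1))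
    (fun x hx => (h.rightExtDeriv_neg hs (hcu.trans hx.1)).ne) fun x hx y hy => ?_⟩
  exact key x ⟨hu.trans hx.1.le, hx.2.le.trans hv⟩ y ⟨hu.trans hy.1.le, hy.2.le.trans hv⟩

theorem rightBranch_rightExt (h : HalfOrder f c e ℓ)
    (hs : ∀ x ∈ Ioc c e, derivWithin f (Ioc c e) x < 0) {F : ℝ → ℝ}
    (hF : EqOn F (rightExt f c e) (Ici c)) {b : ℝ} (hcb : c < b) : RightBranch F c b ℓ := by
  have hFc : F c = f c := (hF self_mem_Ici).trans (rightExt_eqOn f c e h.lt.le)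
  have hanti : StrictAntiOn F (Ici c) := (h.strictAntiOn_rightExt hs).congr hF.symm
  refine ⟨hcb, h.one_le,
    hanti.mono Icc_subset_Ici_self, fun u hu => ?_, ?_⟩
  · obtain ⟨C, hC⟩ := h.logDerivLip_rightExt hs hu.1 hu.2
    exact ⟨C, hC.congr fun x hx => hF (hu.1.le.trans hx.1)⟩
  · obtain ⟨φ, ψ, h1, h2, h3, h4, h5, h6, h7⟩ := h.crit_signed
    have h8 : ∀ᶠ x in 𝓝[≥] c, x ≤ e := mem_nhdsWithin_of_mem_nhds (Iic_mem_nhds h.lt)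
    obtain ⟨v, hv, hsub⟩ := mem_nhdsGE_iff_exists_Icc_subset.1 (h7.and h8)
    have hψ : StrictAnti ψ := strictAnti_of_deriv_neg h4
    have hφ : StrictMono φ := strictMono_of_deriv_pos h3
    refine ⟨φ, ψ, v - c, h1, h2, h3, h4, h5, by rw [hFc, h6], sub_pos.2 hv, fun x hx => ?_⟩
    obtain ⟨e1, e2⟩ := hsub ⟨hx.1, by linarith [hx.2]⟩
    rw [hF hx.1, rightExt_eqOn f c e e2]
    have hle : f x ≤ f c := by
      have := hanti.antitoneOn self_mem_Ici (mem_Ici.2 hx.1) hx.1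
      rwa [hFc, hF hx.1, rightExt_eqOn f c e e2] at this
    have p1 : 0 ≤ ψ (f x) := h6 ▸ hψ.antitone hle
    have p2 : 0 ≤ φ x := h5 ▸ hφ.monotone hx.1
    rwa [abs_of_nonneg p1, abs_of_nonneg p2] at e1

end HalfOrder

/-! ### Reduction of the theorem to wandering systems -/

theorem Diffeomorph.deriv_ne_zero (φ : Diffeomorph 𝓘(ℝ, ℝ) 𝓘(ℝ, ℝ) ℝ ℝ 2) (x : ℝ) :
    deriv φ x ≠ 0 := by
  intro h0
  have h1 : HasDerivAt φ (deriv φ x) x :=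
    (φ.contDiff.differentiable (by norm_num) x).hasDerivAt
  have h2 : HasDerivAt φ.symm (deriv φ.symm (φ x)) (φ x) :=
    (φ.symm.contDiff.differentiable (by norm_num) (φ x)).hasDerivAt
  have h3 := h2.comp x h1
  have h4 : (φ.symm ∘ φ : ℝ → ℝ) = id := funext fun y => φ.symm_apply_apply y
  rw [h4, h0, mul_zero] at h3
  exact zero_ne_one (h3.unique (hasDerivAt_id x))

theorem halfOrder_right {f : ℝ → ℝ} {c ℓ : ℝ} (hc : c ∈ Ioo (0 : ℝ) 1)
    (hd : ContDiffOn ℝ 2 f (Icc 0 1 \ {c}))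
    (h0 : ∀ x ∈ Icc (0 : ℝ) 1 \ {c}, derivWithin f (Icc 0 1) x ≠ 0) (hℓ : 1 ≤ ℓ)
    (h : HasCriticalOrder 2 f c ℓ (Ici c)) : HalfOrder f c 1 ℓ := by
  have hsub : Ioc c 1 ⊆ Icc 0 1 \ {c} := fun x hx => ⟨⟨(hc.1.trans hx.1).le, hx.2⟩, hx.1.ne'⟩
  refine ⟨hc.2, hℓ, hd.mono hsub, fun x hx => ?_, ?_⟩
  · have h1 := (differentiableWithinAt_of_derivWithin_ne_zero (h0 x (hsub hx))).hasDerivWithinAt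
    rw [(h1.mono fun y hy => (hsub hy).1).derivWithin (uniqueDiffOn_Ioc _ _ x hx)]
    exact h0 x (hsub hx)
  · obtain ⟨φ, ψ, h1, h2, U, hU, h3⟩ := h
    refine ⟨φ, ψ, φ.contDiff, ψ.contDiff, φ.deriv_ne_zero, ψ.deriv_ne_zero, h1, h2, ?_⟩
    filter_upwards [mem_nhdsWithin_of_mem_nhds hU, self_mem_nhdsWithin] with x hx hxc using h3 x hx hxc

theorem halfOrder_left {f : ℝ → ℝ} {c ℓ : ℝ} (hc : c ∈ Ioo (0 : ℝ) 1)
    (hd : ContDiffOn ℝ 2 f (Icc 0 1 \ {c}))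
    (h0 : ∀ x ∈ Icc (0 : ℝ) 1 \ {c}, derivWithin f (Icc 0 1) x ≠ 0) (hℓ : 1 ≤ ℓ)
    (h : HasCriticalOrder 2 f c ℓ (Iic c)) : HalfOrder (fun x => f (2 * c - x)) c (2 * c) ℓ := by
  have hsub : MapsTo (fun x => 2 * c - x) (Ioc c (2 * c)) (Icc 0 1 \ {c}) := fun x hx =>
    ⟨⟨by linarith [hx.2], by linarith [hx.1, hc.2]⟩, ne_of_lt (by linarith [hx.1])⟩
  refine ⟨by linarith [hc.1], hℓ, hd.comp (contDiff_const.sub contDiff_id).contDiffOn hsub,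
    fun x hx => ?_, ?_⟩
  · have h1 := (differentiableWithinAt_of_derivWithin_ne_zero (h0 _ (hsub hx))).hasDerivWithinAt
    have h2 := (h1.comp x ((hasDerivWithinAt_id x (Ioc c (2 * c))).const_sub (2 * c))
      fun y hy => (hsub hy).1).derivWithin (uniqueDiffOn_Ioc _ _ x hx)
    have h3 : derivWithin (fun x => f (2 * c - x)) (Ioc c (2 * c)) x = _ := h2
    rw [h3]
    simpa using h0 _ (hsub hx)
  · obtain ⟨φ, ψ, h1, h2, U, hU, h3⟩ := h
    refine ⟨fun x => φ (2 * c - x), ψ, φ.contDiff.comp (contDiff_const.sub contDiff_id),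
      ψ.contDiff, fun x => ?_, ψ.deriv_ne_zero, ?_, ?_, ?_⟩
    · rw [deriv_comp_const_sub]
      exact neg_ne_zero.2 (φ.deriv_ne_zero _)
    · simp only [two_mul, add_sub_cancel_right, h1]
    · simp only [two_mul, add_sub_cancel_right, h2]
    · have ht : Tendsto (fun x => 2 * c - x) (𝓝 c) (𝓝 c) := by
        have : Tendsto (fun x => 2 * c - x) (𝓝 c) (𝓝 (2 * c - c)) :=
          (continuous_const.sub continuous_id).tendsto _
        rwa [two_mul, add_sub_cancel_right, ← two_mul] at this
      filter_upwards [mem_nhdsWithin_of_mem_nhds (ht hU), self_mem_nhdsWithin] with x hx hxc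
      have hxc : c ≤ x := hxc
      exact h3 _ hx (mem_Iic.2 (by linarith))

theorem HalfOrder.deriv_neg {f : ℝ → ℝ} {c e ℓ : ℝ} (h : HalfOrder f c e ℓ)
    (ha : StrictAntiOn f (Icc c e)) : ∀ x ∈ Ioc c e, derivWithin f (Ioc c e) x < 0 := by
  rcases h.strictAntiOn_or_strictMonoOn with hs | hs
  · exact hs.2
  · have h1 := left_mem_Icc.2 h.lt.le
    have h2 := right_mem_Icc.2 h.lt.le
    exact absurd (ha h1 h2 h.lt) (hs h1 h2 h.lt).not_gt

theorem false_of_wandering_of_max {f : ℝ → ℝ} {c ℓm ℓp : ℝ} {J : Set ℝ} (hc : c ∈ Ioo (0 : ℝ) 1)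
    (hf : MapsTo f (Icc 0 1) (Icc 0 1)) (hr : HalfOrder f c 1 ℓp)
    (hl : HalfOrder (fun x => f (2 * c - x)) c (2 * c) ℓm) (ar : StrictAntiOn f (Icc c 1))
    (al : StrictAntiOn (fun x => f (2 * c - x)) (Icc c (2 * c))) (hJ : J ⊆ Icc 0 1)
    (hord : J.OrdConnected) (hnt : J.Nontrivial)
    (hdisj : ∀ m n : ℕ, m ≠ n → Disjoint (f^[m] '' J) (f^[n] '' J))
    (hnp : ∀ x ∈ J, NoInjectiveReturnUnit f x) : False := by
  set g : ℝ → ℝ := fun x => f (2 * c - x) with hg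
  set F : ℝ → ℝ := fun x => if x ≤ c then rightExt g c (2 * c) (2 * c - x) else rightExt f c 1 x
    with hF
  have hgc : g c = f c := by rw [hg]; simp only [two_mul, add_sub_cancel_right]
  have hFl' : ∀ x ≤ c, F x = rightExt g c (2 * c) (2 * c - x) := fun x hx => if_pos hx
  have hFr : EqOn F (rightExt f c 1) (Ici c) := by
    intro x hx
    rcases (mem_Ici.1 hx).eq_or_lt with rfl | hx
    · rw [hFl' c le_rfl, HalfOrder.rightExt_eqOn f c 1 hc.2.le,
        HalfOrder.rightExt_eqOn g c (2 * c) (mem_Iic.2 (by linarith [hc.1]))]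
      simp [hg]
    · exact if_neg hx.not_ge
  have hFl : EqOn (fun x => F (2 * c - x)) (rightExt g c (2 * c)) (Ici c) := by
    intro x hx
    have hx : c ≤ x := hx
    simp only
    rw [hFl' _ (by linarith), sub_sub_cancel]
  have hFf : EqOn F f (Icc 0 1) := by
    intro x hx
    rcases le_total x c with hxc | hxc
    · rw [hFl' x hxc, HalfOrder.rightExt_eqOn g c (2 * c) (mem_Iic.2 (by linarith [hx.1])), hg]
      simp only [sub_sub_cancel]
    · rw [hFr hxc, HalfOrder.rightExt_eqOn f c 1 hx.2]
  have hcont : Continuous F := by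
    rw [← continuousOn_univ, ← Iic_union_Ici (a := c)]
    refine ContinuousOn.union_of_isClosed ?_ (hr.continuousOn_rightExt.congr hFr) isClosed_Iic
      isClosed_Ici
    exact (hl.continuousOn_rightExt.comp (by fun_prop : ContinuousOn (fun x => 2 * c - x) (Iic c))
      fun x hx => mem_Ici.2 (by linarith [mem_Iic.1 hx])).congr hFl'
  have dr := hr.deriv_neg ar
  have dl := hl.deriv_neg al
  have hanti : StrictAntiOn F (Ici c) := (hr.strictAntiOn_rightExt dr).congr hFr.symm
  have hmono : StrictMonoOn F (Iic c) := by
    intro x hx y hy hxy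
    have hx := mem_Iic.1 hx
    have hy := mem_Iic.1 hy
    rw [hFl' x hx, hFl' y hy]
    exact hl.strictAntiOn_rightExt dl (mem_Ici.2 (by linarith)) (mem_Ici.2 (by linarith))
      (by linarith)
  have m0 := hf (left_mem_Icc.2 (zero_le_one' ℝ))
  have m1 := hf (right_mem_Icc.2 (zero_le_one' ℝ))
  have f0 : 0 ≤ F 0 := by rw [hFf (left_mem_Icc.2 zero_le_one)]; exact m0.1
  have f1 : 0 ≤ F 1 := by rw [hFf (right_mem_Icc.2 zero_le_one)]; exact m1.1
  -- Two units beyond the end the quadratic has lost at least 4 from a value at most 1. This room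
  -- yields a fixed point `a ≤ 0` on the left and a preimage `b ≥ 1` of it on the right.
  have fneg : F (-2) ≤ -2 := by
    rw [hFl' _ (by linarith [hc.1]), HalfOrder.rightExt_of_le g c (by linarith)]
    have e1 : g (2 * c) = f 0 := by simp [hg]
    have := dl (2 * c) ⟨hl.lt, le_rfl⟩
    rw [e1]
    nlinarith [m0.2]
  have fpos : F 3 ≤ -2 := by
    rw [hFr (mem_Ici.2 (by linarith [hc.2])), HalfOrder.rightExt_of_le f c (by norm_num)]
    have := dr 1 ⟨hc.2, le_rfl⟩
    nlinarith [m1.2]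
  obtain ⟨a, ha, hFa⟩ : ∃ a ∈ Icc (-2 : ℝ) 0, F a - a = 0 :=
    intermediate_value_Icc (f := fun x => F x - x) (by norm_num)
      (hcont.sub continuous_id).continuousOn ⟨by linarith, by linarith⟩
  obtain ⟨b, hb, hFb⟩ : ∃ b ∈ Icc (1 : ℝ) 3, F b = a :=
    intermediate_value_Icc' (by norm_num) hcont.continuousOn ⟨by linarith [ha.1], by linarith [ha.2]⟩
  have hcmem : c ∈ Icc (0 : ℝ) 1 := Ioo_subset_Icc_self hc
  have hU : UnimodalSystem F a c b :=
    { cont := hcont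
      mono := hmono
      anti := hanti
      lt_left := by linarith [ha.2, hc.1]
      lt_right := by linarith [hb.1, hc.2]
      left_fixed := by linarith
      right_image := hFb
      peak_le := by rw [hFf hcmem]; linarith [(hf hcmem).2, hb.1] }
  obtain ⟨⟨C, hC, hCR⟩, hD, ℓ, K, η, hpow⟩ := hU.exists_bounds
    (hr.rightBranch_rightExt dr hFr hU.lt_right)
    (hl.rightBranch_rightExt dl hFl (by linarith [hU.lt_left]))
  have himage : ∀ n, F^[n] '' J = f^[n] '' J := fun n =>
    ((iterate_eqOn_of_eqOn hf hFf n).mono hJ).image_eq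
  obtain ⟨α, β, x, hW⟩ := hU.exists_wanderingSystem
    (hJ.trans (Icc_subset_Icc ha.2 hb.1)) hord hnt (by simpa only [himage] using hdisj)
    fun x hx => (hnp x hx).extend hf hFf (hJ hx)
  exact hW.false_of_bounds hC hCR hD hpow

theorem mainTheorem1 (f : ℝ → ℝ) (hf : f ∈ UnimodalMaps 2) :
    ¬ ∃ J : Set ℝ, IsWanderingInterval f J := by
  rintro ⟨J, hJ, hord, hnt, hdisj, hper⟩
  obtain ⟨hmaps, c, hc, hd, h0, ℓm, ℓp, hm, hp, hcm, hcp⟩ := hf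
  have hr := halfOrder_right hc hd h0 hp hcp
  have hl := halfOrder_left hc hd h0 hm hcm
  set g : ℝ → ℝ := fun x => f (2 * c - x) with hg
  have hfg : ∀ x, f x = g (2 * c - x) := fun x => by simp [hg]
  have hrefl : MapsTo (fun x => 2 * c - x) (Icc 0 c) (Icc c (2 * c)) := fun x hx =>
    ⟨by linarith [hx.2], by linarith [hx.1]⟩
  have hcont : ContinuousOn f (Icc 0 1) := by
    rw [← Icc_union_Icc_eq_Icc hc.1.le hc.2.le]
    refine ContinuousOn.union_of_isClosed ?_ hr.continuousOn isClosed_Icc isClosed_Icc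
    exact (hl.continuousOn.comp (by fun_prop : ContinuousOn (fun x => 2 * c - x) (Icc 0 c))
      hrefl).congr fun x _ => hfg x
  have hnp : ∀ x ∈ J, NoInjectiveReturnUnit f x := fun x hx =>
    noInjectiveReturnUnit_of_not_isPeriodicOrbit hmaps hcont (hJ hx) (hper x hx)
  obtain ⟨x₀, hx₀⟩ := hnt.nonempty
  have hninj := (hnp x₀ hx₀).not_injOn hmaps (hJ hx₀)
  have hgt : IsGreatest (Icc 0 c) c := isGreatest_Icc hc.1.le
  have hlt : IsLeast (Icc c 1) c := isLeast_Icc hc.2.le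
  -- Both `ar` and `al` describe the behaviour moving away from `c`. Two decreasing branches mean a
  -- maximum and two increasing ones a minimum; in the mixed cases `f` is injective, which has been
  -- excluded.
  rcases hr.strictAntiOn_or_strictMonoOn with ⟨ar, -⟩ | ar <;>
    rcases hl.strictAntiOn_or_strictMonoOn with ⟨al, -⟩ | al
  · exact false_of_wandering_of_max hc hmaps hr hl ar al hJ hord hnt hdisj hnp
  · have h1 : StrictAntiOn f (Icc 0 c) := fun x hx y hy hxy => by
      rw [hfg x, hfg y]
      exact al (hrefl hy) (hrefl hx) (by linarith)
    have h2 := h1.union ar hgt hlt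
    rw [Icc_union_Icc_eq_Icc hc.1.le hc.2.le] at h2
    exact hninj h2.injOn
  · have h1 : StrictMonoOn f (Icc 0 c) := fun x hx y hy hxy => by
      rw [hfg x, hfg y]
      exact al (hrefl hy) (hrefl hx) (by linarith)
    have h2 := h1.union ar hgt hlt
    rw [Icc_union_Icc_eq_Icc hc.1.le hc.2.le] at h2
    exact hninj h2.injOn
  -- Conjugation by `x ↦ 1 - x` turns the minimum at `c` into a maximum at `1 - c` and exchanges the
  -- two critical orders.
  · set k : ℝ → ℝ := fun x => 1 - f (1 - x) with hk
    have hflip : MapsTo (fun x : ℝ => 1 - x) (Icc 0 1) (Icc 0 1) := fun x hx =>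
      ⟨by linarith [hx.2], by linarith [hx.1]⟩
    have kr : HalfOrder k (1 - c) 1 ℓm := by
      have := hl.congr_shift (g := k) (t := 1 - 2 * c) fun x => by
        simp only [hk, hg]
        ring_nf
      rwa [show c + (1 - 2 * c) = 1 - c by ring, show 2 * c + (1 - 2 * c) = 1 by ring] at this
    have kl : HalfOrder (fun x => k (2 * (1 - c) - x)) (1 - c) (2 * (1 - c)) ℓp := by
      have := hr.congr_shift (g := fun x => k (2 * (1 - c) - x)) (t := 1 - 2 * c) fun x => by
        simp only [hk]
        ring_nf
      rwa [show c + (1 - 2 * c) = 1 - c by ring, show 1 + (1 - 2 * c) = 2 * (1 - c) by ring] at this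
    have himage : ∀ n, k^[n] '' ((fun x => 1 - x) '' J) = (fun x => 1 - x) '' (f^[n] '' J) := by
      intro n
      rw [image_image, image_image]
      refine image_congr fun x _ => ?_
      rw [hk, iterate_reflect, sub_sub_cancel]
    refine false_of_wandering_of_max (f := k) (c := 1 - c) (J := (fun x => 1 - x) '' J)
      ⟨by linarith [hc.2], by linarith [hc.1]⟩ (fun x hx => hflip (hmaps (hflip hx))) kr kl
      (fun x hx y hy hxy => ?_) (fun x hx y hy hxy => ?_) ?_ ?_ ?_ (fun m n hmn => ?_) ?_
    · have := al (a := 2 * c - 1 + x) ⟨by linarith [hx.1], by linarith [hx.2]⟩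
        (b := 2 * c - 1 + y) ⟨by linarith [hy.1], by linarith [hy.2]⟩ (by linarith)
      simp only [hg] at this
      simp only [hk]
      ring_nf at this ⊢
      linarith
    · have := ar (a := 2 * c - 1 + x) ⟨by linarith [hx.1], by linarith [hx.2]⟩
        (b := 2 * c - 1 + y) ⟨by linarith [hy.1], by linarith [hy.2]⟩ (by linarith)
      simp only [hk]
      ring_nf at this ⊢
      linarith
    · exact (hflip.mono_left hJ).image_subset
    · refine ⟨?_⟩
      rintro _ ⟨x, hx, rfl⟩ _ ⟨y, hy, rfl⟩ z hz
      exact ⟨1 - z, hord.out hy hx ⟨by linarith [hz.2], by linarith [hz.1]⟩, by ring⟩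
    · exact hnt.image fun x y hxy => by linarith
    · rw [himage, himage]
      exact (disjoint_image_iff fun x y hxy => by linarith).2 (hdisj m n hmn)
    · rintro _ ⟨x, hx, rfl⟩
      exact (hnp x hx).reflect
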